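/- **Setting.** Let $M=(\mathcal S,\mathcal A,P,r,H,d_1)$ be a finite-horizon time-inhomogeneous MDP with finite state space of size $S$, finite action space of size $A$, horizon $H\ge 1$, transition kernels $P_h(\cdot\mid s,a)$, initial distribution $d_1$, and random rewards $r_h\in[0,1]$ which, given $(s_h,a_h)$, are independent of everything else, in particular of $s_{h+1}$; $r_h(s,a)$ is the mean reward. For a (randomized, Markov, nonstationary) policy $\pi$ let $v^\pi=\mathbb E_\pi[\sum_{h=1}^H r_h]$, $v^\star=\sup_\pi v^\pi$, $d^\pi_h(s,a)=\mathbb P_\pi[s_h=s]\,\pi_h(a\mid s)$. Let $V^\star_{H+1}=0$, $V^\star_h(s)=\max_a\big(r_h(s,a)+\sum_{s'}P_h(s'\mid s,a)V^\star_{h+1}(s')\big)$, and let $$\mathbb Q^\star_h=\max_{s,a}\mathrm{Var}\big(r_h+V^\star_{h+1}(s_{h+1})\,\big|\,s_h=s,a_h=a\big)$$ be the per-step environmental norm. **Data.** $\mathcal D$ consists of $n$ independent episodes $(s^\tau_h,a^\tau_h,r^\tau_h,s^\tau_{h+1})_{h\le H}$ rolled out by a behavior policy $\mu$. Put $\bar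 d_m=\min\{d^\mu_h(s,a):h,s,a,\ d^\mu_h(s,a)>0\}$. *Uniform coverage* means that $d^\mu_h(s,a)>0$ for all $h$, all actions $a$, and all states $s$ that some policy reaches at time $h$ with positive probability. **Algorithm (APVI).** Fix $\delta\in(0,1)$ and $C>0$, and let $\iota=\log(HSA/\delta)$. Let $n_h(s,a)$ be the number of episodes with $(s^\tau_h,a^\tau_h)=(s,a)$, and let $\widehat P_h(\cdot\mid s,a)$, $\widehat r_h(s,a)$ be the empirical transition frequencies and the empirical mean reward at $(s,a)$ at time $h$ ($1/S$ and $0$ if $n_h(s,a)=0$). Start with $\widehat V_{H+1}=0$; for $h=H,\dots,1$ put $$\Gamma_h(s,a)=2\sqrt{\frac{\widehat{\mathrm{Var}}_{h,s,a}(r+\widehat V_{h+1})\,\iota}{n_h(s,a)}}+\frac{14H\iota}{n_h(s,a)}\ \text{ if } n_h(s,a)\ge1,\qquad \Gamma_h(s,a)=CH\iota\ \text{ otherwise},$$ $$\overline Q_h=\max\Big\{0,\min\big\{\widehat r_h+\widehat P_h\widehat V_{h+1}-\Gamma_h,\;H-h+1\big\}\Big\},$$ where $\widehat{\mathrm{Var}}_{h,s,a}(r+\widehat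 V_{h+1})$ is the empirical variance of the rewards observed at $(s,a)$ at time $h$ plus the variance of $\widehat V_{h+1}(s')$ under $s'\sim\widehat P_h(\cdot\mid s,a)$. For every $s$ let $\widehat\pi_h(\cdot\mid s)$ be any distribution on $\mathcal A$ that maximizes $p\mapsto\langle\overline Q_h(s,\cdot),p\rangle$, and set $\widehat V_h(s)=\langle\overline Q_h(s,\cdot),\widehat\pi_h(\cdot\mid s)\rangle$. The output is $\widehat\pi=(\widehat\pi_1,\dots,\widehat\pi_H)$. **Proposition.** There are absolute constants $c_0,C_1,C_2>0$ such that for every such MDP $M$, every behavior policy $\mu$ satisfying uniform coverage, all $\delta\in(0,1)$ and $C>0$, and every $n>c_0\,\iota/\bar d_m$, the following hold. 1. If $\mathcal B\in\mathbb R$ is such that under every policy $\sum_{h=1}^H r_h\le\mathcal B$ almost surely, then with probability at least $1-\delta$ every output $\widehat\pi$ of APVI (however ties are broken) satisfies $$0\le v^\star-v^{\widehat\pi}\le C_1\min\left\{\sum_{h=1}^H\sqrt{\frac{\mathbb Q^\star_h\,\iota}{n\bar d_m}},\ \sqrt{\frac{H\mathcal B^2\,\iota}{n\bar d_m}}\right\}+C_2\,\frac{H^3\,\iota}{n\bar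 d_m}.$$ 2. If all transitions and all rewards of $M$ are deterministic, then $\mathbb Q^\star_h=0$ for all $h$, and with probability at least $1-\delta$ every output of APVI satisfies $0\le v^\star-v^{\widehat\pi}\le C_2H^3\iota/(n\bar d_m)$. -/

import Mathlib

open MeasureTheory

noncomputable section

/-- A finite-horizon, time-inhomogeneous tabular MDP.  Times are `0, …, H - 1` (the usual
`1, …, H`).  `R h s a` is the law of the realized reward `r_h` given `(s_h, a_h) = (s, a)`. -/
structure EpisodicMDP (S A : Type*) [Fintype S] (H : ℕ) where
  d₁ : S → ℝ
  d₁_nonneg : ∀ s, 0 ≤ d₁ s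
  d₁_sum : ∑ s, d₁ s = 1
  P : Fin H → S → A → S → ℝ
  P_nonneg : ∀ h s a s', 0 ≤ P h s a s'
  P_sum : ∀ h s a, ∑ s', P h s a s' = 1
  R : Fin H → S → A → ProbabilityMeasure ℝ
  R_mem : ∀ h s a, ∀ᵐ x ∂(R h s a : Measure ℝ), x ∈ Set.Icc (0 : ℝ) 1

/-- A (randomized, nonstationary Markov) policy: `prob h s a` is `π_h(a | s)`. -/
structure Policy (S A : Type*) [Fintype A] (H : ℕ) where
  prob : Fin H → S → A → ℝ
  nonneg : ∀ h s a, 0 ≤ prob h s a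
  sum_one : ∀ h s, ∑ a, prob h s a = 1

/-- An episode: the states `s_1, …, s_{H+1}`, the actions `a_1, …, a_H` and the realized
rewards `r_1, …, r_H`. -/
abbrev Episode (S A : Type*) (H : ℕ) : Type _ :=
  (Fin (H + 1) → S) × (Fin H → A) × (Fin H → ℝ)

namespace Episode

variable {S A : Type*} {H : ℕ}

def state (e : Episode S A H) (h : Fin (H + 1)) : S := e.1 h

def action (e : Episode S A H) (h : Fin H) : A := e.2.1 h

def reward (e : Episode S A H) (h : Fin H) : ℝ := e.2.2 h

def totalReward (e : Episode S A H) : ℝ := ∑ h, e.reward h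

end Episode

namespace EpisodicMDP

variable {S A : Type*} [Fintype S] [Fintype A] {H : ℕ}

/-- The probability of the state-action path `s_1, a_1, …, s_H, a_H, s_{H+1}` under `π`. -/
def pathProb (M : EpisodicMDP S A H) (π : Policy S A H)
    (s : Fin (H + 1) → S) (a : Fin H → A) : ℝ :=
  M.d₁ (s 0) * ∏ h : Fin H,
    (π.prob h (s h.castSucc) (a h) * M.P h (s h.castSucc) (a h) (s h.succ))

/-- The law of the episode rolled out by `π`: the state-action path has the probabilities
`pathProb`, and given the path the rewards are independent with `r_h ∼ R h s_h a_h`. -/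
def episodeLaw [MeasurableSpace S] [MeasurableSpace A]
    (M : EpisodicMDP S A H) (π : Policy S A H) : Measure (Episode S A H) :=
  ∑ s : Fin (H + 1) → S, ∑ a : Fin H → A,
    ENNReal.ofReal (M.pathProb π s a) •
      (Measure.dirac s).prod ((Measure.dirac a).prod
        (Measure.pi fun h => (M.R h (s h.castSucc) (a h) : Measure ℝ)))

/-- The law of `n` independent episodes rolled out by `μ`. -/
def dataLaw [MeasurableSpace S] [MeasurableSpace A]
    (M : EpisodicMDP S A H) (μ : Policy S A H) (n : ℕ) : Measure (Fin n → Episode S A H) :=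
  Measure.pi fun _ => M.episodeLaw μ

/-- The performance `v^π = 𝔼_π[r_1 + ⋯ + r_H]`. -/
def performance [MeasurableSpace S] [MeasurableSpace A]
    (M : EpisodicMDP S A H) (π : Policy S A H) : ℝ :=
  ∫ e, e.totalReward ∂(M.episodeLaw π)

/-- The optimal performance `v^⋆`. -/
def optPerformance [MeasurableSpace S] [MeasurableSpace A] (M : EpisodicMDP S A H) : ℝ :=
  ⨆ π : Policy S A H, M.performance π

/-- `ℙ_π[s_h = s]`. -/
def stateProb [MeasurableSpace S] [MeasurableSpace A]
    (M : EpisodicMDP S A H) (π : Policy S A H) (h : Fin H) (s : S) : ℝ :=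
  (M.episodeLaw π).real {e | e.state h.castSucc = s}

/-- The marginal state-action occupancy `d^π_h(s, a)`. -/
def occupancy [MeasurableSpace S] [MeasurableSpace A]
    (M : EpisodicMDP S A H) (π : Policy S A H) (h : Fin H) (s : S) (a : A) : ℝ :=
  M.stateProb π h s * π.prob h s a

/-- Uniform data coverage: `d^μ_h(s, a) > 0` for every action `a` and every state `s` that some
policy can reach at time `h`.  (The minimum of these finitely many numbers is positive.) -/
def UniformCoverage [MeasurableSpace S] [MeasurableSpace A]
    (M : EpisodicMDP S A H) (μ : Policy S A H) : Prop :=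
  ∀ h s, (∃ π : Policy S A H, 0 < M.stateProb π h s) → ∀ a, 0 < M.occupancy μ h s a

/-- The smallest positive occupancy of `μ`. -/
def minOccupancy [MeasurableSpace S] [MeasurableSpace A]
    (M : EpisodicMDP S A H) (μ : Policy S A H) : ℝ :=
  sInf {x | 0 < x ∧ ∃ h s a, x = M.occupancy μ h s a}

/-- The mean reward `r_h(s, a)`. -/
def meanReward (M : EpisodicMDP S A H) (h : Fin H) (s : S) (a : A) : ℝ :=
  ∫ x, x ∂(M.R h s a : Measure ℝ)

/-- The Bellman update `r_h(s, a) + ∑ s', P_h(s' | s, a) V(s')`. -/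
def bellman (M : EpisodicMDP S A H) (h : Fin H) (V : S → ℝ) (s : S) (a : A) : ℝ :=
  M.meanReward h s a + ∑ s', M.P h s a s' * V s'

/-- The optimal value functions: `V^⋆_{H+1} = 0` and
`V^⋆_h(s) = max_a (r_h(s, a) + (P_h V^⋆_{h+1})(s, a))`. -/
def optValue (M : EpisodicMDP S A H) : Fin (H + 1) → S → ℝ :=
  Fin.reverseInduction (motive := fun _ => S → ℝ) (fun _ => 0)
    (fun h V s => ⨆ a, M.bellman h V s a)

/-- `Var(r_h + V(s_{h+1}))` given `(s_h, a_h) = (s, a)`, where `r_h ∼ R h s a` and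
`s_{h+1} ∼ P_h(· | s, a)` are independent. -/
def stepVariance (M : EpisodicMDP S A H) (h : Fin H) (V : S → ℝ) (s : S) (a : A) : ℝ :=
  ∫ x, ∑ s', M.P h s a s' * (x + V s' - M.bellman h V s a) ^ 2 ∂(M.R h s a : Measure ℝ)

/-- The per-step environmental norm `ℚ^⋆_h = max_{s,a} Var(r_h + V^⋆_{h+1})`. -/
def envNorm (M : EpisodicMDP S A H) (h : Fin H) : ℝ :=
  ⨆ x : S × A, M.stepVariance h (M.optValue h.succ) x.1 x.2

/-- Whatever the policy, the total reward of an episode is almost surely at most `B`. -/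
def TotalRewardLE [MeasurableSpace S] [MeasurableSpace A]
    (M : EpisodicMDP S A H) (B : ℝ) : Prop :=
  ∀ π : Policy S A H, ∀ᵐ e ∂(M.episodeLaw π), e.totalReward ≤ B

/-- All transitions and all rewards are deterministic. -/
def IsDeterministic (M : EpisodicMDP S A H) : Prop :=
  ∀ h s a, (∃ s', M.P h s a s' = 1) ∧ ∃ x : ℝ, (M.R h s a : Measure ℝ) = Measure.dirac x

end EpisodicMDP

namespace APVI

variable {S A : Type*} [Fintype S] [Fintype A] [DecidableEq S] [DecidableEq A] {H n : ℕ}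

/-- The number of episodes that visit `(s, a)` at time `h`. -/
def count (D : Fin n → Episode S A H) (h : Fin H) (s : S) (a : A) : ℕ :=
  ∑ τ, if (D τ).state h.castSucc = s ∧ (D τ).action h = a then 1 else 0

/-- The empirical transition kernel (uniform where there is no data). -/
def transHat (D : Fin n → Episode S A H) (h : Fin H) (s : S) (a : A) (s' : S) : ℝ :=
  if count D h s a = 0 then 1 / (Fintype.card S : ℝ) else
    (∑ τ, if (D τ).state h.succ = s' ∧ (D τ).state h.castSucc = s ∧ (D τ).action h = a
      then (1 : ℝ) else 0) / (count D h s a : ℝ)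

/-- The empirical mean reward (zero where there is no data). -/
def rewardHat (D : Fin n → Episode S A H) (h : Fin H) (s : S) (a : A) : ℝ :=
  if count D h s a = 0 then 0 else
    (∑ τ, if (D τ).state h.castSucc = s ∧ (D τ).action h = a
      then (D τ).reward h else 0) / (count D h s a : ℝ)

/-- The empirical variance of the rewards observed at `(s, a)` at time `h`. -/
def rewardVarHat (D : Fin n → Episode S A H) (h : Fin H) (s : S) (a : A) : ℝ :=
  (∑ τ, if (D τ).state h.castSucc = s ∧ (D τ).action h = a
    then ((D τ).reward h - rewardHat D h s a) ^ 2 else 0) / (count D h s a : ℝ)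

/-- The variance of `V(s')` for `s' ∼ transHat D h s a`. -/
def valueVarHat (D : Fin n → Episode S A H) (h : Fin H) (V : S → ℝ) (s : S) (a : A) : ℝ :=
  ∑ s', transHat D h s a s' * (V s' - ∑ s'', transHat D h s a s'' * V s'') ^ 2

/-- The variance of `r + V(s')` in the estimated model, where the reward `r` follows the empirical
reward law at `(s, a)` and is independent of `s' ∼ transHat D h s a`. -/
def stepVarHat (D : Fin n → Episode S A H) (h : Fin H) (V : S → ℝ) (s : S) (a : A) : ℝ :=
  rewardVarHat D h s a + valueVarHat D h V s a

/-- The log factor `ι = log (H S A / δ)`. -/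
def logFactor (S A : Type*) [Fintype S] [Fintype A] (H : ℕ) (δ : ℝ) : ℝ :=
  Real.log ((H : ℝ) * (Fintype.card S : ℝ) * (Fintype.card A : ℝ) / δ)

/-- The pessimistic penalty `Γ_h(s, a)`, with the algorithm's constants `C₁ = 2` and `C₂ = 14`;
`C` is the constant of the penalty at unvisited pairs. -/
def bonus (δ C : ℝ) (D : Fin n → Episode S A H) (h : Fin H) (V : S → ℝ) (s : S) (a : A) : ℝ :=
  if count D h s a = 0 then C * (H : ℝ) * logFactor S A H δ else
    2 * √(stepVarHat D h V s a * logFactor S A H δ / (count D h s a : ℝ))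
      + 14 * (H : ℝ) * logFactor S A H δ / (count D h s a : ℝ)

/-- The truncated pessimistic `Q`-function built from the next value function `V`.  At time `h`
(counted from `0`) there are `H - h` rewards to come. -/
def qBar (δ C : ℝ) (D : Fin n → Episode S A H) (h : Fin H) (V : S → ℝ) (s : S) (a : A) : ℝ :=
  max 0 (min (rewardHat D h s a + ∑ s', transHat D h s a s' * V s' - bonus δ C D h V s a)
    ((H : ℝ) - (h : ℕ)))

/-- The value functions computed backwards in time when the policy `π` is selected:
`V_{H+1} = 0` and `V_h(s) = ⟨qBar_h(s, ·), π_h(· | s)⟩`. -/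
def vHat (δ C : ℝ) (D : Fin n → Episode S A H) (π : Policy S A H) : Fin (H + 1) → S → ℝ :=
  Fin.reverseInduction (motive := fun _ => S → ℝ) (fun _ => 0)
    (fun h V s => ∑ a, qBar δ C D h V s a * π.prob h s a)

/-- `π` is a possible output of adaptive pessimistic value iteration on the data `D`: at every time
and state it maximizes `⟨qBar_h(s, ·), p⟩` over the distributions `p` on actions.  Ties may be
broken in any way. -/
def IsOutput (δ C : ℝ) (D : Fin n → Episode S A H) (π : Policy S A H) : Prop :=
  ∀ (h : Fin H) (s : S), ∀ p ∈ stdSimplex ℝ A,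
    ∑ a, qBar δ C D h (vHat δ C D π h.succ) s a * p a ≤
      ∑ a, qBar δ C D h (vHat δ C D π h.succ) s a * π.prob h s a

end APVI

end

/-! Write `V̂` for the value functions of APVI and `η = 5ι/(n d̄_m)`. The core is a one-step
estimate, `GoodAt.abs_qBar_sub_le`: at every pair `(s, a)` covered by `μ`, the truncated `Q̄_h`
differs from the Bellman update `r_h + P_h V̂_{h+1}` by at most a constant times `√(η Var(r_h +
V̂_{h+1})) + Hη`. The estimate is two-sided, so under uniform coverage the sign of the penalty plays
no role.

The difficulty is that `V̂_{h+1}` is computed from the same episodes as `P̂_h`. It is resolved by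
reversing time. `V̂_{h+1}` depends only on what follows `s_{h+1}` in each episode, with `s_{h+1}`
included (`vMax_forget`). Given these futures, the events "episode `τ` visits `(s, a)` at time `h`"
are independent, with probability `backProb` depending only on `s_{h+1}` (`lintegral_visits_forget`,
`lintegral_pi_mark`). Bernstein's inequality thus applies conditionally, with `V̂_{h+1}` and its
variance frozen (`measure_mark_sum_gt_le`). The conditional mean `∑_τ backProb(s_{h+1}^τ)
g(s_{h+1}^τ)` depends on the data only through the numbers of visits to the next states. By Bayes'
rule it would equal `n d_h(s, a) (P_h g)(s, a)` if these numbers were exact, and that vanishes for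
centered `g`. Their relative error is at most `2√η`, which costs `2√η n d_h P_h|g| ≤ 2 n d_h √(η
Var)`, without any factor depending on the number of states (`sum_backProb_mul_sub_le`,
`GoodAt.value_dev`).

The regret is `(V⋆ - V̂) + (V̂ - V^π̂)`. Each bracket is at most the expected sum of the one-step
errors, along an optimal policy and along `π̂` respectively (`polValue_sub_vMax_le`,
`vMax_sub_polValue_le`). The errors still contain variances of `V̂`. A crude bound `H√η` per step
gives `|V̂ - W| ≲ H²√η` for `W = V⋆` and `W = V^π̂`; replacing `V̂` by `W` inside the variances then
costs only `H³η` in total (`stepError_le`). With `W = V⋆` the variances are at most `ℚ⋆_h`. With `W`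
the value function of the policy that is followed, their expected sum is at most `3B²`
(`TotalRewardLE.evalCost_stepVariance_le`), and Cauchy–Schwarz over the `H` steps gives `√(HB²η)`.
In the deterministic case `ℚ⋆ = 0` and only the second-order term remains. -/

noncomputable section

set_option linter.unusedSectionVars false

/-! ### Sums over paths of a finite Markov chain -/

namespace MarkovPath

variable {S : Type*} [Fintype S]

/-- The row vector `d m_0 ⋯ m_{i-1}`. -/
def fwd {H : ℕ} (d : S → ℝ) (m : Fin H → S → S → ℝ) : Fin (H + 1) → S → ℝ :=
  Fin.induction (motive := fun _ => S → ℝ) d (fun h v s' => ∑ s, v s * m h s s')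

/-- The column vector `m_i ⋯ m_{H-1} 1`. -/
def bwd {H : ℕ} (m : Fin H → S → S → ℝ) : Fin (H + 1) → S → ℝ :=
  Fin.reverseInduction (motive := fun _ => S → ℝ) (fun _ => 1)
    (fun h v s => ∑ s', m h s s' * v s')

variable {H : ℕ}

@[simp] lemma fwd_zero (d : S → ℝ) (m : Fin H → S → S → ℝ) : fwd d m 0 = d := rfl

lemma fwd_succ (d : S → ℝ) (m : Fin H → S → S → ℝ) (h : Fin H) (s' : S) :
    fwd d m h.succ s' = ∑ s, fwd d m h.castSucc s * m h s s' := by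
  simp [fwd]

@[simp] lemma bwd_last (m : Fin H → S → S → ℝ) (s : S) : bwd m (Fin.last H) s = 1 := by
  simp [bwd]

lemma bwd_castSucc (m : Fin H → S → S → ℝ) (h : Fin H) (s : S) :
    bwd m h.castSucc s = ∑ s', m h s s' * bwd m h.succ s' := by
  simp [bwd]

/-- The recursion of `fwd` appends a transition at the end, while a path splits off its first state;
absorbing the first transition into the initial vector reconciles the two in an induction on `H`. -/
lemma fwd_shift (d : S → ℝ) (m : Fin (H + 1) → S → S → ℝ) (i : Fin (H + 1)) :
    fwd d m i.succ = fwd (fun s' => ∑ s, d s * m 0 s s') (fun h => m h.succ) i := by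
  induction i using Fin.induction with
  | zero => funext s'; rw [fwd_succ]; simp
  | succ i ih =>
    funext s'
    rw [fwd_succ, fwd_succ, ← Fin.succ_castSucc, ih]

lemma sum_path_eq_sum_fwd_last (d : S → ℝ) (m : Fin H → S → S → ℝ) :
    ∑ s : Fin (H + 1) → S, d (s 0) * ∏ h, m h (s h.castSucc) (s h.succ)
      = ∑ s, fwd d m (Fin.last H) s := by
  induction H generalizing d with
  | zero =>
    simp only [Finset.univ_eq_empty, Finset.prod_empty, mul_one]
    exact Fintype.sum_equiv (Equiv.funUnique (Fin 1) S) _ _ (fun s => by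
      simp [show (Fin.last 0) = 0 from rfl])
  | succ H ih =>
    rw [← Fin.succ_last, fwd_shift, ← ih, ← (Fin.consEquiv fun _ => S).sum_comp,
      Fintype.sum_prod_type, Finset.sum_comm]
    refine Finset.sum_congr rfl fun s _ => ?_
    rw [Finset.sum_mul]
    refine Finset.sum_congr rfl fun x _ => ?_
    simp [Fin.consEquiv, Fin.prod_univ_succ, mul_assoc]

/-- Moving one matrix from the row vector to the column vector leaves the product unchanged, so a
path sum may be cut at any time. -/
lemma sum_fwd_mul_bwd (d : S → ℝ) (m : Fin H → S → S → ℝ) (i : Fin (H + 1)) :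
    ∑ s, fwd d m i s * bwd m i s = ∑ s, fwd d m (Fin.last H) s := by
  induction i using Fin.reverseInduction with
  | last => simp
  | cast h ih =>
    rw [← ih]
    simp only [fwd_succ, bwd_castSucc, Finset.mul_sum, Finset.sum_mul]
    rw [Finset.sum_comm]
    exact Finset.sum_congr rfl fun _ _ => Finset.sum_congr rfl fun _ _ => by ring

lemma sum_path (d : S → ℝ) (m : Fin H → S → S → ℝ) (i : Fin (H + 1)) :
    ∑ s : Fin (H + 1) → S, d (s 0) * ∏ h, m h (s h.castSucc) (s h.succ)
      = ∑ s, fwd d m i s * bwd m i s := by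
  rw [sum_fwd_mul_bwd, sum_path_eq_sum_fwd_last]

/-- Each action occurs in a single factor, so the sum over action sequences is absorbed into the
transition matrices. -/
lemma sum_path_action {A : Type*} [Fintype A] (d : S → ℝ) (k : Fin H → S → A → S → ℝ)
    (i : Fin (H + 1)) :
    ∑ s : Fin (H + 1) → S, ∑ a : Fin H → A,
        d (s 0) * ∏ h, k h (s h.castSucc) (a h) (s h.succ)
      = ∑ s, fwd d (fun h s s' => ∑ a, k h s a s') i s
          * bwd (fun h s s' => ∑ a, k h s a s') i s := by
  rw [← sum_path]
  refine Finset.sum_congr rfl fun s _ => ?_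
  rw [← Finset.mul_sum, Finset.prod_univ_sum]
  simp

lemma fwd_congr {d : S → ℝ} {m m' : Fin H → S → S → ℝ} (i : Fin (H + 1))
    (hm : ∀ h : Fin H, h.castSucc < i → m h = m' h) : fwd d m i = fwd d m' i := by
  induction i using Fin.induction with
  | zero => rfl
  | succ h ih =>
    funext s'
    rw [fwd_succ, fwd_succ, ih fun j hj => hm j (hj.trans Fin.castSucc_lt_succ),
      hm h Fin.castSucc_lt_succ]

lemma bwd_congr {m m' : Fin H → S → S → ℝ} (i : Fin (H + 1))
    (hm : ∀ h : Fin H, i ≤ h.castSucc → m h = m' h) : bwd m i = bwd m' i := by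
  induction i using Fin.reverseInduction with
  | last => funext s; simp
  | cast h ih =>
    funext s
    rw [bwd_castSucc, bwd_castSucc, ih fun j hj => hm j (Fin.castSucc_lt_succ.le.trans hj),
      hm h le_rfl]

lemma bwd_eq_one {m : Fin H → S → S → ℝ} (i : Fin (H + 1))
    (hm : ∀ h : Fin H, i ≤ h.castSucc → ∀ s, ∑ s', m h s s' = 1) (s : S) : bwd m i s = 1 := by
  induction i using Fin.reverseInduction generalizing s with
  | last => simp
  | cast h ih =>
    rw [bwd_castSucc, ← hm h le_rfl s]
    exact Finset.sum_congr rfl fun s' _ => by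
      rw [ih (fun j hj => hm j (Fin.castSucc_lt_succ.le.trans hj)), mul_one]

end MarkovPath

/-! ### The law of an episode as a finite mixture over state-action paths. -/

namespace EpisodicMDP

open MarkovPath

variable {S A : Type*} [Fintype S] [Fintype A] {H : ℕ}

/-- The distribution of the state at each time, computed forward. -/
def stateDist (M : EpisodicMDP S A H) (π : Policy S A H) : Fin (H + 1) → S → ℝ :=
  fwd M.d₁ fun h s s' => ∑ a, π.prob h s a * M.P h s a s'

lemma stateDist_succ (M : EpisodicMDP S A H) (π : Policy S A H) (h : Fin H) (s' : S) :
    M.stateDist π h.succ s'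
      = ∑ s, M.stateDist π h.castSucc s * ∑ a, π.prob h s a * M.P h s a s' :=
  fwd_succ ..

lemma stateDist_nonneg (M : EpisodicMDP S A H) (π : Policy S A H) (i : Fin (H + 1)) (s : S) :
    0 ≤ M.stateDist π i s := by
  induction i using Fin.induction generalizing s with
  | zero => exact M.d₁_nonneg s
  | succ h ih =>
    rw [stateDist_succ]
    exact Finset.sum_nonneg fun s _ => mul_nonneg (ih s)
      (Finset.sum_nonneg fun a _ => mul_nonneg (π.nonneg ..) (M.P_nonneg ..))

lemma sum_prob_mul_P (M : EpisodicMDP S A H) (π : Policy S A H) (h : Fin H) (s : S) :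
    ∑ s', ∑ a, π.prob h s a * M.P h s a s' = 1 := by
  rw [Finset.sum_comm]
  simp [← Finset.mul_sum, M.P_sum, π.sum_one]

lemma stateDist_sum (M : EpisodicMDP S A H) (π : Policy S A H) (i : Fin (H + 1)) :
    ∑ s, M.stateDist π i s = 1 := by
  induction i using Fin.induction with
  | zero => exact M.d₁_sum
  | succ h ih =>
    simp only [stateDist_succ]
    rw [Finset.sum_comm]
    simp [← Finset.mul_sum, sum_prob_mul_P, ih]

lemma pathProb_nonneg (M : EpisodicMDP S A H) (π : Policy S A H) (s : Fin (H + 1) → S)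
    (a : Fin H → A) : 0 ≤ M.pathProb π s a :=
  mul_nonneg (M.d₁_nonneg _)
    (Finset.prod_nonneg fun _ _ => mul_nonneg (π.nonneg ..) (M.P_nonneg ..))

/-- The law of the rewards given the state-action path. -/
def rewardLaw (M : EpisodicMDP S A H) (s : Fin (H + 1) → S) (a : Fin H → A) :
    Measure (Fin H → ℝ) :=
  Measure.pi fun h => (M.R h (s h.castSucc) (a h) : Measure ℝ)

instance (M : EpisodicMDP S A H) (s : Fin (H + 1) → S) (a : Fin H → A) :
    IsProbabilityMeasure (M.rewardLaw s a) := by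
  unfold rewardLaw; infer_instance

variable [MeasurableSpace S] [MeasurableSpace A]

lemma episodeLaw_eq_sum_map (M : EpisodicMDP S A H) (π : Policy S A H) :
    M.episodeLaw π = ∑ s : Fin (H + 1) → S, ∑ a : Fin H → A,
      ENNReal.ofReal (M.pathProb π s a) • (M.rewardLaw s a).map (fun r => (s, a, r)) := by
  unfold episodeLaw rewardLaw
  refine Finset.sum_congr rfl fun s _ => Finset.sum_congr rfl fun a _ => ?_
  rw [Measure.dirac_prod, Measure.dirac_prod, Measure.map_map (by fun_prop) (by fun_prop)]
  rfl

variable [MeasurableSingletonClass S] [MeasurableSingletonClass A]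

/-- Because this map is an embedding, integrals against the episode law can be computed path by path
for arbitrary, possibly non-measurable, integrands. -/
lemma measurableEmbedding_episode (s : Fin (H + 1) → S) (a : Fin H → A) :
    MeasurableEmbedding (fun r : Fin H → ℝ => ((s, a, r) : Episode S A H)) :=
  .prodMk_left s (.prodMk_left a .id)

lemma lintegral_episodeLaw (M : EpisodicMDP S A H) (π : Policy S A H)
    (ψ : Episode S A H → ENNReal) :
    ∫⁻ e, ψ e ∂(M.episodeLaw π) = ∑ s : Fin (H + 1) → S, ∑ a : Fin H → A,
      ENNReal.ofReal (M.pathProb π s a) * ∫⁻ r, ψ (s, a, r) ∂(M.rewardLaw s a) := by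
  rw [episodeLaw_eq_sum_map, lintegral_finsetSum_measure]
  refine Finset.sum_congr rfl fun s _ => ?_
  rw [lintegral_finsetSum_measure]
  refine Finset.sum_congr rfl fun a _ => ?_
  rw [lintegral_smul_measure, (measurableEmbedding_episode s a).lintegral_map, smul_eq_mul]

lemma integrable_episodeLaw (M : EpisodicMDP S A H) (π : Policy S A H) (ψ : Episode S A H → ℝ)
    (hψ : ∀ s a, Integrable (fun r => ψ (s, a, r)) (M.rewardLaw s a)) :
    Integrable ψ (M.episodeLaw π) := by
  rw [episodeLaw_eq_sum_map]
  refine integrable_finsetSum_measure.2 fun s _ => integrable_finsetSum_measure.2 fun a _ => ?_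
  exact (((measurableEmbedding_episode s a).integrable_map_iff).2 (hψ s a)).smul_measure
    ENNReal.ofReal_ne_top

lemma integral_episodeLaw (M : EpisodicMDP S A H) (π : Policy S A H) (ψ : Episode S A H → ℝ)
    (hψ : ∀ s a, Integrable (fun r => ψ (s, a, r)) (M.rewardLaw s a)) :
    ∫ e, ψ e ∂(M.episodeLaw π) = ∑ s : Fin (H + 1) → S, ∑ a : Fin H → A,
      M.pathProb π s a * ∫ r, ψ (s, a, r) ∂(M.rewardLaw s a) := by
  have hi : ∀ s a, Integrable ψ (ENNReal.ofReal (M.pathProb π s a) •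
      (M.rewardLaw s a).map (fun r => ((s, a, r) : Episode S A H))) := fun s a =>
    (((measurableEmbedding_episode s a).integrable_map_iff).2 (hψ s a)).smul_measure
      ENNReal.ofReal_ne_top
  rw [episodeLaw_eq_sum_map, integral_finsetSum_measure
    fun s _ => integrable_finsetSum_measure.2 fun a _ => hi s a]
  refine Finset.sum_congr rfl fun s _ => ?_
  rw [integral_finsetSum_measure fun a _ => hi s a]
  refine Finset.sum_congr rfl fun a _ => ?_
  rw [integral_smul_measure, (measurableEmbedding_episode s a).integral_map,
    ENNReal.toReal_ofReal (M.pathProb_nonneg π s a), smul_eq_mul]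

/-- The transition weights of a product functional of the steps of an episode. -/
def stepWeight (M : EpisodicMDP S A H) (π : Policy S A H) (φ : Fin H → S → A → ℝ → S → ℝ)
    (h : Fin H) (s s' : S) : ℝ :=
  ∑ a, π.prob h s a * M.P h s a s' * ∫ x, φ h s a x s' ∂(M.R h s a : Measure ℝ)

/-- Given the path the rewards are independent, so a product over the steps integrates to a product,
and the path sum is again one of transfer matrices. Every moment below is a special choice of `φ`.
-/
lemma integral_prod_step (M : EpisodicMDP S A H) (π : Policy S A H)
    (φ : Fin H → S → A → ℝ → S → ℝ)
    (hφ : ∀ h s a s', Integrable (fun x => φ h s a x s') (M.R h s a : Measure ℝ))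
    (i : Fin (H + 1)) :
    ∫ e, ∏ h : Fin H, φ h (e.state h.castSucc) (e.action h) (e.reward h) (e.state h.succ)
        ∂(M.episodeLaw π)
      = ∑ s, fwd M.d₁ (M.stepWeight π φ) i s * bwd (M.stepWeight π φ) i s := by
  rw [integral_episodeLaw]
  · have := sum_path_action M.d₁ (fun h s a s' => π.prob h s a * M.P h s a s' *
      ∫ x, φ h s a x s' ∂(M.R h s a : Measure ℝ)) i
    refine Eq.trans ?_ this
    refine Finset.sum_congr rfl fun s _ => Finset.sum_congr rfl fun a _ => ?_
    rw [Finset.prod_mul_distrib, pathProb, mul_assoc]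
    congr 2
    exact integral_fintype_prod_eq_prod (μ := fun h => (M.R h (s h.castSucc) (a h) : Measure ℝ))
      (fun h x => φ h (s h.castSucc) (a h) x (s h.succ))
  · intro s a
    exact Integrable.fintype_prod (μ := fun h => (M.R h (s h.castSucc) (a h) : Measure ℝ))
      (fun h => hφ h (s h.castSucc) (a h) (s h.succ))

instance (M : EpisodicMDP S A H) (π : Policy S A H) : IsProbabilityMeasure (M.episodeLaw π) := by
  constructor
  rw [← lintegral_one, lintegral_episodeLaw]
  have h := sum_path_action M.d₁ (fun h s a s' => π.prob h s a * M.P h s a s') (Fin.last H)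
  have h1 : ∑ s, fwd M.d₁ (fun h s s' => ∑ a, π.prob h s a * M.P h s a s') (Fin.last H) s = 1 :=
    M.stateDist_sum π (Fin.last H)
  simp only [bwd_last, mul_one, h1] at h
  simp only [lintegral_one, measure_univ, mul_one]
  calc _ = ENNReal.ofReal (∑ s : Fin (H + 1) → S, ∑ a : Fin H → A, M.pathProb π s a) := by
        rw [ENNReal.ofReal_sum_of_nonneg fun s _ =>
          Finset.sum_nonneg fun a _ => M.pathProb_nonneg π s a]
        exact Finset.sum_congr rfl fun s _ =>
          (ENNReal.ofReal_sum_of_nonneg fun a _ => M.pathProb_nonneg π s a).symm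
    _ = 1 := by
        rw [← ENNReal.ofReal_one]; exact congrArg _ h

end EpisodicMDP

/-! ### Sums over the remaining time steps, and telescoping. -/

lemma Fin.sum_ite_castSucc_le {H : ℕ} (f : Fin H → ℝ) (h₀ : Fin H) :
    ∑ h : Fin H, (if h₀.castSucc ≤ h.castSucc then f h else 0)
      = f h₀ + ∑ h : Fin H, if h₀.succ ≤ h.castSucc then f h else 0 := by
  have hsplit : ∀ h : Fin H, (if h₀.castSucc ≤ h.castSucc then f h else 0)
      = (if h = h₀ then f h else 0) + if h₀.succ ≤ h.castSucc then f h else 0 := by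
    intro h
    rcases lt_trichotomy h h₀ with hh | rfl | hh
    · have h1 : ¬ h₀.castSucc ≤ h.castSucc := by simpa using hh
      have h2 : ¬ h₀.succ ≤ h.castSucc := fun h3 => h1 (Fin.castSucc_lt_succ.le.trans h3)
      simp [h1, h2, hh.ne]
    · have h2 : ¬ h.succ ≤ h.castSucc := not_le.2 Fin.castSucc_lt_succ
      simp [h2]
    · have h1 : h₀.castSucc ≤ h.castSucc := by simpa using hh.le
      have h2 : h₀.succ ≤ h.castSucc := by
        rw [Fin.le_def]; exact Nat.succ_le_of_lt hh
      simp [h1, h2, hh.ne']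
  rw [Finset.sum_congr rfl fun h _ => hsplit h, Finset.sum_add_distrib,
    Finset.sum_ite_eq' Finset.univ h₀]
  simp

lemma Fin.sum_ite_sub_eq {H : ℕ} (f : Fin (H + 1) → ℝ) (i : Fin (H + 1)) :
    ∑ h : Fin H, (if i ≤ h.castSucc then f h.succ - f h.castSucc else 0)
      = f (Fin.last H) - f i := by
  induction i using Fin.reverseInduction with
  | last => simp [Fin.last_le_iff, (Fin.castSucc_lt_last _).ne]
  | cast h₀ ih => rw [Fin.sum_ite_castSucc_le, ih]; ring

namespace Episode

variable {S A : Type*} [MeasurableSpace S] [MeasurableSpace A] {H : ℕ}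

@[fun_prop]
lemma measurable_state (h : Fin (H + 1)) :
    Measurable (fun e : Episode S A H => e.state h) :=
  (measurable_pi_apply h).comp measurable_fst

@[fun_prop]
lemma measurable_action (h : Fin H) : Measurable (fun e : Episode S A H => e.action h) :=
  (measurable_pi_apply h).comp (measurable_fst.comp measurable_snd)

@[fun_prop]
lemma measurable_reward (h : Fin H) : Measurable (fun e : Episode S A H => e.reward h) :=
  (measurable_pi_apply h).comp (measurable_snd.comp measurable_snd)

end Episode

namespace EpisodicMDP

open MarkovPath

variable {S A : Type*} [Fintype S] [Fintype A] {H : ℕ}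

/-! ### Evaluation of a policy -/

/-- The expected cumulative cost of `π` from each time and state on. -/
def evalCost (M : EpisodicMDP S A H) (π : Policy S A H) (c : Fin H → S → A → ℝ) :
    Fin (H + 1) → S → ℝ :=
  Fin.reverseInduction (motive := fun _ => S → ℝ) (fun _ => 0)
    (fun h G s => ∑ a, π.prob h s a * (c h s a + ∑ s', M.P h s a s' * G s'))

@[simp] lemma evalCost_last (M : EpisodicMDP S A H) (π : Policy S A H) (c : Fin H → S → A → ℝ)
    (s : S) : M.evalCost π c (Fin.last H) s = 0 := by
  simp [evalCost]

lemma evalCost_castSucc (M : EpisodicMDP S A H) (π : Policy S A H) (c : Fin H → S → A → ℝ)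
    (h : Fin H) (s : S) : M.evalCost π c h.castSucc s
      = ∑ a, π.prob h s a * (c h s a + ∑ s', M.P h s a s' * M.evalCost π c h.succ s') := by
  simp [evalCost]

/-- The value function of `π`. -/
def polValue (M : EpisodicMDP S A H) (π : Policy S A H) : Fin (H + 1) → S → ℝ :=
  M.evalCost π M.meanReward

lemma integrable_of_continuous (M : EpisodicMDP S A H) (h : Fin H) (s : S) (a : A) (f : ℝ → ℝ)
    (hf : Continuous f) : Integrable f (M.R h s a : Measure ℝ) := by
  obtain ⟨C, hC⟩ := (isCompact_Icc (a := (0 : ℝ)) (b := 1)).exists_bound_of_continuousOn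
    hf.continuousOn
  refine Integrable.of_bound hf.aestronglyMeasurable C ?_
  filter_upwards [M.R_mem h s a] with x hx using hC x hx

variable [MeasurableSpace S] [MeasurableSpace A]
variable [MeasurableSingletonClass S] [MeasurableSingletonClass A]

lemma stepWeight_eq (M : EpisodicMDP S A H) (π : Policy S A H)
    (φ : Fin H → S → A → ℝ → S → ℝ) (h : Fin H) (hφ : ∀ s a x s', φ h s a x s' = 1) :
    M.stepWeight π φ h = fun s s' => ∑ a, π.prob h s a * M.P h s a s' := by
  funext s s'
  simp [stepWeight, hφ]

lemma fwd_stepWeight_eq (M : EpisodicMDP S A H) (π : Policy S A H)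
    (φ : Fin H → S → A → ℝ → S → ℝ) (i : Fin (H + 1))
    (hφ : ∀ h : Fin H, h.castSucc < i → ∀ s a x s', φ h s a x s' = 1) :
    fwd M.d₁ (M.stepWeight π φ) i = M.stateDist π i :=
  fwd_congr i fun h hh => M.stepWeight_eq π φ h (hφ h hh)

lemma bwd_stepWeight_eq (M : EpisodicMDP S A H) (π : Policy S A H)
    (φ : Fin H → S → A → ℝ → S → ℝ) (i : Fin (H + 1))
    (hφ : ∀ h : Fin H, i ≤ h.castSucc → ∀ s a x s', φ h s a x s' = 1) (s : S) :
    bwd (M.stepWeight π φ) i s = 1 :=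
  bwd_eq_one i (fun h hh s => by
    rw [M.stepWeight_eq π φ h (hφ h hh)]
    exact M.sum_prob_mul_P π h s) s

lemma integral_step (M : EpisodicMDP S A H) (π : Policy S A H) (h : Fin H)
    (ψ : S → A → ℝ → S → ℝ)
    (hψ : ∀ s a s', Integrable (fun x => ψ s a x s') (M.R h s a : Measure ℝ)) :
    ∫ e, ψ (e.state h.castSucc) (e.action h) (e.reward h) (e.state h.succ) ∂(M.episodeLaw π)
      = ∑ s, M.stateDist π h.castSucc s * ∑ a, π.prob h s a * ∑ s', M.P h s a s' *
          ∫ x, ψ s a x s' ∂(M.R h s a : Measure ℝ) := by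
  classical
  -- All factors other than the one at time `h` are `1`, so the forward vector is the state
  -- distribution and the backward vector after step `h` is `1`.
  let φ : Fin H → S → A → ℝ → S → ℝ := fun j s a x s' => if j = h then ψ s a x s' else 1
  have hφ : ∀ j s a s', Integrable (fun x => φ j s a x s') (M.R j s a : Measure ℝ) := by
    intro j s a s'
    by_cases hj : j = h
    · subst hj; simpa [φ] using hψ s a s'
    · simp [φ, hj]
  have key := M.integral_prod_step π φ hφ h.castSucc
  simp only [φ, Finset.prod_ite_eq', Finset.mem_univ, if_true] at key
  rw [key]
  refine Finset.sum_congr rfl fun s _ => ?_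
  rw [fwd_stepWeight_eq, bwd_castSucc]
  · congr 1
    simp only [Finset.mul_sum]
    rw [Finset.sum_comm]
    refine Finset.sum_congr rfl fun s' _ => ?_
    rw [bwd_stepWeight_eq, mul_one]
    · simp [stepWeight, mul_assoc]
    · intro j hj s a x s'
      have : j ≠ h := by
        rintro rfl
        exact absurd hj (not_le.2 Fin.castSucc_lt_succ)
      simp [this]
  · intro j hj s a x s'
    have : j ≠ h := by
      rintro rfl
      exact lt_irrefl _ hj
    simp [this]

lemma integrable_step (M : EpisodicMDP S A H) (π : Policy S A H) (h : Fin H)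
    (ψ : S → A → ℝ → S → ℝ)
    (hψ : ∀ s a s', Integrable (fun x => ψ s a x s') (M.R h s a : Measure ℝ)) :
    Integrable (fun e : Episode S A H =>
      ψ (e.state h.castSucc) (e.action h) (e.reward h) (e.state h.succ)) (M.episodeLaw π) := by
  refine M.integrable_episodeLaw π _ fun s a => ?_
  exact (measurePreserving_eval
    (fun h => (M.R h (s h.castSucc) (a h) : Measure ℝ)) h).integrable_comp_of_integrable
      (hψ (s h.castSucc) (a h) (s h.succ))

/-- A step functional with vanishing conditional mean is orthogonal to every function of an earlier
state. -/
lemma integral_state_mul_step_eq_zero (M : EpisodicMDP S A H) (π : Policy S A H) (h₀ h : Fin H)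
    (hle : h₀ ≤ h) (f : S → ℝ) (ψ : S → A → ℝ → S → ℝ)
    (hψ : ∀ s a s', Integrable (fun x => ψ s a x s') (M.R h s a : Measure ℝ))
    (h0 : ∀ s, ∑ a, π.prob h s a * ∑ s', M.P h s a s' *
      ∫ x, ψ s a x s' ∂(M.R h s a : Measure ℝ) = 0) :
    ∫ e, f (e.state h₀.castSucc) *
        ψ (e.state h.castSucc) (e.action h) (e.reward h) (e.state h.succ) ∂(M.episodeLaw π)
      = 0 := by
  classical
  -- The factor `f` sits at step `h₀` and `ψ` at step `h`; cutting at `h` isolates the conditional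
  -- mean of `ψ`. If `h₀ = h`, both sit in the same step and `f` comes out as a constant.
  let φ : Fin H → S → A → ℝ → S → ℝ := fun j s a x s' =>
    (if j = h₀ then f s else 1) * if j = h then ψ s a x s' else 1
  have hφ : ∀ j s a s', Integrable (fun x => φ j s a x s') (M.R j s a : Measure ℝ) := by
    intro j s a s'
    refine Integrable.const_mul ?_ _
    by_cases hj : j = h
    · subst hj; simpa using hψ s a s'
    · simp [hj]
  have key := M.integral_prod_step π φ hφ h.castSucc
  simp only [φ, Finset.prod_mul_distrib, Finset.prod_ite_eq', Finset.mem_univ, if_true] at key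
  rw [key]
  refine Finset.sum_eq_zero fun s _ => ?_
  rw [bwd_castSucc]
  refine mul_eq_zero_of_right _ ?_
  have hb : ∀ s', bwd (M.stepWeight π φ) h.succ s' = 1 := by
    refine M.bwd_stepWeight_eq π φ h.succ ?_
    intro j hj s a x s'
    have hlt : h < j := by
      have := Fin.castSucc_lt_succ.trans_le hj
      simpa using this
    simp [φ, hlt.ne', (hle.trans_lt hlt).ne']
  calc _ = ∑ s', M.stepWeight π φ h s s' :=
        Finset.sum_congr rfl fun s' _ => by rw [hb, mul_one]
    _ = (if h = h₀ then f s else 1) * ∑ a, π.prob h s a * ∑ s', M.P h s a s' *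
          ∫ x, ψ s a x s' ∂(M.R h s a : Measure ℝ) := by
        simp only [stepWeight, φ, if_true, Finset.mul_sum]
        rw [Finset.sum_comm]
        refine Finset.sum_congr rfl fun a _ => Finset.sum_congr rfl fun s' _ => ?_
        rw [integral_const_mul]
        ring
    _ = 0 := by rw [h0, mul_zero]

/-- The rewards collected from time `h₀` on. -/
def _root_.Episode.tailReward (e : Episode S A H) (h₀ : Fin H) : ℝ :=
  ∑ h, if h₀ ≤ h then e.reward h else 0

lemma integrable_mul_reward (M : EpisodicMDP S A H) (π : Policy S A H) (f : S → ℝ)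
    (h₀ h : Fin H) :
    Integrable (fun e : Episode S A H => f (e.state h₀.castSucc) * e.reward h)
      (M.episodeLaw π) := by
  refine M.integrable_episodeLaw π _ fun s a => ?_
  change Integrable (fun r : Fin H → ℝ => f (s h₀.castSucc) * r h) _
  refine Integrable.const_mul ?_ _
  exact (measurePreserving_eval
    (fun h => (M.R h (s h.castSucc) (a h) : Measure ℝ)) h).integrable_comp_of_integrable
      (M.integrable_of_continuous h (s h.castSucc) (a h) id continuous_id)

lemma integrable_mul_tailReward (M : EpisodicMDP S A H) (π : Policy S A H) (f : S → ℝ)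
    (h₀ h₁ : Fin H) :
    Integrable (fun e : Episode S A H => f (e.state h₀.castSucc) * e.tailReward h₁)
      (M.episodeLaw π) := by
  simp only [Episode.tailReward, Finset.mul_sum]
  refine integrable_finsetSum _ fun h _ => ?_
  by_cases hh : h₁ ≤ h
  · simpa [hh] using M.integrable_mul_reward π f h₀ h
  · simp [hh]

/-- The tail reward is `V^π` at the starting state plus the martingale differences `r_h +
V^π_{h+1}(s_{h+1}) - V^π_h(s_h)`, which telescope because the final value is zero. Each difference
is orthogonal to `f`. Taking `f = 1` gives the performance, an indicator gives bounds on `V^π` at a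
single state. -/
lemma integral_state_mul_tailReward (M : EpisodicMDP S A H) (π : Policy S A H) (h₀ : Fin H)
    (f : S → ℝ) :
    ∫ e, f (e.state h₀.castSucc) * e.tailReward h₀ ∂(M.episodeLaw π)
      = ∑ s, M.stateDist π h₀.castSucc s * (f s * M.polValue π h₀.castSucc s) := by
  have hint : ∀ (h : Fin H) (s : S) (a : A) (s' : S), Integrable
      (fun x => x + (M.polValue π h.succ s' - M.polValue π h.castSucc s))
      (M.R h s a : Measure ℝ) := fun h s a s' =>
    M.integrable_of_continuous h s a _ (by fun_prop)
  have hzero : ∀ (h : Fin H), h₀ ≤ h → ∫ e : Episode S A H, f (e.state h₀.castSucc) *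
      (e.reward h + (M.polValue π h.succ (e.state h.succ)
        - M.polValue π h.castSucc (e.state h.castSucc))) ∂(M.episodeLaw π) = 0 := by
    intro h hh
    refine M.integral_state_mul_step_eq_zero π h₀ h hh f
      (fun s _ x s' => x + (M.polValue π h.succ s' - M.polValue π h.castSucc s)) (hint h) ?_
    intro s
    have h1 : ∀ a s', ∫ x, x + (M.polValue π h.succ s' - M.polValue π h.castSucc s)
        ∂(M.R h s a : Measure ℝ)
          = M.meanReward h s a + M.polValue π h.succ s' - M.polValue π h.castSucc s := by
      intro a s'
      rw [integral_add (M.integrable_of_continuous h s a (fun x => x) continuous_id)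
        (integrable_const _)]
      simp [meanReward]
      ring
    simp only [h1, mul_sub, mul_add, Finset.sum_add_distrib, Finset.sum_sub_distrib,
      ← Finset.sum_mul, M.P_sum, one_mul, π.sum_one]
    rw [sub_eq_zero, polValue, evalCost_castSucc]
    simp only [mul_add, Finset.sum_add_distrib]
  have hid : ∀ e : Episode S A H, f (e.state h₀.castSucc) * e.tailReward h₀
      = (∑ h : Fin H, if h₀ ≤ h then f (e.state h₀.castSucc) *
      (e.reward h + (M.polValue π h.succ (e.state h.succ)
        - M.polValue π h.castSucc (e.state h.castSucc))) else 0)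
        + f (e.state h₀.castSucc) * M.polValue π h₀.castSucc (e.state h₀.castSucc) := by
    intro e
    have ht := Fin.sum_ite_sub_eq (fun i => M.polValue π i (e.state i)) h₀.castSucc
    have hlast : M.polValue π (Fin.last H) (e.state (Fin.last H)) = 0 := evalCost_last ..
    rw [hlast, zero_sub] at ht
    simp only [Fin.castSucc_le_castSucc_iff] at ht
    rw [Episode.tailReward, ← neg_eq_iff_eq_neg.2 ht, Finset.mul_sum, mul_neg, ← sub_eq_add_neg,
      Finset.mul_sum, ← Finset.sum_sub_distrib]
    refine Finset.sum_congr rfl fun h _ => ?_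
    split_ifs <;> ring
  have hi1 : ∀ h : Fin H, Integrable (fun e : Episode S A H => if h₀ ≤ h then
      f (e.state h₀.castSucc) *
      (e.reward h + (M.polValue π h.succ (e.state h.succ)
        - M.polValue π h.castSucc (e.state h.castSucc))) else 0) (M.episodeLaw π) := by
    intro h
    by_cases hh : h₀ ≤ h
    · simp only [hh, if_true]
      refine M.integrable_episodeLaw π _ fun s a => ?_
      change Integrable (fun r : Fin H → ℝ => f (s h₀.castSucc) *
        (r h + (M.polValue π h.succ (s h.succ) - M.polValue π h.castSucc (s h.castSucc)))) _
      refine Integrable.const_mul ?_ _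
      exact (measurePreserving_eval
        (fun h => (M.R h (s h.castSucc) (a h) : Measure ℝ)) h).integrable_comp_of_integrable
          (hint h (s h.castSucc) (a h) (s h.succ))
    · simp [hh]
  have hi2 : ∀ (s : S) (a : A) (s' : S), Integrable
      (fun _ : ℝ => f s * M.polValue π h₀.castSucc s) (M.R h₀ s a : Measure ℝ) :=
    fun _ _ _ => integrable_const _
  simp only [hid]
  rw [integral_add (integrable_finsetSum _ fun h _ => hi1 h) (M.integrable_step π h₀ _ hi2),
    integral_finsetSum _ fun h _ => hi1 h, Finset.sum_eq_zero, zero_add,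
    M.integral_step π h₀ _ hi2]
  · simp [← Finset.sum_mul, M.P_sum, π.sum_one]
  · intro h _
    by_cases hh : h₀ ≤ h
    · simpa [hh] using hzero h hh
    · simp [hh]

lemma performance_eq (M : EpisodicMDP S A H) (π : Policy S A H) (hH : 1 ≤ H) :
    M.performance π = ∑ s, M.d₁ s * M.polValue π 0 s := by
  have : NeZero H := ⟨by omega⟩
  have := M.integral_state_mul_tailReward π 0 (fun _ => 1)
  simp only [one_mul, Episode.tailReward, Fin.zero_le, if_true, Fin.castSucc_zero'] at this
  exact this

lemma stateProb_eq (M : EpisodicMDP S A H) (π : Policy S A H) (h : Fin H) (s : S) :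
    M.stateProb π h s = M.stateDist π h.castSucc s := by
  classical
  have hm : MeasurableSet {e : Episode S A H | e.state h.castSucc = s} :=
    measurableSet_eq_fun (Episode.measurable_state h.castSucc) measurable_const
  have key := M.integral_step π h (fun t _ _ _ => if t = s then (1 : ℝ) else 0)
    fun _ _ _ => integrable_const _
  rw [stateProb, ← integral_indicator_one hm]
  refine Eq.trans (integral_congr_ae (Filter.Eventually.of_forall fun e => ?_)) (key.trans ?_)
  · simp [Set.indicator_apply]
  · simp [M.P_sum, π.sum_one]

lemma ae_episodeLaw_of_forall (M : EpisodicMDP S A H) (π : Policy S A H)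
    (p : Episode S A H → Prop) (hp : ∀ s a, ∀ᵐ r ∂(M.rewardLaw s a), p (s, a, r)) :
    ∀ᵐ e ∂(M.episodeLaw π), p e := by
  rw [ae_iff, episodeLaw_eq_sum_map, Measure.coe_finsetSum, Finset.sum_apply]
  refine Finset.sum_eq_zero fun s _ => ?_
  rw [Measure.coe_finsetSum, Finset.sum_apply]
  refine Finset.sum_eq_zero fun a _ => ?_
  rw [Measure.smul_apply, (measurableEmbedding_episode s a).map_apply]
  have := ae_iff.1 (hp s a)
  rw [Set.preimage_ofPred_eq, this, smul_zero]

lemma ae_reward_mem (M : EpisodicMDP S A H) (π : Policy S A H) :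
    ∀ᵐ e ∂(M.episodeLaw π), ∀ h, e.reward h ∈ Set.Icc (0 : ℝ) 1 := by
  refine M.ae_episodeLaw_of_forall π _ fun s a => ae_all_iff.2 fun h => ?_
  exact (measurePreserving_eval
    (fun h => (M.R h (s h.castSucc) (a h) : Measure ℝ)) h).quasiMeasurePreserving.ae
      (M.R_mem h (s h.castSucc) (a h))

end EpisodicMDP

namespace EpisodicMDP

open MarkovPath

variable {S A : Type*} [Fintype S] [Fintype A] {H : ℕ}

/-! ### Time reversal: the past given the future -/

/-- Erase the states and actions up to time `h`. -/
def forgetPath (h : Fin H) (s₀ : S) (a₀ : A) (p : (Fin (H + 1) → S) × (Fin H → A)) :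
    (Fin (H + 1) → S) × (Fin H → A) :=
  (fun i => if h.castSucc < i then p.1 i else s₀, fun j => if h < j then p.2 j else a₀)

/-- Erase the rewards up to time `h`. -/
def forgetReward (h : Fin H) (r : Fin H → ℝ) : Fin H → ℝ :=
  fun j => (if h < j then id else fun _ => 0) (r j)

/-- Erase everything that happens up to time `h`. -/
def forget (h : Fin H) (s₀ : S) (a₀ : A) (e : Episode S A H) : Episode S A H :=
  ((forgetPath h s₀ a₀ (e.1, e.2.1)).1, (forgetPath h s₀ a₀ (e.1, e.2.1)).2,
    forgetReward h e.2.2)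

lemma forgetPath_idem (h : Fin H) (s₀ : S) (a₀ : A) (p : (Fin (H + 1) → S) × (Fin H → A)) :
    forgetPath h s₀ a₀ (forgetPath h s₀ a₀ p) = forgetPath h s₀ a₀ p := by
  ext i
  · by_cases hi : h.castSucc < i <;> simp [forgetPath, hi]
  · by_cases hi : h < i <;> simp [forgetPath, hi]

/-- The condition splits into one condition per step, so the indicator of a fibre is a product over
the steps and fits the transfer-matrix formula. -/
lemma forgetPath_eq_iff (h : Fin H) (s₀ : S) (a₀ : A) {p q : (Fin (H + 1) → S) × (Fin H → A)}
    (hq : forgetPath h s₀ a₀ q = q) :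
    forgetPath h s₀ a₀ p = q ↔
      ∀ j, (h ≤ j → p.1 j.succ = q.1 j.succ) ∧ (h < j → p.2 j = q.2 j) := by
  constructor
  · rintro rfl j
    refine ⟨fun hj => ?_, fun hj => by simp [forgetPath, hj]⟩
    have : h.castSucc < j.succ := Fin.castSucc_lt_succ_iff.2 hj
    simp [forgetPath, this]
  · intro hp
    rw [← hq]
    ext i
    · by_cases hi : h.castSucc < i
      · obtain ⟨j, rfl⟩ := Fin.exists_succ_eq.2 (Fin.ne_zero_of_lt hi)
        simp [forgetPath, hi, (hp j).1 (Fin.castSucc_lt_succ_iff.1 hi)]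
      · simp [forgetPath, hi]
    · by_cases hi : h < i
      · simp [forgetPath, hi, (hp i).2 hi]
      · simp [forgetPath, hi]

/-- A path sum restricted to a prescribed future is cut at time `h + 1`. The backward vector does
not see `X` or `Y`, and the forward vector sees them only through the sums that `hXY` equates: this
is the Markov property. -/
lemma sum_pathProb_fiber_congr [DecidableEq S] [DecidableEq A] (M : EpisodicMDP S A H)
    (π : Policy S A H) (h : Fin H) (s₀ : S)
    (a₀ : A) (X Y : S → A → S → ℝ)
    (hXY : ∀ s', ∑ s, M.stateDist π h.castSucc s * ∑ a, π.prob h s a * M.P h s a s' * X s a s'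
      = ∑ s, M.stateDist π h.castSucc s * ∑ a, π.prob h s a * M.P h s a s' * Y s a s')
    (q : (Fin (H + 1) → S) × (Fin H → A)) (hq : forgetPath h s₀ a₀ q = q) :
    ∑ s : Fin (H + 1) → S, ∑ a : Fin H → A, M.pathProb π s a *
        (if forgetPath h s₀ a₀ (s, a) = q then X (s h.castSucc) (a h) (s h.succ) else 0)
      = ∑ s : Fin (H + 1) → S, ∑ a : Fin H → A, M.pathProb π s a *
        (if forgetPath h s₀ a₀ (s, a) = q then Y (s h.castSucc) (a h) (s h.succ) else 0) := by
  let k : (S → A → S → ℝ) → Fin H → S → A → S → ℝ := fun Z j s a s' =>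
    π.prob j s a * M.P j s a s' *
      (if (h ≤ j → s' = q.1 j.succ) ∧ (h < j → a = q.2 j) then
        (if j = h then Z s a s' else 1) else 0)
  have hk : ∀ Z : S → A → S → ℝ, ∑ s : Fin (H + 1) → S, ∑ a : Fin H → A, M.pathProb π s a *
        (if forgetPath h s₀ a₀ (s, a) = q then Z (s h.castSucc) (a h) (s h.succ) else 0)
      = ∑ s, fwd M.d₁ (fun h s s' => ∑ a, k Z h s a s') h.succ s
          * bwd (fun h s s' => ∑ a, k Z h s a s') h.succ s := by
    intro Z
    rw [← sum_path_action]
    refine Finset.sum_congr rfl fun s _ => Finset.sum_congr rfl fun a _ => ?_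
    have hprod : ∏ j, k Z j (s j.castSucc) (a j) (s j.succ)
        = (∏ j, π.prob j (s j.castSucc) (a j) * M.P j (s j.castSucc) (a j) (s j.succ)) *
          ∏ j, (if (h ≤ j → s j.succ = q.1 j.succ) ∧ (h < j → a j = q.2 j) then
            (if j = h then Z (s j.castSucc) (a j) (s j.succ) else 1) else 0) :=
      Finset.prod_mul_distrib
    rw [pathProb, mul_assoc, hprod, Finset.prod_ite_zero]
    simp only [forgetPath_eq_iff h s₀ a₀ hq, Finset.prod_ite_eq', Finset.mem_univ, if_true,
      forall_true_left]
  rw [hk, hk]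
  refine Finset.sum_congr rfl fun s' _ => ?_
  congr 1
  · have hf : ∀ Z : S → A → S → ℝ,
        fwd M.d₁ (fun h s s' => ∑ a, k Z h s a s') h.castSucc = M.stateDist π h.castSucc := by
      intro Z
      refine fwd_congr _ fun j hj => ?_
      have hjh : j < h := by simpa using hj
      funext s s'
      refine Finset.sum_congr rfl fun a _ => ?_
      simp [k, not_le.2 hjh, not_lt.2 hjh.le, hjh.ne]
    have hg : ∀ Z : S → A → S → ℝ,
        fwd M.d₁ (fun h s s' => ∑ a, k Z h s a s') h.succ s'
          = (if s' = q.1 h.succ then 1 else 0) *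
            ∑ s, M.stateDist π h.castSucc s * ∑ a, π.prob h s a * M.P h s a s' * Z s a s' := by
      intro Z
      rw [fwd_succ, hf, Finset.mul_sum]
      refine Finset.sum_congr rfl fun s _ => ?_
      by_cases hs : s' = q.1 h.succ <;> simp [k, hs]
    rw [hg, hg, hXY]
  · refine congrFun (bwd_congr _ fun j hj => ?_) s'
    have hjh : j ≠ h := by
      rintro rfl
      exact absurd hj (not_le.2 Fin.castSucc_lt_succ)
    funext s s'
    simp [k, hjh]

/-- The conditional probability of `(s_h, a_h) = (s₀, a₀)` given `s_{h+1} = s'`. -/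
def backProb (M : EpisodicMDP S A H) (π : Policy S A H) (h : Fin H) (s₀ : S) (a₀ : A)
    (s' : S) : ℝ :=
  M.stateDist π h.castSucc s₀ * π.prob h s₀ a₀ * M.P h s₀ a₀ s' / M.stateDist π h.succ s'

lemma flow_le_stateDist_succ (M : EpisodicMDP S A H) (π : Policy S A H) (h : Fin H) (s₀ : S)
    (a₀ : A) (s' : S) : M.stateDist π h.castSucc s₀ * π.prob h s₀ a₀ * M.P h s₀ a₀ s'
      ≤ M.stateDist π h.succ s' := by
  rw [stateDist_succ, mul_assoc]
  have h2 : ∀ s a, 0 ≤ π.prob h s a * M.P h s a s' := fun s a =>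
    mul_nonneg (π.nonneg ..) (M.P_nonneg ..)
  refine le_trans (mul_le_mul_of_nonneg_left ?_ (M.stateDist_nonneg ..))
    (Finset.single_le_sum (f := fun s => M.stateDist π h.castSucc s *
      ∑ a, π.prob h s a * M.P h s a s') (fun s _ => mul_nonneg (M.stateDist_nonneg ..)
        (Finset.sum_nonneg fun a _ => h2 s a)) (Finset.mem_univ s₀))
  exact Finset.single_le_sum (f := fun a => π.prob h s₀ a * M.P h s₀ a s')
    (fun a _ => h2 s₀ a) (Finset.mem_univ a₀)

lemma flow_nonneg (M : EpisodicMDP S A H) (π : Policy S A H) (h : Fin H) (s₀ : S)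
    (a₀ : A) (s' : S) : 0 ≤ M.stateDist π h.castSucc s₀ * π.prob h s₀ a₀ * M.P h s₀ a₀ s' :=
  mul_nonneg (mul_nonneg (M.stateDist_nonneg ..) (π.nonneg ..)) (M.P_nonneg ..)

lemma backProb_nonneg (M : EpisodicMDP S A H) (π : Policy S A H) (h : Fin H) (s₀ : S) (a₀ : A)
    (s' : S) : 0 ≤ M.backProb π h s₀ a₀ s' :=
  div_nonneg (M.flow_nonneg ..) (M.stateDist_nonneg ..)

lemma backProb_le_one (M : EpisodicMDP S A H) (π : Policy S A H) (h : Fin H) (s₀ : S) (a₀ : A)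
    (s' : S) : M.backProb π h s₀ a₀ s' ≤ 1 :=
  div_le_one_of_le₀ (M.flow_le_stateDist_succ ..) (M.stateDist_nonneg ..)

/-- Bayes' rule. At a next state of probability zero `backProb` is zero by the convention for
division, and the right-hand side vanishes as well because it is dominated by that probability. -/
lemma stateDist_mul_backProb (M : EpisodicMDP S A H) (π : Policy S A H) (h : Fin H) (s₀ : S)
    (a₀ : A) (s' : S) : M.stateDist π h.succ s' * M.backProb π h s₀ a₀ s'
      = M.stateDist π h.castSucc s₀ * π.prob h s₀ a₀ * M.P h s₀ a₀ s' := by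
  by_cases h0 : M.stateDist π h.succ s' = 0
  · have h1 := M.flow_le_stateDist_succ π h s₀ a₀ s'
    rw [h0] at h1
    rw [h0, zero_mul, le_antisymm h1 (M.flow_nonneg ..)]
  · rw [backProb, mul_div_cancel₀ _ h0]

/-- Rewards after time `h` depend only on states and actions that survive the erasure; every earlier
reward is sent to the point mass at `0`, whatever its law. -/
lemma map_forgetReward_rewardLaw (M : EpisodicMDP S A H) (h : Fin H) (s₀ : S) (a₀ : A)
    (s : Fin (H + 1) → S) (a : Fin H → A) :
    (M.rewardLaw s a).map (forgetReward h)
      = (M.rewardLaw (forgetPath h s₀ a₀ (s, a)).1 (forgetPath h s₀ a₀ (s, a)).2).map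
          (forgetReward h) := by
  have hm : ∀ j : Fin H, Measurable (if h < j then id else fun _ => (0 : ℝ)) := by
    intro j; split_ifs <;> fun_prop
  have key : ∀ (s : Fin (H + 1) → S) (a : Fin H → A), (M.rewardLaw s a).map (forgetReward h)
      = Measure.pi fun j => (M.R j (s j.castSucc) (a j) : Measure ℝ).map
          (if h < j then id else fun _ => (0 : ℝ)) := by
    intro s a
    exact (Measure.pi_map_pi (μ := fun j => (M.R j (s j.castSucc) (a j) : Measure ℝ))
      (f := fun j => if h < j then id else fun _ => (0 : ℝ)) fun j => (hm j).aemeasurable)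
  rw [key, key]
  congr 1
  funext j
  by_cases hj : h < j
  · simp [forgetPath, hj]
  · simp [hj, Measure.map_const]

variable [MeasurableSpace S] [MeasurableSpace A]

lemma measurable_forget (h : Fin H) (s₀ : S) (a₀ : A) :
    Measurable (forget h s₀ a₀ : Episode S A H → Episode S A H) := by
  refine Measurable.prodMk (measurable_pi_lambda _ fun i => ?_) (Measurable.prodMk
    (measurable_pi_lambda _ fun j => ?_) (measurable_pi_lambda _ fun j => ?_))
  · by_cases hi : h.castSucc < i <;> simp only [forgetPath, hi, if_true, if_false]
    · exact Episode.measurable_state i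
    · fun_prop
  · by_cases hi : h < j <;> simp only [forgetPath, hi, if_true, if_false]
    · exact Episode.measurable_action j
    · fun_prop
  · by_cases hi : h < j <;> simp only [forgetReward, hi, if_true, if_false]
    · exact Episode.measurable_reward j
    · fun_prop

variable [MeasurableSingletonClass S] [MeasurableSingletonClass A]

/-- If two functions of the transition at time `h` have the same conditional mean given the next
state, they have the same mean against every function of the future. -/
lemma lintegral_mul_forget_congr (M : EpisodicMDP S A H) (π : Policy S A H) (h : Fin H) (s₀ : S)
    (a₀ : A) (X Y : S → A → S → ℝ) (hX : ∀ s a s', 0 ≤ X s a s') (hY : ∀ s a s', 0 ≤ Y s a s')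
    (hXY : ∀ s', ∑ s, M.stateDist π h.castSucc s * ∑ a, π.prob h s a * M.P h s a s' * X s a s'
      = ∑ s, M.stateDist π h.castSucc s * ∑ a, π.prob h s a * M.P h s a s' * Y s a s')
    (ψ : Episode S A H → ENNReal) (hψ : Measurable ψ) :
    ∫⁻ e, ENNReal.ofReal (X (e.state h.castSucc) (e.action h) (e.state h.succ))
        * ψ (forget h s₀ a₀ e) ∂(M.episodeLaw π)
      = ∫⁻ e, ENNReal.ofReal (Y (e.state h.castSucc) (e.action h) (e.state h.succ))
        * ψ (forget h s₀ a₀ e) ∂(M.episodeLaw π) := by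
  classical
  let g : (Fin (H + 1) → S) × (Fin H → A) → ENNReal := fun q =>
    ∫⁻ r, ψ (q.1, q.2, forgetReward h r) ∂(M.rewardLaw q.1 q.2)
  have hmr : Measurable (forgetReward h) := by
    refine measurable_pi_lambda _ fun j => ?_
    by_cases hi : h < j <;> simp only [forgetReward, hi, if_true, if_false]
    · exact measurable_pi_apply j
    · fun_prop
  have hg : ∀ s a, ∫⁻ r, ψ (forget h s₀ a₀ (s, a, r)) ∂(M.rewardLaw s a)
      = g (forgetPath h s₀ a₀ (s, a)) := by
    intro s a
    let q := forgetPath h s₀ a₀ (s, a)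
    have h2 : Measurable fun r => ψ (q.1, q.2, r) := by fun_prop
    calc _ = ∫⁻ r, ψ (q.1, q.2, r) ∂((M.rewardLaw s a).map (forgetReward h)) :=
          (lintegral_map h2 hmr).symm
      _ = _ := by
          rw [M.map_forgetReward_rewardLaw h s₀ a₀ s a, lintegral_map h2 hmr]
  have hsum : ∀ Z : S → A → S → ℝ, (∀ s a s', 0 ≤ Z s a s') →
      ∫⁻ e, ENNReal.ofReal (Z (e.state h.castSucc) (e.action h) (e.state h.succ))
        * ψ (forget h s₀ a₀ e) ∂(M.episodeLaw π)
      = ∑ q with forgetPath h s₀ a₀ q = q, ENNReal.ofReal (∑ s : Fin (H + 1) → S,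
          ∑ a : Fin H → A, M.pathProb π s a *
            (if forgetPath h s₀ a₀ (s, a) = q then
              Z (s h.castSucc) (a h) (s h.succ) else 0)) * g q := by
    intro Z hZ
    have hnn : ∀ q (s : Fin (H + 1) → S) (a : Fin H → A), 0 ≤ M.pathProb π s a *
        (if forgetPath h s₀ a₀ (s, a) = q then Z (s h.castSucc) (a h) (s h.succ) else 0) := by
      intro q s a
      refine mul_nonneg (M.pathProb_nonneg π s a) ?_
      split_ifs
      exacts [hZ _ _ _, le_rfl]
    -- Paths are grouped by their future. As `forgetPath` is idempotent, the possible futures are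
    -- its fixed points, and the integral over the rewards depends on the path only through its
    -- future.
    rw [lintegral_episodeLaw, ← Fintype.sum_prod_type',
      ← Finset.sum_fiberwise_of_maps_to (g := fun p : (Fin (H + 1) → S) × (Fin H → A) =>
        forgetPath h s₀ a₀ p) (t := {q | forgetPath h s₀ a₀ q = q})
        (fun p _ => by simpa using forgetPath_idem h s₀ a₀ p)]
    refine Finset.sum_congr rfl fun q _ => ?_
    rw [← Fintype.sum_prod_type', ENNReal.ofReal_sum_of_nonneg fun p _ => hnn q p.1 p.2,
      Finset.sum_mul, Finset.sum_filter]
    refine Finset.sum_congr rfl fun p _ => ?_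
    by_cases hp : forgetPath h s₀ a₀ (p.1, p.2) = q
    · rw [if_pos hp, if_pos hp, ENNReal.ofReal_mul (M.pathProb_nonneg π _ _), mul_assoc, ← hp,
        ← hg]
      congr 1
      exact lintegral_const_mul' (ENNReal.ofReal (Z (p.1 h.castSucc) (p.2 h) (p.1 h.succ))) _
        ENNReal.ofReal_ne_top
    · rw [if_neg hp, if_neg hp]; simp
  rw [hsum X hX, hsum Y hY]
  refine Finset.sum_congr rfl fun q hq => ?_
  rw [M.sum_pathProb_fiber_congr π h s₀ a₀ X Y hXY q (by simpa using hq)]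

/-- Whether the episode visits `(s₀, a₀)` at time `h`. -/
def visits [DecidableEq S] [DecidableEq A] (h : Fin H) (s₀ : S) (a₀ : A) (e : Episode S A H) :
    Bool :=
  decide (e.state h.castSucc = s₀ ∧ e.action h = a₀)

/-- The law of `visits h s₀ a₀` given that `s_{h+1} = s'`. -/
def backKernel (M : EpisodicMDP S A H) (π : Policy S A H) (h : Fin H) (s₀ : S) (a₀ : A)
    (s' : S) (b : Bool) : ℝ :=
  if b then M.backProb π h s₀ a₀ s' else 1 - M.backProb π h s₀ a₀ s'

/-- The reversed chain is Markov: given the whole future, the chance of having come through `(s₀,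
a₀)` depends only on `s_{h+1}`. The indicator of the visit and `backKernel` have the same flow into
each next state, so `lintegral_mul_forget_congr` exchanges them. -/
lemma lintegral_visits_forget [DecidableEq S] [DecidableEq A] (M : EpisodicMDP S A H)
    (π : Policy S A H) (h : Fin H) (s₀ : S) (a₀ : A)
    (ψ : Bool → Episode S A H → ENNReal) (hψ : ∀ b, Measurable (ψ b)) :
    ∫⁻ e, ψ (visits h s₀ a₀ e) (forget h s₀ a₀ e) ∂(M.episodeLaw π)
      = ∫⁻ e, ∑ b, ENNReal.ofReal (M.backKernel π h s₀ a₀ (e.state h.succ) b)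
          * ψ b (forget h s₀ a₀ e) ∂(M.episodeLaw π) := by
  have hmeas : ∀ (Z : S → A → S → ℝ) (b : Bool), Measurable fun e : Episode S A H =>
      ENNReal.ofReal (Z (e.state h.castSucc) (e.action h) (e.state h.succ))
        * ψ b (forget h s₀ a₀ e) := by
    intro Z b
    refine Measurable.mul (ENNReal.measurable_ofReal.comp ?_)
      ((hψ b).comp (measurable_forget h s₀ a₀))
    exact (measurable_of_finite fun x : S × A × S => Z x.1 x.2.1 x.2.2).comp
      ((Episode.measurable_state _).prodMk
        ((Episode.measurable_action _).prodMk (Episode.measurable_state _)))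
  let I : Bool → S → A → S → ℝ := fun b s a _ =>
    if decide (s = s₀ ∧ a = a₀) = b then 1 else 0
  have hflow : ∀ s', ∑ s, M.stateDist π h.castSucc s * ∑ a, π.prob h s a * M.P h s a s' *
      I true s a s' = M.stateDist π h.castSucc s₀ * π.prob h s₀ a₀ * M.P h s₀ a₀ s' := by
    intro s'
    rw [Finset.sum_eq_single s₀, Finset.sum_eq_single a₀]
    · simp [I, mul_assoc]
    · intro a _ ha; simp [I, ha]
    · simp
    · intro s _ hs; simp [I, hs]
    · simp
  have hback : ∀ s', ∑ s, M.stateDist π h.castSucc s * ∑ a, π.prob h s a * M.P h s a s' *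
      M.backProb π h s₀ a₀ s'
      = M.stateDist π h.castSucc s₀ * π.prob h s₀ a₀ * M.P h s₀ a₀ s' := by
    intro s'
    rw [← stateDist_mul_backProb, stateDist_succ, Finset.sum_mul]
    simp only [Finset.sum_mul, mul_assoc]
  have key : ∀ b, ∫⁻ e, ENNReal.ofReal (I b (e.state h.castSucc) (e.action h) (e.state h.succ))
        * ψ b (forget h s₀ a₀ e) ∂(M.episodeLaw π)
      = ∫⁻ e, ENNReal.ofReal (M.backKernel π h s₀ a₀ (e.state h.succ) b)
          * ψ b (forget h s₀ a₀ e) ∂(M.episodeLaw π) := by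
    intro b
    refine M.lintegral_mul_forget_congr π h s₀ a₀ (I b)
      (fun _ _ s' => M.backKernel π h s₀ a₀ s' b) ?_ ?_ ?_ (ψ b) (hψ b)
    · intro s a s'; simp only [I]; split_ifs <;> norm_num
    · intro s a s'
      cases b
      · simpa [backKernel] using M.backProb_le_one π h s₀ a₀ s'
      · simpa [backKernel] using M.backProb_nonneg π h s₀ a₀ s'
    · intro s'
      cases b
      · have hI : ∀ s a, I false s a s' = 1 - I true s a s' := by
          intro s a
          by_cases hsa : s = s₀ ∧ a = a₀ <;> simp [I, hsa]
        simp only [hI, backKernel, mul_sub, mul_one, Finset.sum_sub_distrib, Bool.false_eq_true,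
          if_false]
        rw [hflow, hback]
      · simp only [backKernel, if_true]
        rw [hflow, hback]
  calc _ = ∫⁻ e, ∑ b, ENNReal.ofReal (I b (e.state h.castSucc) (e.action h) (e.state h.succ))
        * ψ b (forget h s₀ a₀ e) ∂(M.episodeLaw π) := by
        refine lintegral_congr fun e => ?_
        rw [Fintype.sum_bool]
        have hI : ∀ b, I b (e.state h.castSucc) (e.action h) (e.state h.succ)
            = if visits h s₀ a₀ e = b then 1 else 0 := fun _ => rfl
        simp only [hI]
        cases visits h s₀ a₀ e <;> simp
    _ = _ := by
        rw [lintegral_finsetSum _ fun b _ => hmeas (I b) b,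
          lintegral_finsetSum _ fun b _ => hmeas (fun _ _ s' => M.backKernel π h s₀ a₀ s' b) b]
        exact Finset.sum_congr rfl fun b _ => key b

end EpisodicMDP

/-! ### Exponential inequalities for independent samples and for conditionally independent marks. -/

namespace Concentration

variable {E : Type*} [MeasurableSpace E]

lemma lintegral_pi_fin_succ (ρ : Measure E) [IsProbabilityMeasure ρ] {n : ℕ}
    (f : (Fin (n + 1) → E) → ENNReal) (hf : Measurable f) :
    ∫⁻ D, f D ∂(Measure.pi fun _ => ρ)
      = ∫⁻ e, ∫⁻ D, f (Fin.cons e D) ∂(Measure.pi fun _ => ρ) ∂ρ := by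
  have hmp := (measurePreserving_piFinSuccAbove (fun _ : Fin (n + 1) => ρ) 0).symm
  have hcons : ∀ p : E × (Fin n → E),
      (MeasurableEquiv.piFinSuccAbove (fun _ : Fin (n + 1) => E) 0).symm p
        = Fin.cons p.1 p.2 := fun p => by
    simp [MeasurableEquiv.piFinSuccAbove, Fin.insertNthEquiv]
  rw [← hmp.lintegral_comp hf, lintegral_prod _ (by fun_prop)]
  simp only [hcons]

lemma measurable_fin_cons {n : ℕ} :
    Measurable fun p : E × (Fin n → E) => (Fin.cons p.1 p.2 : Fin (n + 1) → E) := by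
  refine measurable_pi_lambda _ fun i => ?_
  refine Fin.cases ?_ (fun j => ?_) i
  · simpa using measurable_fst
  · simp only [Fin.cons_succ]; fun_prop

/-- If the binary mark `x e` has conditional law `κ e` given `F e`, then the marks of independent
samples are conditionally independent given all the `F`-values. -/
theorem lintegral_pi_mark (ρ : Measure E) [IsProbabilityMeasure ρ] (x : E → Bool)
    (hxm : Measurable x) (F : E → E) (hF : Measurable F) (κ : E → Bool → ENNReal)
    (hκ : ∀ b, Measurable fun e => κ e b)
    (hx : ∀ ψ : Bool → E → ENNReal, (∀ b, Measurable (ψ b)) →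
      ∫⁻ e, ψ (x e) (F e) ∂ρ = ∫⁻ e, ∑ b, κ e b * ψ b (F e) ∂ρ)
    (n : ℕ) (Ψ : (Fin n → Bool) → (Fin n → E) → ENNReal) (hΨ : ∀ b, Measurable (Ψ b)) :
    ∫⁻ D, Ψ (fun τ => x (D τ)) (fun τ => F (D τ)) ∂(Measure.pi fun _ => ρ)
      = ∫⁻ D, ∑ b : Fin n → Bool, (∏ τ, κ (D τ) (b τ)) * Ψ b (fun τ => F (D τ))
          ∂(Measure.pi fun _ => ρ) := by
  induction n with
  | zero =>
    refine lintegral_congr fun D => ?_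
    rw [Fintype.sum_subsingleton _ fun τ => x (D τ)]
    simp
  | succ n ih =>
    have hΨu : Measurable fun p : (Fin (n + 1) → Bool) × (Fin (n + 1) → E) => Ψ p.1 p.2 :=
      measurable_from_prod_countable_right hΨ
    have hFn : ∀ k, Measurable fun D : Fin k → E => fun τ => F (D τ) := fun k =>
      measurable_pi_lambda _ fun τ => hF.comp (measurable_pi_apply τ)
    have hxn : ∀ k, Measurable fun D : Fin k → E => fun τ => x (D τ) := fun k =>
      measurable_pi_lambda _ fun τ => hxm.comp (measurable_pi_apply τ)
    have hprod : ∀ k (b : Fin k → Bool), Measurable fun D : Fin k → E => ∏ τ, κ (D τ) (b τ) :=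
      fun k b => Finset.measurable_prod _ fun τ _ => (hκ (b τ)).comp (measurable_pi_apply τ)
    have hcF : ∀ e (D : Fin n → E), (fun τ => F ((Fin.cons e D : Fin (n + 1) → E) τ))
        = Fin.cons (F e) fun τ => F (D τ) := by
      intro e D; funext τ; refine Fin.cases ?_ (fun j => ?_) τ <;> simp
    have hcx : ∀ e (D : Fin n → E), (fun τ => x ((Fin.cons e D : Fin (n + 1) → E) τ))
        = Fin.cons (x e) fun τ => x (D τ) := by
      intro e D; funext τ; refine Fin.cases ?_ (fun j => ?_) τ <;> simp
    have hstep : ∀ b : Fin n → Bool, Measurable fun p : E × (Fin n → E) =>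
        (∏ τ, κ (p.2 τ) (b τ)) *
          Ψ (Fin.cons (x p.1) b) (Fin.cons (F p.1) fun τ => F (p.2 τ)) := by
      intro b
      refine ((hprod n b).comp measurable_snd).mul (hΨu.comp (Measurable.prodMk ?_ ?_))
      · exact (measurable_fin_cons (E := Bool)).comp
          ((hxm.comp measurable_fst).prodMk measurable_const)
      · exact measurable_fin_cons.comp
          ((hF.comp measurable_fst).prodMk ((hFn n).comp measurable_snd))
    rw [lintegral_pi_fin_succ ρ (fun D => Ψ (fun τ => x (D τ)) (fun τ => F (D τ)))
        (hΨu.comp ((hxn _).prodMk (hFn _))),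
      lintegral_pi_fin_succ ρ (fun D => ∑ b : Fin (n + 1) → Bool, (∏ τ, κ (D τ) (b τ)) *
        Ψ b (fun τ => F (D τ))) (Finset.measurable_sum _ fun b _ =>
        (hprod _ b).mul ((hΨ b).comp (hFn _)))]
    simp only [hcF, hcx]
    -- With the first episode fixed, the induction hypothesis averages the other marks; Fubini then
    -- allows `hx` to average the first mark with the other episodes fixed, and a second exchange
    -- restores the order.
    calc _ = ∫⁻ e, ∫⁻ D, ∑ b : Fin n → Bool, (∏ τ, κ (D τ) (b τ)) *
              Ψ (Fin.cons (x e) b) (Fin.cons (F e) fun τ => F (D τ))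
              ∂(Measure.pi fun _ => ρ) ∂ρ := by
          refine lintegral_congr fun e => ?_
          refine ih (fun b D => Ψ (Fin.cons (x e) b) (Fin.cons (F e) D)) fun b => ?_
          exact (hΨ _).comp (measurable_fin_cons.comp (measurable_const.prodMk measurable_id))
      _ = ∫⁻ D, ∫⁻ e, ∑ b : Fin n → Bool, (∏ τ, κ (D τ) (b τ)) *
              Ψ (Fin.cons (x e) b) (Fin.cons (F e) fun τ => F (D τ))
              ∂ρ ∂(Measure.pi fun _ => ρ) :=
          lintegral_lintegral_swap
            (Finset.measurable_sum _ fun b _ => hstep b).aemeasurable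
      _ = ∫⁻ D, ∫⁻ e, ∑ b₀, κ e b₀ * ∑ b : Fin n → Bool, (∏ τ, κ (D τ) (b τ)) *
              Ψ (Fin.cons b₀ b) (Fin.cons (F e) fun τ => F (D τ))
              ∂ρ ∂(Measure.pi fun _ => ρ) := by
          refine lintegral_congr fun D => ?_
          refine hx (fun b₀ e => ∑ b : Fin n → Bool, (∏ τ, κ (D τ) (b τ)) *
              Ψ (Fin.cons b₀ b) (Fin.cons e fun τ => F (D τ))) fun b₀ => ?_
          refine Finset.measurable_sum _ fun b _ => Measurable.const_mul ?_ _
          exact (hΨ _).comp (measurable_fin_cons.comp (measurable_id.prodMk measurable_const))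
      _ = ∫⁻ e, ∫⁻ D, ∑ b₀, κ e b₀ * ∑ b : Fin n → Bool, (∏ τ, κ (D τ) (b τ)) *
              Ψ (Fin.cons b₀ b) (Fin.cons (F e) fun τ => F (D τ))
              ∂(Measure.pi fun _ => ρ) ∂ρ := by
          refine (lintegral_lintegral_swap ?_).symm
          refine (Finset.measurable_sum _ fun b₀ _ => ((hκ b₀).comp measurable_fst).mul
            (Finset.measurable_sum _ fun b _ => ((hprod n b).comp measurable_snd).mul
              ((hΨ _).comp (measurable_fin_cons.comp ((hF.comp measurable_fst).prodMk
                ((hFn n).comp measurable_snd)))))).aemeasurable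
      _ = _ := by
          refine lintegral_congr fun e => lintegral_congr fun D => ?_
          rw [← (Fin.consEquiv fun _ => Bool).sum_comp, Fintype.sum_prod_type]
          refine Finset.sum_congr rfl fun b₀ _ => ?_
          rw [Finset.mul_sum]
          refine Finset.sum_congr rfl fun b _ => ?_
          simp [Fin.consEquiv, Fin.prod_univ_succ, mul_assoc]

lemma measure_lt_le_exp {Ω : Type*} [MeasurableSpace Ω] (μ : Measure Ω) (Y : Ω → ℝ)
    (hY : AEMeasurable Y μ) (h : ∫⁻ ω, ENNReal.ofReal (Real.exp (Y ω)) ∂μ ≤ 1) (t : ℝ) :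
    μ {ω | t < Y ω} ≤ ENNReal.ofReal (Real.exp (-t)) := by
  have h1 := mul_meas_ge_le_lintegral₀ (μ := μ)
    (f := fun ω => ENNReal.ofReal (Real.exp (Y ω)))
    (ENNReal.measurable_ofReal.comp_aemeasurable (Real.measurable_exp.comp_aemeasurable hY))
    (ENNReal.ofReal (Real.exp t))
  have h2 : μ {ω | t < Y ω}
      ≤ μ {ω | ENNReal.ofReal (Real.exp t) ≤ ENNReal.ofReal (Real.exp (Y ω))} :=
    measure_mono fun ω (hω : t < Y ω) =>
      ENNReal.ofReal_le_ofReal (Real.exp_le_exp.2 hω.le)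
  rw [Real.exp_neg, ENNReal.ofReal_inv_of_pos (Real.exp_pos t)]
  rw [ENNReal.le_inv_iff_mul_le, mul_comm]
  exact (mul_le_mul_right h2 _).trans (h1.trans h)

/-- The source of the expression `φ + φ ^ 2` in all tail bounds below. -/
lemma exp_le_of_abs_le_one {x : ℝ} (hx : |x| ≤ 1) : Real.exp x ≤ 1 + (x + x ^ 2) := by
  have := (abs_le.1 (Real.abs_exp_sub_one_sub_id_le hx)).2
  linarith

lemma lintegral_pi_prod (ρ : Measure E) [IsProbabilityMeasure ρ] (f : E → ENNReal)
    (hf : Measurable f) (n : ℕ) :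
    ∫⁻ D, ∏ τ : Fin n, f (D τ) ∂(Measure.pi fun _ => ρ) = (∫⁻ e, f e ∂ρ) ^ n := by
  induction n with
  | zero => simp
  | succ n ih =>
    rw [lintegral_pi_fin_succ ρ _ (by fun_prop)]
    simp only [Fin.prod_univ_succ, Fin.cons_zero, Fin.cons_succ]
    rw [pow_succ', ← lintegral_mul_const _ hf]
    refine lintegral_congr fun e => ?_
    rw [lintegral_const_mul _ (by fun_prop), ih]

/-- Bernstein's inequality for independent samples, in exponential form. -/
theorem measure_sum_gt_le (ρ : Measure E) [IsProbabilityMeasure ρ] (n : ℕ) (φ : E → ℝ)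
    (hφ : Measurable φ) (hb : ∀ᵐ e ∂ρ, |φ e| ≤ 1) (t : ℝ) :
    (Measure.pi fun _ : Fin n => ρ)
        {D | n * (∫ e, (φ e + φ e ^ 2) ∂ρ) + t < ∑ τ, φ (D τ)}
      ≤ ENNReal.ofReal (Real.exp (-t)) := by
  set v := ∫ e, (φ e + φ e ^ 2) ∂ρ with hv
  have hint : Integrable (fun e => φ e + φ e ^ 2) ρ := by
    refine Integrable.of_bound (by fun_prop) 2 ?_
    filter_upwards [hb] with e he
    have h1 := abs_le.1 he
    rw [Real.norm_eq_abs, abs_le]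
    constructor <;> nlinarith
  -- `E exp φ ≤ 1 + v ≤ exp v`.
  have hone : ∫⁻ e, ENNReal.ofReal (Real.exp (φ e)) ∂ρ ≤ ENNReal.ofReal (Real.exp v) := by
    calc _ ≤ ∫⁻ e, ENNReal.ofReal (1 + (φ e + φ e ^ 2)) ∂ρ := by
          refine lintegral_mono_ae ?_
          filter_upwards [hb] with e he
          exact ENNReal.ofReal_le_ofReal (exp_le_of_abs_le_one he)
      _ = ENNReal.ofReal (∫ e, (1 + (φ e + φ e ^ 2)) ∂ρ) := by
          rw [ofReal_integral_eq_lintegral_ofReal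
            (f := fun e => 1 + (φ e + φ e ^ 2)) ((integrable_const _).add hint)]
          filter_upwards [hb] with e he
          have h1 := abs_le.1 he
          change (0 : ℝ) ≤ 1 + (φ e + φ e ^ 2)
          nlinarith
      _ ≤ _ := by
          refine ENNReal.ofReal_le_ofReal ?_
          rw [integral_add (integrable_const _) hint]
          simp only [integral_const, probReal_univ, smul_eq_mul, mul_one]
          linarith [Real.add_one_le_exp v]
  have hset : {D : Fin n → E | n * v + t < ∑ τ, φ (D τ)}
      = {D | t < ∑ τ, φ (D τ) - n * v} := by
    ext D; simp only [Set.mem_ofPred_eq]; constructor <;> intro h <;> linarith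
  rw [hset]
  refine measure_lt_le_exp _ _ (Measurable.aemeasurable (by fun_prop)) ?_ t
  have hexp : ∀ D : Fin n → E, ENNReal.ofReal (Real.exp (∑ τ, φ (D τ) - n * v))
      = ENNReal.ofReal (Real.exp (-(n * v))) * ∏ τ, ENNReal.ofReal (Real.exp (φ (D τ))) := by
    intro D
    rw [← ENNReal.ofReal_prod_of_nonneg fun _ _ => (Real.exp_pos _).le, ← Real.exp_sum,
      ← ENNReal.ofReal_mul (Real.exp_pos _).le, ← Real.exp_add]
    ring_nf
  simp only [hexp]
  rw [lintegral_const_mul _ (by fun_prop), lintegral_pi_prod ρ (fun e => ENNReal.ofReal (Real.exp (φ e))) (by fun_prop)]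
  calc _ ≤ ENNReal.ofReal (Real.exp (-(n * v))) * ENNReal.ofReal (Real.exp v) ^ n := by gcongr
    _ = 1 := by
      rw [← ENNReal.ofReal_pow (Real.exp_pos _).le, ← Real.exp_nat_mul,
        ← ENNReal.ofReal_mul (Real.exp_pos _).le, ← Real.exp_add]
      simp

/-- Bernstein's inequality for binary marks that are conditionally independent given the
`F`-values, with weights that depend on all the `F`-values. -/
theorem measure_mark_sum_gt_le (ρ : Measure E) [IsProbabilityMeasure ρ] (x : E → Bool)
    (hxm : Measurable x) (F : E → E) (hF : Measurable F) (z : E → ℝ) (hz : Measurable z)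
    (hz0 : ∀ e, 0 ≤ z e) (hz1 : ∀ e, z e ≤ 1) (hzF : ∀ e, z (F e) = z e)
    (hx : ∀ ψ : Bool → E → ENNReal, (∀ b, Measurable (ψ b)) →
      ∫⁻ e, ψ (x e) (F e) ∂ρ
        = ∫⁻ e, ∑ b, ENNReal.ofReal (if b then z e else 1 - z e) * ψ b (F e) ∂ρ)
    (n : ℕ) (w : Fin n → (Fin n → E) → ℝ) (hw : ∀ τ, Measurable (w τ))
    (hwF : ∀ τ D, w τ (fun σ => F (D σ)) = w τ D) (hw1 : ∀ τ D, |w τ D| ≤ 1) (t : ℝ) :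
    (Measure.pi fun _ : Fin n => ρ)
        {D | ∑ τ, z (D τ) * (w τ D + w τ D ^ 2) + t < ∑ τ, if x (D τ) then w τ D else 0}
      ≤ ENNReal.ofReal (Real.exp (-t)) := by
  have hset : {D : Fin n → E | ∑ τ, z (D τ) * (w τ D + w τ D ^ 2) + t
        < ∑ τ, if x (D τ) then w τ D else 0}
      = {D | t < (∑ τ, if x (D τ) then w τ D else 0)
          - ∑ τ, z (D τ) * (w τ D + w τ D ^ 2)} := by
    ext D; simp only [Set.mem_ofPred_eq]; constructor <;> intro h <;> linarith
  rw [hset]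
  have hzm : Measurable fun D : Fin n → E => ∑ τ, z (D τ) * (w τ D + w τ D ^ 2) :=
    Finset.measurable_sum _ fun τ _ => (hz.comp (measurable_pi_apply τ)).mul
      ((hw τ).add ((hw τ).pow_const 2))
  refine measure_lt_le_exp _ (fun D => (∑ τ, if x (D τ) then w τ D else 0)
    - ∑ τ, z (D τ) * (w τ D + w τ D ^ 2)) (Measurable.aemeasurable (Measurable.sub
    (Finset.measurable_sum _ fun τ _ => Measurable.ite ?_ (hw τ) measurable_const) hzm)) ?_ t
  · exact (hxm.comp (measurable_pi_apply τ)) (measurableSet_singleton true)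
  -- By `hwF` and `hzF` the weights and the probabilities are functions of the `F`-values, so they
  -- stay fixed while the marks are averaged.
  have key := lintegral_pi_mark ρ x hxm F hF
    (fun e b => ENNReal.ofReal (if b then z e else 1 - z e))
    (fun b => by cases b <;> simp <;> fun_prop) hx n
    (fun b D => ENNReal.ofReal (Real.exp ((∑ τ, if b τ then w τ D else 0)
          - ∑ τ, z (D τ) * (w τ D + w τ D ^ 2))))
    (fun b => ENNReal.measurable_ofReal.comp (Real.measurable_exp.comp
      (Measurable.sub (Finset.measurable_sum _ fun τ _ => by
        cases b τ <;> simp [hw τ]) hzm)))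
  simp only [hwF, hzF] at key
  rw [key]
  refine (lintegral_mono fun D => ?_).trans (b := ∫⁻ _, 1 ∂(Measure.pi fun _ : Fin n => ρ))
    (by simp)
  have hk : ∀ (b : Fin n → Bool) τ, 0 ≤ if b τ then z (D τ) else 1 - z (D τ) := by
    intro b τ
    split_ifs
    exacts [hz0 _, sub_nonneg.2 (hz1 _)]
  calc _ = ENNReal.ofReal (∑ b : Fin n → Bool, (∏ τ, if b τ then z (D τ) else 1 - z (D τ)) *
        Real.exp ((∑ τ, if b τ then w τ D else 0)
          - ∑ τ, z (D τ) * (w τ D + w τ D ^ 2))) := by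
        rw [ENNReal.ofReal_sum_of_nonneg fun b _ =>
          mul_nonneg (Finset.prod_nonneg fun τ _ => hk b τ) (Real.exp_pos _).le]
        refine Finset.sum_congr rfl fun b _ => ?_
        rw [ENNReal.ofReal_mul (Finset.prod_nonneg fun τ _ => hk b τ),
          ENNReal.ofReal_prod_of_nonneg fun τ _ => hk b τ]
    _ ≤ ENNReal.ofReal 1 := by
        refine ENNReal.ofReal_le_ofReal ?_
        have h1 : ∀ b : Fin n → Bool, (∏ τ, if b τ then z (D τ) else 1 - z (D τ)) *
            Real.exp ((∑ τ, if b τ then w τ D else 0)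
              - ∑ τ, z (D τ) * (w τ D + w τ D ^ 2))
            = ∏ τ, ((if b τ then z (D τ) else 1 - z (D τ)) *
              Real.exp ((if b τ then w τ D else 0) - z (D τ) * (w τ D + w τ D ^ 2))) := by
          intro b
          rw [Finset.prod_mul_distrib, ← Real.exp_sum, Finset.sum_sub_distrib]
        simp only [h1]
        -- The sum over all mark vectors of a product is the product of the sums over single marks,
        -- so one factor `(z e^w + 1 - z) e^{-z(w + w²)}` per sample has to be at most `1`.
        have h2 := Finset.prod_univ_sum (fun _ : Fin n => (Finset.univ : Finset Bool))
          (fun τ b => (if b then z (D τ) else 1 - z (D τ)) *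
              Real.exp ((if b then w τ D else 0) - z (D τ) * (w τ D + w τ D ^ 2)))
        rw [Fintype.piFinset_univ] at h2
        rw [← h2]
        refine Finset.prod_le_one (fun τ _ => Finset.sum_nonneg fun b _ =>
          mul_nonneg (hk (fun _ => b) τ) (Real.exp_pos _).le) fun τ _ => ?_
        rw [Fintype.sum_bool]
        simp only [if_true, Bool.false_eq_true, if_false]
        rw [Real.exp_sub, Real.exp_sub, Real.exp_zero, ← mul_div_assoc, ← mul_div_assoc,
          ← add_div, mul_one]
        refine div_le_one_of_le₀ ?_ (Real.exp_pos _).le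
        -- `z e^w + 1 - z ≤ 1 + z(w + w²) ≤ exp(z(w + w²))`.
        have h3 := mul_le_mul_of_nonneg_left (exp_le_of_abs_le_one (hw1 τ D)) (hz0 (D τ))
        linarith [Real.add_one_le_exp (z (D τ) * (w τ D + w τ D ^ 2))]
    _ = 1 := ENNReal.ofReal_one

end Concentration

namespace APVI

variable {S A : Type*} [Fintype S] [Fintype A] [DecidableEq S] [DecidableEq A] {H n : ℕ}

/-! ### The greedy value functions -/

/-- The value functions of APVI, which do not depend on how ties are broken. -/
def vMax (δ C : ℝ) (D : Fin n → Episode S A H) : Fin (H + 1) → S → ℝ :=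
  Fin.reverseInduction (motive := fun _ => S → ℝ) (fun _ => 0)
    (fun h V s => ⨆ a, qBar δ C D h V s a)

@[simp] lemma vMax_last (δ C : ℝ) (D : Fin n → Episode S A H) (s : S) :
    vMax δ C D (Fin.last H) s = 0 := by
  simp [vMax]

lemma vMax_castSucc (δ C : ℝ) (D : Fin n → Episode S A H) (h : Fin H) (s : S) :
    vMax δ C D h.castSucc s = ⨆ a, qBar δ C D h (vMax δ C D h.succ) s a := by
  simp [vMax]

@[simp] lemma vHat_last (δ C : ℝ) (D : Fin n → Episode S A H) (π : Policy S A H) (s : S) :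
    vHat δ C D π (Fin.last H) s = 0 := by
  simp [vHat]

lemma vHat_castSucc (δ C : ℝ) (D : Fin n → Episode S A H) (π : Policy S A H) (h : Fin H)
    (s : S) : vHat δ C D π h.castSucc s
      = ∑ a, qBar δ C D h (vHat δ C D π h.succ) s a * π.prob h s a := by
  simp [vHat]

/-- Testing optimality against point masses shows that the maximum is attained. The value functions
are thus functions of the data alone, and one good event serves all tie-breaking rules. -/
lemma IsOutput.vHat_eq [Nonempty A] {δ C : ℝ} {D : Fin n → Episode S A H} {π : Policy S A H}
    (hπ : IsOutput δ C D π) (i : Fin (H + 1)) : vHat δ C D π i = vMax δ C D i := by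
  induction i using Fin.reverseInduction with
  | last => funext s; simp
  | cast h ih =>
    funext s
    rw [vHat_castSucc, vMax_castSucc, ← ih]
    refine le_antisymm ?_ (ciSup_le fun a => ?_)
    · calc _ ≤ ∑ a, (⨆ a, qBar δ C D h (vHat δ C D π h.succ) s a) * π.prob h s a :=
            Finset.sum_le_sum fun a _ => mul_le_mul_of_nonneg_right
              (le_ciSup (Set.finite_range _).bddAbove a) (π.nonneg ..)
        _ = _ := by rw [← Finset.mul_sum, π.sum_one, mul_one]
    · have := hπ h s (Pi.single a 1) (single_mem_stdSimplex ℝ a)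
      simpa [Pi.single_apply] using this

lemma qBar_nonneg (δ C : ℝ) (D : Fin n → Episode S A H) (h : Fin H) (V : S → ℝ) (s : S) (a : A) :
    0 ≤ qBar δ C D h V s a :=
  le_max_left ..

lemma qBar_le (δ C : ℝ) (D : Fin n → Episode S A H) (h : Fin H) (V : S → ℝ) (s : S) (a : A) :
    qBar δ C D h V s a ≤ (H : ℝ) - (h : ℕ) := by
  refine max_le (sub_nonneg.2 ?_) (min_le_right ..)
  exact_mod_cast h.2.le

lemma vMax_nonneg (δ C : ℝ) (D : Fin n → Episode S A H) (i : Fin (H + 1)) (s : S) :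
    0 ≤ vMax δ C D i s := by
  induction i using Fin.lastCases with
  | last => simp
  | cast h =>
    rw [vMax_castSucc]
    exact Real.iSup_nonneg fun a => qBar_nonneg ..

lemma vMax_le [Nonempty A] (δ C : ℝ) (D : Fin n → Episode S A H) (i : Fin (H + 1)) (s : S) :
    vMax δ C D i s ≤ (H : ℝ) - (i : ℕ) := by
  induction i using Fin.lastCases with
  | last => simp
  | cast h =>
    rw [vMax_castSucc]
    exact ciSup_le fun a => qBar_le ..

lemma qBar_congr {D D' : Fin n → Episode S A H} {h : Fin H}
    (h1 : ∀ τ, (D τ).state h.castSucc = (D' τ).state h.castSucc)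
    (h2 : ∀ τ, (D τ).state h.succ = (D' τ).state h.succ)
    (h3 : ∀ τ, (D τ).action h = (D' τ).action h)
    (h4 : ∀ τ, (D τ).reward h = (D' τ).reward h) (δ C : ℝ) :
    qBar δ C D h = qBar δ C D' h := by
  funext V s a
  have hc : count D h s a = count D' h s a := by simp only [count, h1, h3]
  have ht : transHat D h s a = transHat D' h s a := by
    funext s'; simp only [transHat, hc, h1, h2, h3]
  have hr : rewardHat D h s a = rewardHat D' h s a := by
    simp only [rewardHat, hc, h1, h3, h4]
  have hv : rewardVarHat D h s a = rewardVarHat D' h s a := by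
    simp only [rewardVarHat, hc, hr, h1, h3, h4]
  simp only [qBar, bonus, stepVarHat, valueVarHat, hc, ht, hr, hv]

/-- The recursion at a time `j > h` uses only the states, actions and rewards of steps `j` and
later, none of which is erased. This independence of the past is what the time reversal exploits. -/
lemma vMax_forget (δ C : ℝ) (D : Fin n → Episode S A H) (h : Fin H) (s₀ : S) (a₀ : A)
    (i : Fin (H + 1)) (hi : h.castSucc < i) :
    vMax δ C (fun τ => EpisodicMDP.forget h s₀ a₀ (D τ)) i = vMax δ C D i := by
  induction i using Fin.reverseInduction with
  | last => funext s; simp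
  | cast j ih =>
    have hj : h < j := by simpa using hi
    have hj' : h.castSucc < j.succ := hi.trans Fin.castSucc_lt_succ
    funext s
    rw [vMax_castSucc, vMax_castSucc, ih hj']
    rw [qBar_congr (D' := D)] <;> intro τ <;>
      simp [EpisodicMDP.forget, EpisodicMDP.forgetPath, EpisodicMDP.forgetReward, Episode.state,
        Episode.action, Episode.reward, hj, hj.le]

section Measurability

variable [MeasurableSpace S] [MeasurableSingletonClass S]
  [MeasurableSpace A] [MeasurableSingletonClass A]

lemma measurableSet_visit (τ : Fin n) (h : Fin H) (s : S) (a : A) :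
    MeasurableSet {D : Fin n → Episode S A H |
      (D τ).state h.castSucc = s ∧ (D τ).action h = a} :=
  (measurableSet_eq_fun ((Episode.measurable_state _).comp (measurable_pi_apply τ))
    measurable_const).inter (measurableSet_eq_fun
      ((Episode.measurable_action _).comp (measurable_pi_apply τ)) measurable_const)

lemma measurable_count (h : Fin H) (s : S) (a : A) :
    Measurable fun D : Fin n → Episode S A H => count D h s a :=
  Finset.measurable_sum _ fun τ _ =>
    Measurable.ite (measurableSet_visit τ h s a) measurable_const measurable_const

lemma measurableSet_count_eq_zero (h : Fin H) (s : S) (a : A) :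
    MeasurableSet {D : Fin n → Episode S A H | count D h s a = 0} :=
  measurable_count h s a (measurableSet_singleton 0)

lemma measurable_natCast_count (h : Fin H) (s : S) (a : A) :
    Measurable fun D : Fin n → Episode S A H => (count D h s a : ℝ) :=
  measurable_from_top.comp (measurable_count h s a)

lemma measurable_transHat (h : Fin H) (s : S) (a : A) (s' : S) :
    Measurable fun D : Fin n → Episode S A H => transHat D h s a s' := by
  refine Measurable.ite (measurableSet_count_eq_zero h s a) measurable_const
    (Measurable.div (Finset.measurable_sum _ fun τ _ => Measurable.ite ?_ measurable_const
      measurable_const) (measurable_natCast_count h s a))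
  exact (measurableSet_eq_fun ((Episode.measurable_state _).comp (measurable_pi_apply τ))
    measurable_const).inter (measurableSet_visit τ h s a)

lemma measurable_rewardHat (h : Fin H) (s : S) (a : A) :
    Measurable fun D : Fin n → Episode S A H => rewardHat D h s a :=
  Measurable.ite (measurableSet_count_eq_zero h s a) measurable_const
    (Measurable.div (Finset.measurable_sum _ fun τ _ =>
      Measurable.ite (measurableSet_visit τ h s a)
        ((Episode.measurable_reward h).comp (measurable_pi_apply τ)) measurable_const)
      (measurable_natCast_count h s a))

lemma measurable_rewardVarHat (h : Fin H) (s : S) (a : A) :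
    Measurable fun D : Fin n → Episode S A H => rewardVarHat D h s a :=
  Measurable.div (Finset.measurable_sum _ fun τ _ =>
      Measurable.ite (measurableSet_visit τ h s a)
        ((((Episode.measurable_reward h).comp (measurable_pi_apply τ)).sub
          (measurable_rewardHat h s a)).pow_const 2) measurable_const)
      (measurable_natCast_count h s a)

lemma measurable_qBar (δ C : ℝ) (h : Fin H) (V : (Fin n → Episode S A H) → S → ℝ)
    (hV : ∀ s, Measurable fun D => V D s) (s : S) (a : A) :
    Measurable fun D : Fin n → Episode S A H => qBar δ C D h (V D) s a := by
  have hc := measurable_natCast_count (n := n) h s a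
  have ht := measurable_transHat (n := n) h s a
  have hr := measurable_rewardHat (n := n) h s a
  have hv := measurable_rewardVarHat (n := n) h s a
  have hb : Measurable fun D : Fin n → Episode S A H => bonus δ C D h (V D) s a := by
    refine Measurable.ite (measurableSet_count_eq_zero h s a) measurable_const ?_
    unfold stepVarHat valueVarHat
    fun_prop
  unfold qBar
  fun_prop

lemma measurable_vMax (δ C : ℝ) (i : Fin (H + 1)) (s : S) :
    Measurable fun D : Fin n → Episode S A H => vMax δ C D i s := by
  induction i using Fin.reverseInduction generalizing s with
  | last => simp
  | cast h ih =>
    simp only [vMax_castSucc]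
    exact Measurable.iSup fun a => measurable_qBar δ C h _ ih s a

end Measurability

end APVI

/-! ### The good event and its probability. -/

namespace EpisodicMDP

variable {S A : Type*} [Fintype S] [Fintype A] {H n : ℕ}

/-- The variance of the reward at `(s, a)`. -/
def rewardVar (M : EpisodicMDP S A H) (h : Fin H) (s : S) (a : A) : ℝ :=
  ∫ x, (x - M.meanReward h s a) ^ 2 ∂(M.R h s a : Measure ℝ)

/-- `V(s') - (P_h V)(s, a)`. -/
def centered (M : EpisodicMDP S A H) (h : Fin H) (V : S → ℝ) (s : S) (a : A) (s' : S) : ℝ :=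
  V s' - ∑ s'', M.P h s a s'' * V s''

/-- The variance of `V(s')` for `s' ∼ P_h(· | s, a)`. -/
def valueVar (M : EpisodicMDP S A H) (h : Fin H) (V : S → ℝ) (s : S) (a : A) : ℝ :=
  ∑ s', M.P h s a s' * M.centered h V s a s' ^ 2

/-- The state-action occupancy computed from the forward state distribution. -/
def flow (M : EpisodicMDP S A H) (μ : Policy S A H) (h : Fin H) (s : S) (a : A) : ℝ :=
  M.stateDist μ h.castSucc s * μ.prob h s a

lemma flow_nn (M : EpisodicMDP S A H) (μ : Policy S A H) (h : Fin H) (s : S) (a : A) :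
    0 ≤ M.flow μ h s a :=
  mul_nonneg (M.stateDist_nonneg ..) (μ.nonneg ..)

lemma rewardVar_nonneg (M : EpisodicMDP S A H) (h : Fin H) (s : S) (a : A) :
    0 ≤ M.rewardVar h s a :=
  integral_nonneg fun _ => sq_nonneg _

lemma valueVar_nonneg (M : EpisodicMDP S A H) (h : Fin H) (V : S → ℝ) (s : S) (a : A) :
    0 ≤ M.valueVar h V s a :=
  Finset.sum_nonneg fun _ _ => mul_nonneg (M.P_nonneg ..) (sq_nonneg _)

lemma meanReward_mem (M : EpisodicMDP S A H) (h : Fin H) (s : S) (a : A) :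
    M.meanReward h s a ∈ Set.Icc (0 : ℝ) 1 := by
  constructor
  · refine integral_nonneg_of_ae ?_
    filter_upwards [M.R_mem h s a] with x hx using hx.1
  · have : M.meanReward h s a ≤ ∫ _, (1 : ℝ) ∂(M.R h s a : Measure ℝ) := by
      refine integral_mono_ae (M.integrable_of_continuous h s a (fun x => x) continuous_id)
        (integrable_const _) ?_
      filter_upwards [M.R_mem h s a] with x hx using hx.2
    simpa using this

lemma centered_abs_le (M : EpisodicMDP S A H) (h : Fin H) (V : S → ℝ) (s : S) (a : A) (B : ℝ)
    (h0 : ∀ s, 0 ≤ V s) (hB : ∀ s, V s ≤ B) (s' : S) : |M.centered h V s a s'| ≤ B := by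
  have h1 : 0 ≤ ∑ s'', M.P h s a s'' * V s'' :=
    Finset.sum_nonneg fun s _ => mul_nonneg (M.P_nonneg ..) (h0 s)
  have h2 : ∑ s'', M.P h s a s'' * V s'' ≤ B := by
    calc _ ≤ ∑ s'', M.P h s a s'' * B :=
          Finset.sum_le_sum fun s _ => mul_le_mul_of_nonneg_left (hB s) (M.P_nonneg ..)
      _ = B := by rw [← Finset.sum_mul, M.P_sum, one_mul]
  rw [centered, abs_le]
  constructor <;> linarith [h0 s', hB s']

variable [DecidableEq S] [DecidableEq A]

/-- Bernstein-type upper bound for a function of the reward, summed over the visits. -/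
def VisitTail (M : EpisodicMDP S A H) (μ : Policy S A H) (t : ℝ) (D : Fin n → Episode S A H)
    (h : Fin H) (s : S) (a : A) (f : ℝ → ℝ) : Prop :=
  ∑ τ, (if (D τ).state h.castSucc = s ∧ (D τ).action h = a then f ((D τ).reward h) else 0)
    ≤ n * (M.flow μ h s a * ∫ x, (f x + f x ^ 2) ∂(M.R h s a : Measure ℝ)) + t

/-- Bernstein-type upper bound for the number of visits of a state. -/
def StateTail (M : EpisodicMDP S A H) (μ : Policy S A H) (t : ℝ) (D : Fin n → Episode S A H)
    (h : Fin H) (s' : S) (c : ℝ) : Prop :=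
  ∑ τ, (if (D τ).state h.succ = s' then c else 0)
    ≤ n * (M.stateDist μ h.succ s' * (c + c ^ 2)) + t

/-- Bernstein-type upper bound for a data-dependent function of the next state, summed over the
visits. -/
def MarkTail (M : EpisodicMDP S A H) (μ : Policy S A H) (t : ℝ) (D : Fin n → Episode S A H)
    (h : Fin H) (s : S) (a : A) (φ : S → ℝ) : Prop :=
  ∑ τ, (if (D τ).state h.castSucc = s ∧ (D τ).action h = a then φ ((D τ).state h.succ) else 0)
    ≤ ∑ τ, M.backProb μ h s a ((D τ).state h.succ) *
        (φ ((D τ).state h.succ) + φ ((D τ).state h.succ) ^ 2) + t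

/-- The scale at which Bernstein's inequality is applied to a variable with bound `b` and
variance `v`. -/
def _root_.Concentration.scale (η b v : ℝ) : ℝ := 1 / (b + √(v / η))

/-- The deviation bounds on which the analysis of APVI rests. -/
def GoodAt (M : EpisodicMDP S A H) (μ : Policy S A H) (δ C η t : ℝ) (D : Fin n → Episode S A H)
    (h : Fin H) (s : S) (a : A) : Prop :=
  M.VisitTail μ t D h s a (fun _ => -(1 / 4)) ∧
  M.VisitTail μ t D h s a (fun x =>
    Concentration.scale η 1 (M.rewardVar h s a) * (x - M.meanReward h s a)) ∧
  M.VisitTail μ t D h s a (fun x =>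
    -Concentration.scale η 1 (M.rewardVar h s a) * (x - M.meanReward h s a)) ∧
  M.VisitTail μ t D h s a (fun x => (x - M.meanReward h s a) ^ 2) ∧
  -- In the two `StateTail` clauses `s` plays the role of the next state `s_{h+1}`; elsewhere it is
  -- the current state.
  M.StateTail μ t D h s √η ∧
  M.StateTail μ t D h s (-√η) ∧
  M.MarkTail μ t D h s a (fun s' =>
    Concentration.scale η H (M.valueVar h (APVI.vMax δ C D h.succ) s a) *
      M.centered h (APVI.vMax δ C D h.succ) s a s') ∧
  M.MarkTail μ t D h s a (fun s' =>
    -Concentration.scale η H (M.valueVar h (APVI.vMax δ C D h.succ) s a) *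
      M.centered h (APVI.vMax δ C D h.succ) s a s') ∧
  M.MarkTail μ t D h s a (fun s' => M.centered h (APVI.vMax δ C D h.succ) s a s' ^ 2 / H ^ 2)

variable [MeasurableSpace S] [MeasurableSpace A]
variable [MeasurableSingletonClass S] [MeasurableSingletonClass A]

lemma integral_visit (M : EpisodicMDP S A H) (μ : Policy S A H) (h : Fin H) (s : S) (a : A)
    (f : ℝ → ℝ) (hf : Continuous f) :
    ∫ e, (if e.state h.castSucc = s ∧ e.action h = a then f (e.reward h) else 0)
      ∂(M.episodeLaw μ) = M.flow μ h s a * ∫ x, f x ∂(M.R h s a : Measure ℝ) := by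
  have hint : ∀ (s₁ : S) (a₁ : A) (_ : S), Integrable
      (fun x => if s₁ = s ∧ a₁ = a then f x else 0) (M.R h s₁ a₁ : Measure ℝ) := by
    intro s₁ a₁ _
    split_ifs
    · exact M.integrable_of_continuous h s₁ a₁ f hf
    · exact integrable_zero _ _ _
  rw [M.integral_step μ h (fun s₁ a₁ x _ => if s₁ = s ∧ a₁ = a then f x else 0) hint,
    Finset.sum_eq_single s, Finset.sum_eq_single a]
  · simp [← Finset.sum_mul, M.P_sum, flow, mul_assoc]
  · intro b _ hb; simp [hb]
  · simp
  · intro b _ hb; simp [hb]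
  · simp

lemma measurableSet_visit (h : Fin H) (s : S) (a : A) :
    MeasurableSet {e : Episode S A H | e.state h.castSucc = s ∧ e.action h = a} :=
  (measurableSet_eq_fun (Episode.measurable_state _) measurable_const).inter
    (measurableSet_eq_fun (Episode.measurable_action _) measurable_const)

lemma measure_not_visitTail_le (M : EpisodicMDP S A H) (μ : Policy S A H) (n : ℕ) (t : ℝ)
    (h : Fin H) (s : S) (a : A) (f : ℝ → ℝ) (hf : Continuous f)
    (hf1 : ∀ x ∈ Set.Icc (0 : ℝ) 1, |f x| ≤ 1) :
    M.dataLaw μ n {D | ¬ M.VisitTail μ t D h s a f} ≤ ENNReal.ofReal (Real.exp (-t)) := by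
  have key := Concentration.measure_sum_gt_le (M.episodeLaw μ) n
    (fun e => if e.state h.castSucc = s ∧ e.action h = a then f (e.reward h) else 0)
    (Measurable.ite (measurableSet_visit h s a)
      (hf.measurable.comp (Episode.measurable_reward h)) measurable_const) (by
      filter_upwards [M.ae_reward_mem μ] with e he
      split_ifs
      · exact hf1 _ (he h)
      · simp) t
  have hφ : ∀ e : Episode S A H,
      (if e.state h.castSucc = s ∧ e.action h = a then f (e.reward h) else 0)
        + (if e.state h.castSucc = s ∧ e.action h = a then f (e.reward h) else 0) ^ 2
      = if e.state h.castSucc = s ∧ e.action h = a then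
          f (e.reward h) + f (e.reward h) ^ 2 else 0 := by
    intro e; split_ifs <;> simp
  simp only [hφ] at key
  rw [M.integral_visit μ h s a (fun x => f x + f x ^ 2) (by fun_prop)] at key
  simpa only [VisitTail, not_le, dataLaw] using key

lemma measure_not_stateTail_le (M : EpisodicMDP S A H) (μ : Policy S A H) (n : ℕ) (t : ℝ)
    (h : Fin H) (s' : S) (c : ℝ) (hc : |c| ≤ 1) :
    M.dataLaw μ n {D | ¬ M.StateTail μ t D h s' c} ≤ ENNReal.ofReal (Real.exp (-t)) := by
  have key := Concentration.measure_sum_gt_le (M.episodeLaw μ) n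
    (fun e => if e.state h.succ = s' then c else 0)
    (Measurable.ite (measurableSet_eq_fun (Episode.measurable_state _) measurable_const)
      measurable_const measurable_const) (Filter.Eventually.of_forall fun e => by
      split_ifs
      · exact hc
      · simp) t
  have hφ : ∀ e : Episode S A H,
      (if e.state h.succ = s' then c else 0) + (if e.state h.succ = s' then c else 0) ^ 2
      = if e.state h.succ = s' then c + c ^ 2 else 0 := by
    intro e; split_ifs <;> simp
  simp only [hφ] at key
  rw [M.integral_step μ h (fun _ _ _ s₁ => if s₁ = s' then c + c ^ 2 else 0)
    fun _ _ _ => integrable_const _] at key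
  have hsum : ∑ s, M.stateDist μ h.castSucc s * ∑ a, μ.prob h s a * ∑ s₁, M.P h s a s₁ *
      ∫ _, (if s₁ = s' then c + c ^ 2 else 0) ∂(M.R h s a : Measure ℝ)
      = M.stateDist μ h.succ s' * (c + c ^ 2) := by
    simp [stateDist_succ, Finset.sum_mul, mul_assoc]
  rw [hsum] at key
  simpa only [StateTail, not_le, dataLaw] using key

/-- The marks are the visits to `(s, a)` at time `h`. Hypothesis `hφF` says that `φ` is determined
by the futures, which is what permits it to depend on the data. -/
lemma measure_not_markTail_le (M : EpisodicMDP S A H) (μ : Policy S A H) (n : ℕ) (t : ℝ)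
    (h : Fin H) (s : S) (a : A) (φ : (Fin n → Episode S A H) → S → ℝ)
    (hφ : ∀ s', Measurable fun D => φ D s')
    (hφF : ∀ D, φ (fun τ => forget h s a (D τ)) = φ D) (hφ1 : ∀ D s', |φ D s'| ≤ 1) :
    M.dataLaw μ n {D | ¬ M.MarkTail μ t D h s a (φ D)} ≤ ENNReal.ofReal (Real.exp (-t)) := by
  have hst : ∀ e : Episode S A H, (forget h s a e).state h.succ = e.state h.succ := by
    intro e
    simp [forget, forgetPath, Episode.state]
  have key := Concentration.measure_mark_sum_gt_le (M.episodeLaw μ) (visits h s a)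
    ((measurable_of_finite fun x : S × A => decide (x.1 = s ∧ x.2 = a)).comp
      ((Episode.measurable_state _).prodMk (Episode.measurable_action _)))
    (forget h s a) (measurable_forget h s a) (fun e => M.backProb μ h s a (e.state h.succ))
    ((measurable_of_finite (M.backProb μ h s a)).comp (Episode.measurable_state _))
    (fun e => M.backProb_nonneg ..) (fun e => M.backProb_le_one ..)
    (fun e => by rw [hst]) (fun ψ hψ => M.lintegral_visits_forget μ h s a ψ hψ) n
    (fun τ D => φ D ((D τ).state h.succ))
    (fun τ => by
      have : Measurable fun p : (Fin n → Episode S A H) × S => φ p.1 p.2 :=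
        measurable_from_prod_countable_left hφ
      exact this.comp (measurable_id.prodMk
        ((Episode.measurable_state _).comp (measurable_pi_apply τ))))
    (fun τ D => by rw [hφF, hst]) (fun τ D => hφ1 _ _) t
  simpa only [MarkTail, not_le, dataLaw, visits, decide_eq_true_eq] using key

lemma scale_mul_abs_le {η b v y : ℝ} (hb : 0 < b) (hy : |y| ≤ b) :
    |Concentration.scale η b v * y| ≤ 1 := by
  have h1 : 0 ≤ √(v / η) := Real.sqrt_nonneg _
  rw [Concentration.scale, abs_mul, abs_of_nonneg (by positivity), one_div, ← div_eq_inv_mul]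
  exact div_le_one_of_le₀ (by linarith) (by positivity)

/-- Union bound over the nine clauses. The value functions, and hence the variance in the scale, may
be used as weights because erasing the past does not change them. -/
lemma measure_not_goodAt_le (M : EpisodicMDP S A H) (μ : Policy S A H) (n : ℕ) (δ C η t : ℝ)
    (hη : η ≤ 1) (h : Fin H) (s : S) (a : A) :
    M.dataLaw μ n {D | ¬ M.GoodAt μ δ C η t D h s a}
      ≤ 9 * ENNReal.ofReal (Real.exp (-t)) := by
  have : Nonempty A := ⟨a⟩
  have hH : (0 : ℝ) < H := by exact_mod_cast (Nat.zero_le _).trans_lt h.2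
  have hr : ∀ x ∈ Set.Icc (0 : ℝ) 1, |x - M.meanReward h s a| ≤ 1 := by
    intro x hx
    have := M.meanReward_mem h s a
    rw [abs_le]
    constructor <;> linarith [hx.1, hx.2, this.1, this.2]
  have hsη : |√η| ≤ 1 := by
    rw [abs_of_nonneg (Real.sqrt_nonneg _)]
    exact Real.sqrt_le_one.2 hη
  have hc : ∀ (D : Fin n → Episode S A H) s',
      |M.centered h (APVI.vMax δ C D h.succ) s a s'| ≤ H := fun D s' =>
    M.centered_abs_le h _ s a H (APVI.vMax_nonneg δ C D _) (fun s =>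
      (APVI.vMax_le δ C D _ s).trans (by simp; positivity)) s'
  have hm := APVI.measurable_vMax (n := n) (S := S) (A := A) δ C h.succ
  have hcm : ∀ s', Measurable fun D : Fin n → Episode S A H =>
      M.centered h (APVI.vMax δ C D h.succ) s a s' := by
    intro s'; unfold centered; fun_prop
  have hsm : Measurable fun D : Fin n → Episode S A H =>
      Concentration.scale η H (M.valueVar h (APVI.vMax δ C D h.succ) s a) := by
    unfold Concentration.scale valueVar; fun_prop
  have hF : ∀ D : Fin n → Episode S A H,
      APVI.vMax δ C (fun τ => forget h s a (D τ)) h.succ = APVI.vMax δ C D h.succ := fun D =>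
    APVI.vMax_forget δ C D h s a _ Fin.castSucc_lt_succ
  have b1 := M.measure_not_visitTail_le μ n t h s a (fun _ => -(1 / 4)) continuous_const
    (fun x _ => by norm_num [abs_le])
  have b2 := M.measure_not_visitTail_le μ n t h s a (fun x =>
    Concentration.scale η 1 (M.rewardVar h s a) * (x - M.meanReward h s a)) (by fun_prop)
    (fun x hx => scale_mul_abs_le one_pos (hr x hx))
  have b3 := M.measure_not_visitTail_le μ n t h s a (fun x =>
    -Concentration.scale η 1 (M.rewardVar h s a) * (x - M.meanReward h s a)) (by fun_prop)
    (fun x hx => by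
      rw [neg_mul, abs_neg]; exact scale_mul_abs_le one_pos (hr x hx))
  have b4 := M.measure_not_visitTail_le μ n t h s a (fun x => (x - M.meanReward h s a) ^ 2)
    (by fun_prop) (fun x hx => by
      rw [abs_pow]; exact pow_le_one₀ (abs_nonneg _) (hr x hx))
  have b5 := M.measure_not_stateTail_le μ n t h s √η hsη
  have b6 := M.measure_not_stateTail_le μ n t h s (-√η) (by rwa [abs_neg])
  have b7 := M.measure_not_markTail_le μ n t h s a (fun D s' =>
    Concentration.scale η H (M.valueVar h (APVI.vMax δ C D h.succ) s a) *
      M.centered h (APVI.vMax δ C D h.succ) s a s') (fun s' => hsm.mul (hcm s'))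
    (fun D => by rw [hF]) (fun D s' => scale_mul_abs_le hH (hc D s'))
  have b8 := M.measure_not_markTail_le μ n t h s a (fun D s' =>
    -Concentration.scale η H (M.valueVar h (APVI.vMax δ C D h.succ) s a) *
      M.centered h (APVI.vMax δ C D h.succ) s a s') (fun s' => hsm.neg.mul (hcm s'))
    (fun D => by rw [hF]) (fun D s' => by
      rw [neg_mul, abs_neg]; exact scale_mul_abs_le hH (hc D s'))
  have b9 := M.measure_not_markTail_le μ n t h s a (fun D s' =>
    M.centered h (APVI.vMax δ C D h.succ) s a s' ^ 2 / H ^ 2)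
    (fun s' => ((hcm s').pow_const 2).div_const _)
    (fun D => by rw [hF]) (fun D s' => by
      rw [← div_pow, abs_pow, abs_div, abs_of_pos hH]
      exact pow_le_one₀ (by positivity) (div_le_one_of_le₀ (hc D s') hH.le))
  simp only [GoodAt, not_and_or, Set.ofPred_or]
  set p := ENNReal.ofReal (Real.exp (-t))
  have hsum : (9 : ENNReal) * p = p + (p + (p + (p + (p + (p + (p + (p + p))))))) := by ring
  rw [hsum]
  refine (measure_union_le _ _).trans (add_le_add b1 ?_)
  refine (measure_union_le _ _).trans (add_le_add b2 ?_)
  refine (measure_union_le _ _).trans (add_le_add b3 ?_)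
  refine (measure_union_le _ _).trans (add_le_add b4 ?_)
  refine (measure_union_le _ _).trans (add_le_add b5 ?_)
  refine (measure_union_le _ _).trans (add_le_add b6 ?_)
  refine (measure_union_le _ _).trans (add_le_add b7 ?_)
  exact (measure_union_le _ _).trans (add_le_add b8 b9)

lemma measure_exists_not_goodAt_le (M : EpisodicMDP S A H) (μ : Policy S A H) (n : ℕ)
    (δ C η t : ℝ) (hη : η ≤ 1) :
    M.dataLaw μ n {D | ∃ h s a, ¬ M.GoodAt μ δ C η t D h s a}
      ≤ ENNReal.ofReal (9 * (H * Fintype.card S * Fintype.card A) * Real.exp (-t)) := by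
  have hset : {D : Fin n → Episode S A H | ∃ h s a, ¬ M.GoodAt μ δ C η t D h s a}
      = ⋃ x : Fin H × S × A, {D | ¬ M.GoodAt μ δ C η t D x.1 x.2.1 x.2.2} := by
    ext D; simp
  rw [hset]
  refine (measure_iUnion_fintype_le _ _).trans ((Finset.sum_le_sum fun x _ =>
    M.measure_not_goodAt_le μ n δ C η t hη x.1 x.2.1 x.2.2).trans (le_of_eq ?_))
  rw [Finset.sum_const, nsmul_eq_mul, ENNReal.ofReal_mul (by positivity),
    ENNReal.ofReal_mul (by norm_num), ← mul_assoc]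
  congr 1
  rw [mul_comm]
  simp [Fintype.card_prod, mul_assoc, ENNReal.ofReal_mul]

end EpisodicMDP

/-! ### The choice of the exponential parameter. -/

namespace Concentration

lemma scale_pos {η b v : ℝ} (hb : 0 < b) : 0 < scale η b v := by
  have : 0 ≤ √(v / η) := Real.sqrt_nonneg _
  rw [scale]; positivity

/-- With parameter `θ = scale η b v` the quadratic term contributes `θ v ≤ √(η v)`, and the tail
contributes `η / θ = η b + √(η v)`. This balances the two terms, while `θ b ≤ 1` keeps the variable
in the range where the exponential inequality holds. -/
lemma scale_mul_le {η b v : ℝ} (hη : 0 < η) (hb : 0 < b) (hv : 0 ≤ v) :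
    scale η b v * v ≤ √(η * v) := by
  have h1 : 0 ≤ √(v / η) := Real.sqrt_nonneg _
  have h2 : √(η * v) * √(v / η) = v := by
    rw [← Real.sqrt_mul (by positivity)]
    have : η * v * (v / η) = v ^ 2 := by field_simp
    rw [this, Real.sqrt_sq hv]
  rw [scale, one_div, ← div_eq_inv_mul, div_le_iff₀ (by positivity), mul_add, h2]
  have := mul_nonneg (Real.sqrt_nonneg (η * v)) hb.le
  linarith

lemma div_scale {η b v : ℝ} (hη : 0 < η) : η / scale η b v = η * b + √(η * v) := by
  have h2 : η * √(v / η) = √(η * v) := by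
    rw [← Real.sqrt_sq hη.le, ← Real.sqrt_mul (by positivity), Real.sqrt_sq hη.le]
    congr 1
    field_simp
  rw [scale, div_div_eq_mul_div, div_one, mul_add, h2]

/-- Optimizing Bernstein's inequality in its exponential parameter. -/
lemma le_of_scale_mul_le {η b v ν X Z : ℝ} (hη : 0 < η) (hb : 0 < b) (hv : 0 ≤ v)
    (hν : 0 ≤ ν) (c : ℝ) (hc : 0 ≤ c)
    (h : scale η b v * X ≤ scale η b v * Z + scale η b v ^ 2 * (c * ν * v) + η * ν) :
    X ≤ Z + ν * ((c + 1) * √(η * v) + η * b) := by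
  have hs := scale_pos (η := η) (v := v) hb
  have h1 : X ≤ Z + c * ν * (scale η b v * v) + ν * (η / scale η b v) := by
    refine le_of_mul_le_mul_left (h.trans (le_of_eq ?_)) hs
    field_simp
  have h2 := mul_le_mul_of_nonneg_left (scale_mul_le hη hb hv) (mul_nonneg hc hν)
  rw [div_scale hη] at h1
  nlinarith

end Concentration

/-! ### Empirical means and variances as sums over visits. -/

namespace APVI

variable {S A : Type*} [Fintype S] [Fintype A] [DecidableEq S] [DecidableEq A] {H n : ℕ}

/-- The sum of a statistic over the visits of `(s, a)` at time `h`. -/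
def visitSum (D : Fin n → Episode S A H) (h : Fin H) (s : S) (a : A) (f : Fin n → ℝ) : ℝ :=
  ∑ τ, if (D τ).state h.castSucc = s ∧ (D τ).action h = a then f τ else 0

lemma visitSum_const (D : Fin n → Episode S A H) (h : Fin H) (s : S) (a : A) (c : ℝ) :
    visitSum D h s a (fun _ => c) = count D h s a * c := by
  simp only [visitSum, count]
  push_cast
  rw [Finset.sum_mul]
  refine Finset.sum_congr rfl fun τ _ => ?_
  split_ifs <;> simp

lemma visitSum_mul (D : Fin n → Episode S A H) (h : Fin H) (s : S) (a : A) (c : ℝ)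
    (f : Fin n → ℝ) : visitSum D h s a (fun τ => c * f τ) = c * visitSum D h s a f := by
  simp only [visitSum, Finset.mul_sum, mul_ite, mul_zero]

lemma visitSum_add (D : Fin n → Episode S A H) (h : Fin H) (s : S) (a : A)
    (f g : Fin n → ℝ) :
    visitSum D h s a (fun τ => f τ + g τ) = visitSum D h s a f + visitSum D h s a g := by
  simp only [visitSum, ← Finset.sum_add_distrib]
  refine Finset.sum_congr rfl fun τ _ => ?_
  split_ifs <;> simp

lemma visitSum_sub_const (D : Fin n → Episode S A H) (h : Fin H) (s : S) (a : A) (c : ℝ)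
    (f : Fin n → ℝ) :
    visitSum D h s a (fun τ => f τ - c) = visitSum D h s a f - count D h s a * c := by
  simp only [sub_eq_add_neg]
  rw [visitSum_add, visitSum_const, mul_neg]

/-- The mean minimizes the sum of squares. -/
lemma visitSum_sq_sub_le (D : Fin n → Episode S A H) (h : Fin H) (s : S) (a : A) (c m : ℝ)
    (f : Fin n → ℝ) (hm : visitSum D h s a f = count D h s a * m) :
    visitSum D h s a (fun τ => (f τ - m) ^ 2) ≤ visitSum D h s a (fun τ => (f τ - c) ^ 2) := by
  have h1 : (fun τ => (f τ - c) ^ 2) = fun τ => (f τ - m) ^ 2 +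
      ((2 * (m - c)) * (f τ - m) + (m - c) ^ 2) := by funext τ; ring
  rw [h1, visitSum_add, visitSum_add, visitSum_const, visitSum_mul, visitSum_sub_const, hm]
  have : 0 ≤ (count D h s a : ℝ) * (m - c) ^ 2 := by positivity
  linarith

lemma sum_transHat_mul (D : Fin n → Episode S A H) (h : Fin H) (s : S) (a : A)
    (hc : count D h s a ≠ 0) (f : S → ℝ) :
    ∑ s', transHat D h s a s' * f s'
      = visitSum D h s a (fun τ => f ((D τ).state h.succ)) / count D h s a := by
  simp only [transHat, if_neg hc, visitSum, div_mul_eq_mul_div, ← Finset.sum_div,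
    Finset.sum_mul]
  rw [Finset.sum_comm]
  congr 1
  refine Finset.sum_congr rfl fun τ _ => ?_
  by_cases hv : (D τ).state h.castSucc = s ∧ (D τ).action h = a <;> simp [hv]

lemma rewardHat_sub (D : Fin n → Episode S A H) (h : Fin H) (s : S) (a : A)
    (hc : count D h s a ≠ 0) (c : ℝ) :
    rewardHat D h s a - c
      = visitSum D h s a (fun τ => (D τ).reward h - c) / count D h s a := by
  have hc' : (count D h s a : ℝ) ≠ 0 := by exact_mod_cast hc
  rw [visitSum_sub_const, sub_div, mul_div_cancel_left₀ _ hc', rewardHat, if_neg hc]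
  rfl

lemma sum_transHat_mul_sub (D : Fin n → Episode S A H) (h : Fin H) (s : S) (a : A)
    (hc : count D h s a ≠ 0) (f : S → ℝ) (c : ℝ) :
    ∑ s', transHat D h s a s' * f s' - c
      = visitSum D h s a (fun τ => f ((D τ).state h.succ) - c) / count D h s a := by
  have hc' : (count D h s a : ℝ) ≠ 0 := by exact_mod_cast hc
  rw [sum_transHat_mul D h s a hc, visitSum_sub_const, sub_div, mul_div_cancel_left₀ _ hc']

lemma rewardVarHat_le (D : Fin n → Episode S A H) (h : Fin H) (s : S) (a : A)
    (hc : count D h s a ≠ 0) (c : ℝ) :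
    rewardVarHat D h s a
      ≤ visitSum D h s a (fun τ => ((D τ).reward h - c) ^ 2) / count D h s a := by
  have hc' : (count D h s a : ℝ) ≠ 0 := by exact_mod_cast hc
  refine div_le_div_of_nonneg_right (visitSum_sq_sub_le D h s a c (rewardHat D h s a)
    (fun τ => (D τ).reward h) ?_) (Nat.cast_nonneg _)
  rw [rewardHat, if_neg hc, mul_div_cancel₀ _ hc']
  rfl

lemma valueVarHat_le (D : Fin n → Episode S A H) (h : Fin H) (V : S → ℝ) (s : S) (a : A)
    (hc : count D h s a ≠ 0) (c : ℝ) :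
    valueVarHat D h V s a
      ≤ visitSum D h s a (fun τ => (V ((D τ).state h.succ) - c) ^ 2) / count D h s a := by
  have hc' : (count D h s a : ℝ) ≠ 0 := by exact_mod_cast hc
  rw [valueVarHat, sum_transHat_mul D h s a hc
    (fun s' => (V s' - ∑ s'', transHat D h s a s'' * V s'') ^ 2)]
  refine div_le_div_of_nonneg_right (visitSum_sq_sub_le D h s a c _
    (fun τ => V ((D τ).state h.succ)) ?_) (Nat.cast_nonneg _)
  rw [sum_transHat_mul D h s a hc, mul_div_cancel₀ _ hc']

lemma sum_comp_state (D : Fin n → Episode S A H) (h : Fin H) (f : S → ℝ) :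
    ∑ τ, f ((D τ).state h.succ)
      = ∑ s', (∑ τ, if (D τ).state h.succ = s' then (1 : ℝ) else 0) * f s' := by
  simp only [Finset.sum_mul]
  rw [Finset.sum_comm]
  exact Finset.sum_congr rfl fun τ _ => by simp

end APVI

/-! ### Deviations of rewards, counts and next values on the good event. -/

namespace EpisodicMDP

open APVI Concentration

variable {S A : Type*} [Fintype S] [Fintype A] {H n : ℕ}

lemma sum_P_mul_centered (M : EpisodicMDP S A H) (h : Fin H) (V : S → ℝ) (s : S) (a : A) :
    ∑ s', M.P h s a s' * M.centered h V s a s' = 0 := by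
  simp [centered, mul_sub, Finset.sum_sub_distrib, ← Finset.sum_mul, M.P_sum]

lemma sum_P_mul_abs_le (M : EpisodicMDP S A H) (h : Fin H) (s : S) (a : A) (g : S → ℝ) :
    ∑ s', M.P h s a s' * |g s'| ≤ √(∑ s', M.P h s a s' * g s' ^ 2) := by
  refine Real.le_sqrt_of_sq_le ?_
  set m := ∑ s', M.P h s a s' * |g s'| with hm
  have h1 : 0 ≤ ∑ s', M.P h s a s' * (|g s'| - m) ^ 2 :=
    Finset.sum_nonneg fun _ _ => mul_nonneg (M.P_nonneg ..) (sq_nonneg _)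
  have h2 : ∑ s', M.P h s a s' * (|g s'| - m) ^ 2
      = ∑ s', M.P h s a s' * g s' ^ 2 - 2 * m * m + m ^ 2 := by
    have : ∀ s', M.P h s a s' * (|g s'| - m) ^ 2 = M.P h s a s' * g s' ^ 2
        - 2 * m * (M.P h s a s' * |g s'|) + M.P h s a s' * m ^ 2 := by
      intro s'
      rw [← sq_abs (g s')]; ring
    simp only [this, Finset.sum_add_distrib, Finset.sum_sub_distrib, ← Finset.mul_sum,
      ← Finset.sum_mul, M.P_sum, one_mul, ← hm]
  nlinarith

/-- The reward and the next state are independent, so the cross term vanishes. -/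
lemma stepVariance_eq (M : EpisodicMDP S A H) (h : Fin H) (V : S → ℝ) (s : S) (a : A) :
    M.stepVariance h V s a = M.rewardVar h s a + M.valueVar h V s a := by
  have h1 : ∀ x : ℝ, ∑ s', M.P h s a s' * (x + V s' - M.bellman h V s a) ^ 2
      = (x - M.meanReward h s a) ^ 2 + M.valueVar h V s a := by
    intro x
    have h2 : ∀ s', M.P h s a s' * (x + V s' - M.bellman h V s a) ^ 2
        = M.P h s a s' * (x - M.meanReward h s a) ^ 2
          + 2 * (x - M.meanReward h s a) * (M.P h s a s' * M.centered h V s a s')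
          + M.P h s a s' * M.centered h V s a s' ^ 2 := by
      intro s'
      simp only [bellman, centered]; ring
    simp only [h2, Finset.sum_add_distrib, ← Finset.mul_sum, ← Finset.sum_mul, M.P_sum,
      sum_P_mul_centered, valueVar]
    ring
  simp only [stepVariance, h1]
  rw [integral_add (M.integrable_of_continuous h s a _ (by fun_prop)) (integrable_const _)]
  simp [rewardVar]

variable [DecidableEq S] [DecidableEq A]

section Deviation

variable {M : EpisodicMDP S A H} {μ : Policy S A H} {δ C η t : ℝ} {D : Fin n → Episode S A H}
  {h : Fin H} {s : S} {a : A}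

lemma VisitTail.visitSum_le {f : ℝ → ℝ} (hf : M.VisitTail μ t D h s a f) :
    visitSum D h s a (fun τ => f ((D τ).reward h))
      ≤ n * (M.flow μ h s a * ∫ x, (f x + f x ^ 2) ∂(M.R h s a : Measure ℝ)) + t := hf

lemma MarkTail.visitSum_le {φ : S → ℝ} (hf : M.MarkTail μ t D h s a φ) :
    visitSum D h s a (fun τ => φ ((D τ).state h.succ))
      ≤ ∑ τ, M.backProb μ h s a ((D τ).state h.succ) *
        (φ ((D τ).state h.succ) + φ ((D τ).state h.succ) ^ 2) + t := hf

/-- The constant `-1/4` gives `-k/4 ≤ -3ν/16 + t` for the count `k` and its mean `ν`; since `t ≤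
ν/16`, it follows that `k ≥ ν/2`. -/
lemma GoodAt.count_ge (hG : M.GoodAt μ δ C η t D h s a) (hη : η ≤ 1 / 16)
    (ht : t ≤ η * (n * M.flow μ h s a)) :
    n * M.flow μ h s a / 2 ≤ count D h s a := by
  have h1 := hG.1.visitSum_le
  rw [visitSum_const] at h1
  simp only [integral_const, probReal_univ, smul_eq_mul] at h1
  have h2 : 0 ≤ n * M.flow μ h s a := mul_nonneg (Nat.cast_nonneg _) (M.flow_nn ..)
  nlinarith

lemma integral_scale_centered (θ : ℝ) :
    ∫ x, (θ * (x - M.meanReward h s a) + (θ * (x - M.meanReward h s a)) ^ 2)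
      ∂(M.R h s a : Measure ℝ) = θ ^ 2 * M.rewardVar h s a := by
  rw [integral_add (M.integrable_of_continuous h s a _ (by fun_prop))
    (M.integrable_of_continuous h s a _ (by fun_prop)), integral_const_mul,
    integral_sub (M.integrable_of_continuous h s a (fun x => x) continuous_id)
      (integrable_const _)]
  simp only [mul_pow]
  rw [integral_const_mul]
  simp [meanReward, rewardVar]

lemma GoodAt.reward_dev (hG : M.GoodAt μ δ C η t D h s a) (hη : 0 < η)
    (ht : t ≤ η * (n * M.flow μ h s a)) :
    |visitSum D h s a (fun τ => (D τ).reward h - M.meanReward h s a)|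
      ≤ n * M.flow μ h s a * (2 * √(η * M.rewardVar h s a) + η) := by
  have hν : 0 ≤ n * M.flow μ h s a := mul_nonneg (Nat.cast_nonneg _) (M.flow_nn ..)
  have h1 := hG.2.1.visitSum_le
  have h2 := hG.2.2.1.visitSum_le
  rw [visitSum_mul, integral_scale_centered] at h1 h2
  have hv := M.rewardVar_nonneg h s a
  have k1 := le_of_scale_mul_le (X := visitSum D h s a
    (fun τ => (D τ).reward h - M.meanReward h s a)) (Z := 0) hη one_pos hv hν 1 zero_le_one
    (by linarith)
  have k2 := le_of_scale_mul_le (X := -visitSum D h s a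
    (fun τ => (D τ).reward h - M.meanReward h s a)) (Z := 0) hη one_pos hv hν 1 zero_le_one
    (by linarith)
  rw [abs_le]
  constructor <;> linarith

lemma GoodAt.reward_sq (hG : M.GoodAt μ δ C η t D h s a)
    (ht : t ≤ η * (n * M.flow μ h s a)) :
    visitSum D h s a (fun τ => ((D τ).reward h - M.meanReward h s a) ^ 2)
      ≤ n * M.flow μ h s a * (2 * M.rewardVar h s a + η) := by
  have hν : 0 ≤ n * M.flow μ h s a := mul_nonneg (Nat.cast_nonneg _) (M.flow_nn ..)
  have h1 := hG.2.2.2.1.visitSum_le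
  have h2 : ∫ x, ((x - M.meanReward h s a) ^ 2 + ((x - M.meanReward h s a) ^ 2) ^ 2)
      ∂(M.R h s a : Measure ℝ) ≤ 2 * M.rewardVar h s a := by
    rw [rewardVar, ← integral_const_mul]
    refine integral_mono_ae (M.integrable_of_continuous h s a _ (by fun_prop))
      (M.integrable_of_continuous h s a _ (by fun_prop)) ?_
    filter_upwards [M.R_mem h s a] with x hx
    have hm := M.meanReward_mem h s a
    -- The fourth power is at most the square, so the second-order term only doubles the variance.
    have h3 : (x - M.meanReward h s a) ^ 2 ≤ 1 := by
      rw [sq_le_one_iff_abs_le_one, abs_le]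
      constructor <;> linarith [hx.1, hx.2, hm.1, hm.2]
    nlinarith [sq_nonneg (x - M.meanReward h s a)]
  nlinarith

/-- A relative bound: with the constants `±√η` the quadratic term and `t / √η` each cost at most
`√η` times the expected count. -/
lemma abs_stateCount_sub_le {s' : S} (hη : 0 < η) (h1 : M.StateTail μ t D h s' √η)
    (h2 : M.StateTail μ t D h s' (-√η)) (ht : t ≤ η * (n * M.stateDist μ h.succ s')) :
    |∑ τ, (if (D τ).state h.succ = s' then (1 : ℝ) else 0) - n * M.stateDist μ h.succ s'|
      ≤ 2 * √η * (n * M.stateDist μ h.succ s') := by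
  have hs : 0 < √η := Real.sqrt_pos.2 hη
  have hss : √η ^ 2 = η := Real.sq_sqrt hη.le
  have hsum : ∀ c : ℝ, ∑ τ, (if (D τ).state h.succ = s' then c else 0)
      = c * ∑ τ, (if (D τ).state h.succ = s' then (1 : ℝ) else 0) := by
    intro c; simp only [Finset.mul_sum, mul_ite, mul_one, mul_zero]
  rw [StateTail, hsum] at h1 h2
  have k1 : √η * (∑ τ, (if (D τ).state h.succ = s' then (1 : ℝ) else 0))
      ≤ √η * (n * M.stateDist μ h.succ s' + 2 * √η * (n * M.stateDist μ h.succ s')) := by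
    nlinarith
  have k2 : √η * (n * M.stateDist μ h.succ s' - 2 * √η * (n * M.stateDist μ h.succ s'))
      ≤ √η * (∑ τ, (if (D τ).state h.succ = s' then (1 : ℝ) else 0)) := by
    nlinarith
  have k1 := le_of_mul_le_mul_left k1 hs
  have k2 := le_of_mul_le_mul_left k2 hs
  rw [abs_le]
  constructor <;> linarith

/-- The sum of a function of the next state, weighted by the backward probabilities, is close to
its mean when the state counts are. -/
lemma sum_backProb_mul_sub_le (g : S → ℝ) (κ : ℝ)
    (hN : ∀ s', 0 < M.stateDist μ h.succ s' →
      |∑ τ, (if (D τ).state h.succ = s' then (1 : ℝ) else 0) - n * M.stateDist μ h.succ s'|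
        ≤ κ * (n * M.stateDist μ h.succ s') ∨ g s' = 0) :
    |∑ τ, M.backProb μ h s a ((D τ).state h.succ) * g ((D τ).state h.succ)
        - n * M.flow μ h s a * ∑ s', M.P h s a s' * g s'|
      ≤ κ * (n * M.flow μ h s a * ∑ s', M.P h s a s' * |g s'|) := by
  rw [sum_comp_state D h (fun s' => M.backProb μ h s a s' * g s'), Finset.mul_sum,
    ← Finset.sum_sub_distrib, Finset.mul_sum, Finset.mul_sum]
  refine (Finset.abs_sum_le_sum_abs _ _).trans (Finset.sum_le_sum fun s' _ => ?_)
  have hz := M.stateDist_mul_backProb μ h s a s'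
  have hz0 := M.backProb_nonneg μ h s a s'
  have h1 : n * M.flow μ h s a * (M.P h s a s' * g s')
      = n * M.stateDist μ h.succ s' * (M.backProb μ h s a s' * g s') := by
    rw [flow]; linear_combination (-(n : ℝ) * g s') * hz
  have h2 : κ * (n * M.flow μ h s a * (M.P h s a s' * |g s'|))
      = κ * (n * M.stateDist μ h.succ s') * (M.backProb μ h s a s' * |g s'|) := by
    rw [flow]; linear_combination (-(n : ℝ) * κ * |g s'|) * hz
  rw [h1, h2, ← sub_mul, abs_mul, abs_mul, abs_of_nonneg hz0]
  rcases (M.stateDist_nonneg μ h.succ s').eq_or_lt with h0 | h0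
  · have : M.backProb μ h s a s' = 0 := by rw [backProb, ← h0, div_zero]
    simp [this]
  · rcases hN s' h0 with h3 | h3
    · exact mul_le_mul_of_nonneg_right h3 (mul_nonneg hz0 (abs_nonneg _))
    · simp [h3]

/-- The conditional Bernstein bound is combined with the replacement of next-state counts by their
means. The alternative in `hN` is for the last step, where coverage says nothing about the next
state but the next value function is zero. -/
lemma GoodAt.value_dev [Nonempty A] (hG : M.GoodAt μ δ C η t D h s a) (hη : 0 < η)
    (hη' : η ≤ 1 / 16)
    (ht : t ≤ η * (n * M.flow μ h s a))
    (hN : ∀ s', 0 < M.stateDist μ h.succ s' →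
      |∑ τ, (if (D τ).state h.succ = s' then (1 : ℝ) else 0) - n * M.stateDist μ h.succ s'|
        ≤ 2 * √η * (n * M.stateDist μ h.succ s') ∨
      M.centered h (vMax δ C D h.succ) s a s' = 0) :
    |visitSum D h s a (fun τ => M.centered h (vMax δ C D h.succ) s a ((D τ).state h.succ))|
      ≤ n * M.flow μ h s a * (5 * √(η * M.valueVar h (vMax δ C D h.succ) s a) + η * H) ∧
    visitSum D h s a (fun τ => M.centered h (vMax δ C D h.succ) s a ((D τ).state h.succ) ^ 2)
      ≤ n * M.flow μ h s a * (3 * M.valueVar h (vMax δ C D h.succ) s a + η * H ^ 2) := by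
  have hν : 0 ≤ n * M.flow μ h s a := mul_nonneg (Nat.cast_nonneg _) (M.flow_nn ..)
  have hH : (0 : ℝ) < H := by exact_mod_cast (Nat.zero_le _).trans_lt h.2
  have hv := M.valueVar_nonneg h (vMax δ C D h.succ) s a
  obtain ⟨-, -, -, -, -, -, h1, h2, h3⟩ := hG
  have h1 := h1.visitSum_le
  have h2 := h2.visitSum_le
  have h3 := h3.visitSum_le
  have hg : ∀ s', |M.centered h (vMax δ C D h.succ) s a s'| ≤ H :=
    M.centered_abs_le h _ s a H (vMax_nonneg δ C D _)
      (fun s => (vMax_le δ C D _ s).trans (by simp; positivity))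
  have b1 := sum_backProb_mul_sub_le (s := s) (a := a) _ (2 * √η) hN
  have b2 := sum_backProb_mul_sub_le (s := s) (a := a)
    (fun s' => M.centered h (vMax δ C D h.succ) s a s' ^ 2) (2 * √η)
    (fun s' hs' => (hN s' hs').imp id fun h0 => by simp [h0])
  have hcs := M.sum_P_mul_abs_le h s a (M.centered h (vMax δ C D h.succ) s a)
  -- The ideal conditional mean of the centered value is zero, so only the error of the counts
  -- remains; Cauchy–Schwarz (`hcs`) turns it into a standard deviation.
  rw [sum_P_mul_centered, mul_zero, sub_zero] at b1
  simp only [abs_pow, sq_abs] at b2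
  change _ ≤ √(M.valueVar h (vMax δ C D h.succ) s a) at hcs
  rw [show ∑ s', M.P h s a s' * M.centered h (vMax δ C D h.succ) s a s' ^ 2
    = M.valueVar h (vMax δ C D h.succ) s a from rfl] at b2
  rw [visitSum_mul] at h1 h2
  simp only [div_eq_inv_mul, visitSum_mul] at h3
  set g := M.centered h (vMax δ C D h.succ) s a
  set v := M.valueVar h (vMax δ C D h.succ) s a
  set ν := n * M.flow μ h s a
  set X := visitSum D h s a (fun τ => g ((D τ).state h.succ))
  set Y := visitSum D h s a (fun τ => g ((D τ).state h.succ) ^ 2)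
  set Z₁ := ∑ τ, M.backProb μ h s a ((D τ).state h.succ) * g ((D τ).state h.succ) with hZ₁
  set Z₂ := ∑ τ, M.backProb μ h s a ((D τ).state h.succ) * g ((D τ).state h.succ) ^ 2 with hZ₂
  have hsη : √η ≤ 1 / 4 := by
    rw [Real.sqrt_le_left (by norm_num)]; linarith
  have hsη0 : 0 ≤ √η := Real.sqrt_nonneg _
  have hνv : 0 ≤ ν * v := mul_nonneg hν hv
  have hZ1 : |Z₁| ≤ ν * (2 * √(η * v)) := by
    refine b1.trans ?_
    rw [Real.sqrt_mul hη.le]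
    have := mul_le_mul_of_nonneg_left hcs (mul_nonneg hsη0 hν)
    nlinarith
  have hZ2 : Z₂ ≤ 3 / 2 * ν * v := by
    have := (abs_le.1 b2).2
    nlinarith
  have hlin : ∀ θ : ℝ, ∑ τ, M.backProb μ h s a ((D τ).state h.succ) *
      (θ * g ((D τ).state h.succ) + (θ * g ((D τ).state h.succ)) ^ 2)
      = θ * Z₁ + θ ^ 2 * Z₂ := by
    intro θ
    rw [hZ₁, hZ₂, Finset.mul_sum, Finset.mul_sum, ← Finset.sum_add_distrib]
    exact Finset.sum_congr rfl fun τ _ => by ring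
  rw [hlin] at h1 h2
  have hm := mul_le_mul_of_nonneg_left hZ2 (sq_nonneg (scale η H v))
  have k1 := le_of_scale_mul_le (X := X) (Z := Z₁) hη hH hv hν (3 / 2) (by norm_num)
    (by linarith)
  have k2 := le_of_scale_mul_le (X := -X) (Z := -Z₁) hη hH hv hν (3 / 2) (by norm_num)
    (by nlinarith)
  have hsv : 0 ≤ ν * √(η * v) := mul_nonneg hν (Real.sqrt_nonneg _)
  refine ⟨?_, ?_⟩
  · have := abs_le.1 hZ1
    rw [abs_le]
    constructor <;> nlinarith
  -- The centered value squared and divided by `H²` lies in `[0, 1]`, so its own square is absorbed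
  -- by a factor `2`.
  · have h4 : ∑ τ, M.backProb μ h s a ((D τ).state h.succ) *
        (((H : ℝ) ^ 2)⁻¹ * g ((D τ).state h.succ) ^ 2
          + (((H : ℝ) ^ 2)⁻¹ * g ((D τ).state h.succ) ^ 2) ^ 2)
        ≤ ((H : ℝ) ^ 2)⁻¹ * (2 * Z₂) := by
      rw [hZ₂, Finset.mul_sum, Finset.mul_sum]
      refine Finset.sum_le_sum fun τ _ => ?_
      have h5 : ((H : ℝ) ^ 2)⁻¹ * g ((D τ).state h.succ) ^ 2 ≤ 1 := by
        rw [← div_eq_inv_mul]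
        exact div_le_one_of_le₀ (sq_le_sq' (abs_le.1 (hg _)).1 (abs_le.1 (hg _)).2) (by positivity)
      have h6 : 0 ≤ ((H : ℝ) ^ 2)⁻¹ * g ((D τ).state h.succ) ^ 2 := by positivity
      have h7 := M.backProb_nonneg μ h s a ((D τ).state h.succ)
      calc _ ≤ M.backProb μ h s a ((D τ).state h.succ) *
            (2 * (((H : ℝ) ^ 2)⁻¹ * g ((D τ).state h.succ) ^ 2)) :=
            mul_le_mul_of_nonneg_left (by nlinarith) h7
        _ = _ := by ring
    have h8 : ((H : ℝ) ^ 2)⁻¹ * Y ≤ ((H : ℝ) ^ 2)⁻¹ * (2 * Z₂) + η * ν := by linarith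
    have h9 : Y ≤ 2 * Z₂ + η * ν * H ^ 2 := by
      have := mul_le_mul_of_nonneg_left h8 (sq_nonneg (H : ℝ))
      have hne : (H : ℝ) ^ 2 ≠ 0 := by positivity
      rw [mul_inv_cancel_left₀ hne, mul_add, mul_inv_cancel_left₀ hne] at this
      linarith
    nlinarith

end Deviation

end EpisodicMDP

/-! ### The one-step error of the truncated pessimistic `Q`-function. -/

lemma abs_max_min_sub_le {x y u : ℝ} (hy0 : 0 ≤ y) (hyu : y ≤ u) :
    |max 0 (min x u) - y| ≤ |x - y| := by
  rcases le_total x u with h1 | h1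
  · rw [min_eq_left h1]
    rcases le_total 0 x with h2 | h2
    · rw [max_eq_right h2]
    · rw [max_eq_left h2, abs_sub_comm, abs_sub_comm x y, abs_of_nonneg (by linarith),
        abs_of_nonneg (by linarith)]
      linarith
  · rw [min_eq_right h1, max_eq_right (hy0.trans hyu), abs_of_nonneg (by linarith),
      abs_of_nonneg (by linarith)]
    linarith

/-- The arithmetic behind the one-step estimate: `k` is the count, `ν` its mean, `X₁, X₂` the
centered sums of rewards and of next values, `Y₁, Y₂` the sums of their squares, and `σ` the
empirical variance. The three error sources contribute `4 + 10 + 4 = 18` standard deviations. -/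
lemma deviation_le {H η k ν vr vv ι X₁ X₂ Y₁ Y₂ σ : ℝ} (hH : 1 ≤ H) (hη : 0 < η) (hk : 0 < k)
    (hνk : ν ≤ 2 * k) (hν : 0 < ν) (hvr : 0 ≤ vr) (hvv : 0 ≤ vv) (hι : 0 ≤ ι)
    (ht : 5 * ι ≤ η * ν) (d₁ : |X₁| ≤ ν * (2 * √(η * vr) + η))
    (d₂ : |X₂| ≤ ν * (5 * √(η * vv) + η * H)) (d₃ : Y₁ ≤ ν * (2 * vr + η))
    (d₄ : Y₂ ≤ ν * (3 * vv + η * H ^ 2)) (hσ : σ ≤ Y₁ / k + Y₂ / k) :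
    |X₁ / k| + |X₂ / k| + (2 * √(σ * ι / k) + 14 * H * ι / k)
        ≤ 18 * (√(η * (vr + vv)) + H * η)
      ∧ 0 ≤ 2 * √(σ * ι / k) + 14 * H * ι / k := by
  set Q := √(η * (vr + vv)) with hQ
  have hQ0 : 0 ≤ Q := Real.sqrt_nonneg _
  have hr1 : √(η * vr) ≤ Q :=
    Real.sqrt_le_sqrt (mul_le_mul_of_nonneg_left (by linarith) hη.le)
  have hr2 : √(η * vv) ≤ Q :=
    Real.sqrt_le_sqrt (mul_le_mul_of_nonneg_left (by linarith) hη.le)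
  have hηH : η ≤ H * η := le_mul_of_one_le_left hη.le hH
  have f1 : |X₁ / k| ≤ 4 * Q + 2 * (H * η) := by
    rw [abs_div, abs_of_pos hk, div_le_iff₀ hk]
    refine d₁.trans ?_
    have h1 : 2 * √(η * vr) + η ≤ 2 * Q + H * η := by linarith
    calc _ ≤ ν * (2 * Q + H * η) := mul_le_mul_of_nonneg_left h1 hν.le
      _ ≤ 2 * k * (2 * Q + H * η) := mul_le_mul_of_nonneg_right hνk (by positivity)
      _ = _ := by ring
  have f2 : |X₂ / k| ≤ 10 * Q + 2 * (H * η) := by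
    rw [abs_div, abs_of_pos hk, div_le_iff₀ hk]
    refine d₂.trans ?_
    have h1 : 5 * √(η * vv) + η * H ≤ 5 * Q + H * η := by linarith
    calc _ ≤ ν * (5 * Q + H * η) := mul_le_mul_of_nonneg_left h1 hν.le
      _ ≤ 2 * k * (5 * Q + H * η) := mul_le_mul_of_nonneg_right hνk (by positivity)
      _ = _ := by ring
  have f3 : σ ≤ 6 * (vr + vv) + 4 * (H ^ 2 * η) := by
    refine hσ.trans ?_
    rw [← add_div, div_le_iff₀ hk]
    refine (add_le_add d₃ d₄).trans ?_
    have hHH : η ≤ H ^ 2 * η := le_mul_of_one_le_left hη.le (one_le_pow₀ hH)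
    have h1 : (2 * vr + η) + (3 * vv + η * H ^ 2) ≤ 3 * (vr + vv) + 2 * (H ^ 2 * η) := by
      linarith
    calc _ = ν * ((2 * vr + η) + (3 * vv + η * H ^ 2)) := by ring
      _ ≤ ν * (3 * (vr + vv) + 2 * (H ^ 2 * η)) := mul_le_mul_of_nonneg_left h1 hν.le
      _ ≤ 2 * k * (3 * (vr + vv) + 2 * (H ^ 2 * η)) :=
          mul_le_mul_of_nonneg_right hνk (by positivity)
      _ = _ := by ring
  have f4 : ι / k ≤ 2 / 5 * η := by
    rw [div_le_iff₀ hk]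
    have := mul_le_mul_of_nonneg_left hνk hη.le
    linarith
  have f4' : 0 ≤ ι / k := div_nonneg hι hk.le
  have f5 : √(σ * ι / k) ≤ 2 * Q + 2 * (H * η) := by
    refine Real.sqrt_le_iff.2 ⟨by positivity, ?_⟩
    have hQ2 : Q ^ 2 = η * (vr + vv) := Real.sq_sqrt (by positivity)
    calc _ = σ * (ι / k) := mul_div_assoc ..
      _ ≤ (6 * (vr + vv) + 4 * (H ^ 2 * η)) * (ι / k) := mul_le_mul_of_nonneg_right f3 f4'
      _ ≤ (6 * (vr + vv) + 4 * (H ^ 2 * η)) * (2 / 5 * η) :=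
          mul_le_mul_of_nonneg_left f4 (by positivity)
      _ = 12 / 5 * Q ^ 2 + 8 / 5 * (H * η) ^ 2 := by rw [hQ2]; ring
      _ ≤ _ := by
          have : 0 ≤ Q * (H * η) := by positivity
          nlinarith [sq_nonneg Q, sq_nonneg (H * η)]
  have f6 : 14 * H * ι / k ≤ 14 * H * (2 / 5 * η) := by
    rw [mul_div_assoc]
    exact mul_le_mul_of_nonneg_left f4 (by positivity)
  refine ⟨by linarith, by positivity⟩

namespace EpisodicMDP

open APVI Concentration

variable {S A : Type*} [Fintype S] [Fintype A] {H n : ℕ}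

lemma bellman_nonneg (M : EpisodicMDP S A H) (h : Fin H) {V : S → ℝ} (hV : ∀ s, 0 ≤ V s) (s : S)
    (a : A) : 0 ≤ M.bellman h V s a :=
  add_nonneg (M.meanReward_mem h s a).1
    (Finset.sum_nonneg fun s' _ => mul_nonneg (M.P_nonneg ..) (hV s'))

lemma sum_P_mul_le (M : EpisodicMDP S A H) (h : Fin H) {V : S → ℝ} {B : ℝ} (s : S) (a : A)
    (hV : ∀ s', 0 < M.P h s a s' → V s' ≤ B) : ∑ s', M.P h s a s' * V s' ≤ B := by
  calc _ ≤ ∑ s', M.P h s a s' * B := by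
        refine Finset.sum_le_sum fun s' _ => ?_
        rcases (M.P_nonneg h s a s').eq_or_lt with h0 | h0
        · simp [← h0]
        · exact mul_le_mul_of_nonneg_left (hV s' h0) h0.le
    _ = B := by rw [← Finset.sum_mul, M.P_sum, one_mul]

variable [DecidableEq S] [DecidableEq A]

/-- On the good event the truncated pessimistic `Q`-function is close to the Bellman update. -/
theorem GoodAt.abs_qBar_sub_le [Nonempty A] {M : EpisodicMDP S A H} {μ : Policy S A H}
    {δ C η : ℝ} {D : Fin n → Episode S A H} {h : Fin H} {s : S} {a : A}
    (hG : M.GoodAt μ δ C η (5 * logFactor S A H δ) D h s a) (hη : 0 < η) (hη' : η ≤ 1 / 16)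
    (hι : 0 ≤ logFactor S A H δ) (hν : 0 < n * M.flow μ h s a)
    (ht : 5 * logFactor S A H δ ≤ η * (n * M.flow μ h s a))
    (hN : ∀ s', 0 < M.stateDist μ h.succ s' →
      |∑ τ, (if (D τ).state h.succ = s' then (1 : ℝ) else 0) - n * M.stateDist μ h.succ s'|
        ≤ 2 * √η * (n * M.stateDist μ h.succ s') ∨
      M.centered h (vMax δ C D h.succ) s a s' = 0) :
    |qBar δ C D h (vMax δ C D h.succ) s a - M.bellman h (vMax δ C D h.succ) s a|
      ≤ 18 * (√(η * M.stepVariance h (vMax δ C D h.succ) s a) + H * η) := by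
  have hH : (1 : ℝ) ≤ H := by exact_mod_cast (Nat.zero_le _).trans_lt h.2
  have hV0 : ∀ s, 0 ≤ vMax δ C D h.succ s := vMax_nonneg δ C D _
  -- One unit is left for the current reward, so the Bellman update lies in `[0, H - h]` and
  -- truncation to that interval cannot increase the error.
  have hV1 : ∀ s, vMax δ C D h.succ s ≤ (H : ℝ) - (h : ℕ) - 1 := fun s =>
    (vMax_le δ C D _ s).trans (by simp [sub_sub])
  have hb : M.bellman h (vMax δ C D h.succ) s a ≤ (H : ℝ) - (h : ℕ) := by
    have h1 := (M.meanReward_mem h s a).2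
    have h2 := M.sum_P_mul_le h (V := vMax δ C D h.succ) s a fun s' _ => hV1 s'
    rw [bellman]; linarith
  refine (abs_max_min_sub_le (M.bellman_nonneg h hV0 s a) hb).trans ?_
  have hk := hG.count_ge hη' ht
  have hk0 : (0 : ℝ) < count D h s a := by linarith
  have hc : count D h s a ≠ 0 := by
    intro h0; rw [h0] at hk0; simp at hk0
  obtain ⟨d3, d4⟩ := hG.value_dev hη hη' ht hN
  rw [stepVariance_eq]
  obtain ⟨k1, k2⟩ := deviation_le hH hη hk0 (by linarith) hν (M.rewardVar_nonneg h s a)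
    (M.valueVar_nonneg h (vMax δ C D h.succ) s a) hι ht (hG.reward_dev hη ht) d3
    (hG.reward_sq ht) d4 (add_le_add (rewardVarHat_le D h s a hc (M.meanReward h s a))
      (valueVarHat_le D h (vMax δ C D h.succ) s a hc
        (∑ s', M.P h s a s' * vMax δ C D h.succ s')))
  have e1 := rewardHat_sub D h s a hc (M.meanReward h s a)
  have e2 := sum_transHat_mul_sub D h s a hc (vMax δ C D h.succ)
    (∑ s', M.P h s a s' * vMax δ C D h.succ s')
  simp only [centered] at k1
  rw [← e1, ← e2] at k1
  rw [bellman, bonus, if_neg hc, stepVarHat]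
  have g1 := abs_le.1 (le_refl |rewardHat D h s a - M.meanReward h s a|)
  have g2 := abs_le.1 (le_refl |∑ s', transHat D h s a s' * vMax δ C D h.succ s'
    - ∑ s', M.P h s a s' * vMax δ C D h.succ s'|)
  rw [abs_le]
  constructor <;> linarith

end EpisodicMDP

/-! ### Inequalities for square roots, used along trajectories. -/

lemma sum_mul_sqrt_le {ι : Type*} [Fintype ι] {p x : ι → ℝ} (hp : ∀ i, 0 ≤ p i)
    (hp1 : ∑ i, p i = 1) (hx : ∀ i, 0 ≤ x i) : ∑ i, p i * √(x i) ≤ √(∑ i, p i * x i) := by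
  refine Real.le_sqrt_of_sq_le ?_
  set m := ∑ i, p i * √(x i) with hm
  have h1 : 0 ≤ ∑ i, p i * (√(x i) - m) ^ 2 :=
    Finset.sum_nonneg fun i _ => mul_nonneg (hp i) (sq_nonneg _)
  have h2 : ∑ i, p i * (√(x i) - m) ^ 2 = ∑ i, p i * x i - 2 * m * m + m ^ 2 := by
    have : ∀ i, p i * (√(x i) - m) ^ 2
        = p i * x i - 2 * m * (p i * √(x i)) + p i * m ^ 2 := by
      intro i
      rw [sub_sq, Real.sq_sqrt (hx i)]; ring
    simp only [this, Finset.sum_add_distrib, Finset.sum_sub_distrib, ← Finset.mul_sum,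
      ← Finset.sum_mul, hp1, one_mul, ← hm]
  nlinarith

lemma sqrt_add_sqrt_mul_le {k u v : ℝ} (hk : 0 ≤ k) (hu : 0 ≤ u) (hv : 0 ≤ v) :
    √v + √(k * u) ≤ √((k + 1) * (v + u)) := by
  refine Real.le_sqrt_of_sq_le ?_
  have h1 : √v * √(k * u) = √(k * v) * √u := by
    rw [← Real.sqrt_mul hv, ← Real.sqrt_mul (mul_nonneg hk hv)]
    ring_nf
  have h2 := sq_nonneg (√(k * v) - √u)
  rw [sub_sq, Real.sq_sqrt (mul_nonneg hk hv), Real.sq_sqrt hu] at h2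
  rw [add_sq, Real.sq_sqrt hv, Real.sq_sqrt (mul_nonneg hk hu), mul_assoc, h1]
  nlinarith

namespace EpisodicMDP

open APVI

variable {S A : Type*} [Fintype S] [Fintype A] {H n : ℕ}

/-! ### Comparison principles for `evalCost` -/

section Comparison

variable {M : EpisodicMDP S A H} {π : Policy S A H} {Rch : Fin (H + 1) → S → Prop}

/-- Backward induction on the Bellman inequality. It is restricted to a set `Rch` closed under the
possible transitions, because one-step errors are controlled only at covered states. -/
lemma sub_le_evalCost
    (hR : ∀ h s a s', Rch h.castSucc s → 0 < π.prob h s a → 0 < M.P h s a s' → Rch h.succ s')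
    {c : Fin H → S → A → ℝ} {W : Fin (H + 1) → S → ℝ} (hlast : ∀ s, W (Fin.last H) s ≤ 0)
    (hW : ∀ (h : Fin H) s, Rch h.castSucc s → W h.castSucc s
      ≤ ∑ a, π.prob h s a * (c h s a + ∑ s', M.P h s a s' * W h.succ s'))
    (i : Fin (H + 1)) (s : S) (hs : Rch i s) : W i s ≤ M.evalCost π c i s := by
  induction i using Fin.reverseInduction generalizing s with
  | last => simpa using hlast s
  | cast h ih =>
    rw [evalCost_castSucc]
    refine (hW h s hs).trans (Finset.sum_le_sum fun a _ => ?_)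
    rcases (π.nonneg h s a).eq_or_lt with h0 | h0
    · simp [← h0]
    · refine mul_le_mul_of_nonneg_left (add_le_add le_rfl (Finset.sum_le_sum fun s' _ => ?_)) h0.le
      rcases (M.P_nonneg h s a s').eq_or_lt with h1 | h1
      · simp [← h1]
      · exact mul_le_mul_of_nonneg_left (ih s' (hR h s a s' hs h0 h1)) h1.le

lemma evalCost_le_sub
    (hR : ∀ h s a s', Rch h.castSucc s → 0 < π.prob h s a → 0 < M.P h s a s' → Rch h.succ s')
    {c : Fin H → S → A → ℝ} {W : Fin (H + 1) → S → ℝ} (hlast : ∀ s, 0 ≤ W (Fin.last H) s)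
    (hW : ∀ (h : Fin H) s, Rch h.castSucc s →
      ∑ a, π.prob h s a * (c h s a + ∑ s', M.P h s a s' * W h.succ s') ≤ W h.castSucc s)
    (i : Fin (H + 1)) (s : S) (hs : Rch i s) : M.evalCost π c i s ≤ W i s := by
  induction i using Fin.reverseInduction generalizing s with
  | last => simpa using hlast s
  | cast h ih =>
    rw [evalCost_castSucc]
    refine le_trans (Finset.sum_le_sum fun a _ => ?_) (hW h s hs)
    rcases (π.nonneg h s a).eq_or_lt with h0 | h0
    · simp [← h0]
    · refine mul_le_mul_of_nonneg_left (add_le_add le_rfl (Finset.sum_le_sum fun s' _ => ?_)) h0.le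
      rcases (M.P_nonneg h s a s').eq_or_lt with h1 | h1
      · simp [← h1]
      · exact mul_le_mul_of_nonneg_left (ih s' (hR h s a s' hs h0 h1)) h1.le

lemma evalCost_mono
    (hR : ∀ h s a s', Rch h.castSucc s → 0 < π.prob h s a → 0 < M.P h s a s' → Rch h.succ s')
    {c c' : Fin H → S → A → ℝ} (hc : ∀ h s a, Rch h.castSucc s → c h s a ≤ c' h s a)
    (i : Fin (H + 1)) (s : S) (hs : Rch i s) : M.evalCost π c i s ≤ M.evalCost π c' i s := by
  refine sub_le_evalCost hR (fun s => by simp) (fun h s hs => ?_) i s hs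
  rw [evalCost_castSucc]
  exact Finset.sum_le_sum fun a _ => mul_le_mul_of_nonneg_left
    (add_le_add (hc h s a hs) le_rfl) (π.nonneg ..)

lemma evalCost_nonneg {c : Fin H → S → A → ℝ} (hc : ∀ h s a, 0 ≤ c h s a)
    (i : Fin (H + 1)) (s : S) : 0 ≤ M.evalCost π c i s := by
  induction i using Fin.reverseInduction generalizing s with
  | last => simp
  | cast h ih =>
    rw [evalCost_castSucc]
    exact Finset.sum_nonneg fun a _ => mul_nonneg (π.nonneg ..) (add_nonneg (hc h s a)
      (Finset.sum_nonneg fun s' _ => mul_nonneg (M.P_nonneg ..) (ih s')))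

lemma evalCost_const_mul_add (x : ℝ) (c c' : Fin H → S → A → ℝ) (i : Fin (H + 1)) (s : S) :
    M.evalCost π (fun h s a => x * c h s a + c' h s a) i s
      = x * M.evalCost π c i s + M.evalCost π c' i s := by
  induction i using Fin.reverseInduction generalizing s with
  | last => simp
  | cast h ih =>
    simp only [evalCost_castSucc, ih, Finset.mul_sum, ← Finset.sum_add_distrib]
    refine Finset.sum_congr rfl fun a _ => ?_
    have : ∑ s', M.P h s a s' * (x * M.evalCost π c h.succ s' + M.evalCost π c' h.succ s')
        = x * ∑ s', M.P h s a s' * M.evalCost π c h.succ s'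
          + ∑ s', M.P h s a s' * M.evalCost π c' h.succ s' := by
      rw [Finset.mul_sum, ← Finset.sum_add_distrib]
      exact Finset.sum_congr rfl fun _ _ => by ring
    rw [this]
    ring

lemma evalCost_time (k : Fin H → ℝ) (i : Fin (H + 1)) (s : S) :
    M.evalCost π (fun h _ _ => k h) i s = ∑ h : Fin H, if i ≤ h.castSucc then k h else 0 := by
  induction i using Fin.reverseInduction generalizing s with
  | last => simp [Fin.last_le_iff, (Fin.castSucc_lt_last _).ne]
  | cast h ih =>
    simp only [evalCost_castSucc, ih, ← Finset.sum_mul, M.P_sum, π.sum_one, one_mul,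
      Fin.sum_ite_castSucc_le]

lemma evalCost_const_le {k : ℝ} (hk : 0 ≤ k) (i : Fin (H + 1)) (s : S) :
    M.evalCost π (fun _ _ _ => k) i s ≤ H * k := by
  rw [evalCost_time]
  calc _ ≤ ∑ _h : Fin H, k := Finset.sum_le_sum fun h _ => by split_ifs <;> linarith
    _ = _ := by simp

/-- Cauchy–Schwarz along the trajectory, carried out backwards: Jensen's inequality moves the
averages inside the root, and `sqrt_add_sqrt_mul_le` turns `k` remaining steps into `k + 1`. -/
lemma evalCost_sqrt_le {v : Fin H → S → A → ℝ} (hv : ∀ h s a, 0 ≤ v h s a) (i : Fin (H + 1))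
    (s : S) : M.evalCost π (fun h s a => √(v h s a)) i s
      ≤ √(((H : ℝ) - (i : ℕ)) * M.evalCost π v i s) := by
  induction i using Fin.reverseInduction generalizing s with
  | last => simp
  | cast h ih =>
    have hk : (0 : ℝ) ≤ (H : ℝ) - (h.succ : ℕ) := by
      rw [sub_nonneg]
      exact_mod_cast Nat.le_of_lt_succ h.succ.2
    have hG := evalCost_nonneg (M := M) (π := π) hv h.succ
    have hcoe : (H : ℝ) - (h.castSucc : ℕ) = ((H : ℝ) - (h.succ : ℕ)) + 1 := by
      simp only [Fin.val_castSucc, Fin.val_succ]; push_cast; ring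
    rw [hcoe]
    simp only [evalCost_castSucc]
    set k := (H : ℝ) - (h.succ : ℕ)
    have hu : ∀ a, 0 ≤ ∑ s', M.P h s a s' * M.evalCost π v h.succ s' := fun a =>
      Finset.sum_nonneg fun s' _ => mul_nonneg (M.P_nonneg ..) (hG s')
    calc _ ≤ ∑ a, π.prob h s a *
          √((k + 1) * (v h s a + ∑ s', M.P h s a s' * M.evalCost π v h.succ s')) := by
          refine Finset.sum_le_sum fun a _ => mul_le_mul_of_nonneg_left ?_ (π.nonneg ..)
          refine le_trans (add_le_add le_rfl ?_) (sqrt_add_sqrt_mul_le hk (hu a) (hv h s a))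
          calc _ ≤ ∑ s', M.P h s a s' * √(k * M.evalCost π v h.succ s') :=
                Finset.sum_le_sum fun s' _ =>
                  mul_le_mul_of_nonneg_left (ih s') (M.P_nonneg ..)
            _ ≤ √(∑ s', M.P h s a s' * (k * M.evalCost π v h.succ s')) :=
                sum_mul_sqrt_le (M.P_nonneg h s a) (M.P_sum h s a)
                  fun s' => mul_nonneg hk (hG s')
            _ = _ := by
                congr 1
                rw [Finset.mul_sum]
                exact Finset.sum_congr rfl fun _ _ => by ring
      _ ≤ √(∑ a, π.prob h s a *
          ((k + 1) * (v h s a + ∑ s', M.P h s a s' * M.evalCost π v h.succ s'))) :=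
          sum_mul_sqrt_le (π.nonneg h s) (π.sum_one h s) fun a =>
            mul_nonneg (by linarith) (add_nonneg (hv h s a) (hu a))
      _ = _ := by
          congr 1
          rw [Finset.mul_sum]
          exact Finset.sum_congr rfl fun _ _ => by ring

end Comparison

lemma polValue_castSucc (M : EpisodicMDP S A H) (π : Policy S A H) (h : Fin H) (s : S) :
    M.polValue π h.castSucc s
      = ∑ a, π.prob h s a * M.bellman h (M.polValue π h.succ) s a :=
  M.evalCost_castSucc π _ h s

lemma polValue_nonneg (M : EpisodicMDP S A H) (π : Policy S A H) (i : Fin (H + 1)) (s : S) :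
    0 ≤ M.polValue π i s :=
  evalCost_nonneg (fun h s a => (M.meanReward_mem h s a).1) i s

/-! ### The optimal policy -/

@[simp] lemma optValue_last (M : EpisodicMDP S A H) (s : S) : M.optValue (Fin.last H) s = 0 := by
  simp [optValue]

lemma optValue_castSucc (M : EpisodicMDP S A H) (h : Fin H) (s : S) :
    M.optValue h.castSucc s = ⨆ a, M.bellman h (M.optValue h.succ) s a := by
  simp [optValue]

lemma exists_polValue_eq_optValue [Nonempty A] (M : EpisodicMDP S A H) :
    ∃ π : Policy S A H, ∀ i, M.polValue π i = M.optValue i := by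
  classical
  have hmax : ∀ (h : Fin H) (s : S), ∃ a₀, ∀ a, M.bellman h (M.optValue h.succ) s a
      ≤ M.bellman h (M.optValue h.succ) s a₀ := fun h s => Finite.exists_max _
  choose g hg using hmax
  refine ⟨⟨fun h s a => if a = g h s then 1 else 0, fun h s a => by split_ifs <;> norm_num,
    fun h s => by simp⟩, fun i => ?_⟩
  induction i using Fin.reverseInduction with
  | last => funext s; simp [polValue]
  | cast h ih =>
    funext s
    rw [polValue_castSucc, ih, optValue_castSucc]
    simp only [ite_mul, one_mul, zero_mul, Finset.sum_ite_eq', Finset.mem_univ, if_true]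
    exact le_antisymm (le_ciSup (Set.finite_range _).bddAbove (g h s)) (ciSup_le (hg h s))

lemma polValue_le_optValue (M : EpisodicMDP S A H) (π : Policy S A H) (i : Fin (H + 1)) (s : S) :
    M.polValue π i s ≤ M.optValue i s := by
  induction i using Fin.reverseInduction generalizing s with
  | last => simp [polValue]
  | cast h ih =>
    rw [polValue_castSucc, optValue_castSucc]
    calc _ ≤ ∑ a, π.prob h s a * ⨆ a, M.bellman h (M.optValue h.succ) s a := by
          refine Finset.sum_le_sum fun a _ => mul_le_mul_of_nonneg_left ?_ (π.nonneg ..)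
          refine le_trans (add_le_add le_rfl (Finset.sum_le_sum fun s' _ =>
            mul_le_mul_of_nonneg_left (ih s') (M.P_nonneg ..))) (le_ciSup
              (f := fun a => M.bellman h (M.optValue h.succ) s a)
              (Set.finite_range _).bddAbove a)
      _ = _ := by rw [← Finset.sum_mul, π.sum_one, one_mul]

lemma bellman_sub_bellman (M : EpisodicMDP S A H) (h : Fin H) (V W : S → ℝ) (s : S) (a : A) :
    M.bellman h V s a - M.bellman h W s a = ∑ s', M.P h s a s' * (V s' - W s') := by
  simp [bellman, mul_sub, Finset.sum_sub_distrib]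

section Greedy

variable [DecidableEq S] [DecidableEq A] {M : EpisodicMDP S A H} {Rch : Fin (H + 1) → S → Prop}
  {δ C : ℝ} {D : Fin n → Episode S A H} {c : Fin H → S → A → ℝ}

/-- No policy beats the greedy values by more than the accumulated errors. -/
lemma polValue_sub_vMax_le
    (hR : ∀ h s a s', Rch h.castSucc s → 0 < M.P h s a s' → Rch h.succ s')
    (hc : ∀ h s a, Rch h.castSucc s →
      |qBar δ C D h (vMax δ C D h.succ) s a - M.bellman h (vMax δ C D h.succ) s a| ≤ c h s a)
    (π : Policy S A H) (i : Fin (H + 1)) (s : S) (hs : Rch i s) :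
    M.polValue π i s - vMax δ C D i s ≤ M.evalCost π c i s := by
  refine sub_le_evalCost (W := fun i s => M.polValue π i s - vMax δ C D i s)
    (fun h s a s' h1 _ h2 => hR h s a s' h1 h2) (fun s => by simp [polValue])
    (fun h s hs => ?_) i s hs
  -- The maximum dominates the average under any policy, so each step loses at most the error of
  -- `qBar`.
  have h1 : ∑ a, π.prob h s a * qBar δ C D h (vMax δ C D h.succ) s a
      ≤ vMax δ C D h.castSucc s := by
    rw [vMax_castSucc]
    calc _ ≤ ∑ a, π.prob h s a * ⨆ a, qBar δ C D h (vMax δ C D h.succ) s a :=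
          Finset.sum_le_sum fun a _ => mul_le_mul_of_nonneg_left
            (le_ciSup (Set.finite_range _).bddAbove a) (π.nonneg ..)
      _ = _ := by rw [← Finset.sum_mul, π.sum_one, one_mul]
  refine (sub_le_sub_left h1 _).trans ?_
  rw [polValue_castSucc, ← Finset.sum_sub_distrib]
  refine Finset.sum_le_sum fun a _ => ?_
  rw [← mul_sub, ← bellman_sub_bellman]
  refine mul_le_mul_of_nonneg_left ?_ (π.nonneg ..)
  linarith [(abs_le.1 (hc h s a hs)).1]

/-- The greedy values exceed the value of the output by at most the accumulated errors. -/
lemma vMax_sub_polValue_le [Nonempty A]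
    (hR : ∀ h s a s', Rch h.castSucc s → 0 < M.P h s a s' → Rch h.succ s')
    (hc : ∀ h s a, Rch h.castSucc s →
      |qBar δ C D h (vMax δ C D h.succ) s a - M.bellman h (vMax δ C D h.succ) s a| ≤ c h s a)
    {π : Policy S A H} (hπ : IsOutput δ C D π) (i : Fin (H + 1)) (s : S) (hs : Rch i s) :
    vMax δ C D i s - M.polValue π i s ≤ M.evalCost π c i s := by
  refine sub_le_evalCost (W := fun i s => vMax δ C D i s - M.polValue π i s)
    (fun h s a s' h1 _ h2 => hR h s a s' h1 h2) (fun s => by simp [polValue])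
    (fun h s hs => ?_) i s hs
  rw [← hπ.vHat_eq h.castSucc, vHat_castSucc, hπ.vHat_eq, polValue_castSucc,
    ← Finset.sum_sub_distrib]
  refine Finset.sum_le_sum fun a _ => ?_
  rw [mul_comm, ← mul_sub, ← bellman_sub_bellman]
  refine mul_le_mul_of_nonneg_left ?_ (π.nonneg ..)
  linarith [(abs_le.1 (hc h s a hs)).2]

end Greedy

/-! ### Variances -/

lemma stepVariance_nonneg (M : EpisodicMDP S A H) (h : Fin H) (V : S → ℝ) (s : S) (a : A) :
    0 ≤ M.stepVariance h V s a := by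
  rw [stepVariance_eq]
  exact add_nonneg (M.rewardVar_nonneg ..) (M.valueVar_nonneg ..)

lemma valueVar_eq (M : EpisodicMDP S A H) (h : Fin H) (V : S → ℝ) (s : S) (a : A) :
    M.valueVar h V s a
      = ∑ s', M.P h s a s' * V s' ^ 2 - (∑ s', M.P h s a s' * V s') ^ 2 := by
  have h1 : ∀ s', M.P h s a s' * M.centered h V s a s' ^ 2
      = M.P h s a s' * V s' ^ 2 - 2 * (∑ s'', M.P h s a s'' * V s'') * (M.P h s a s' * V s')
        + M.P h s a s' * (∑ s'', M.P h s a s'' * V s'') ^ 2 := by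
    intro s'; simp only [centered]; ring
  simp only [valueVar, h1, Finset.sum_add_distrib, Finset.sum_sub_distrib, ← Finset.mul_sum,
    ← Finset.sum_mul, M.P_sum]
  ring

lemma rewardVar_eq (M : EpisodicMDP S A H) (h : Fin H) (s : S) (a : A) :
    M.rewardVar h s a = ∫ x, x ^ 2 ∂(M.R h s a : Measure ℝ) - M.meanReward h s a ^ 2 := by
  have h1 : ∀ x : ℝ, (x - M.meanReward h s a) ^ 2
      = x ^ 2 - (2 * M.meanReward h s a * x - M.meanReward h s a ^ 2) := fun x => by ring
  simp only [rewardVar, h1]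
  rw [integral_sub (M.integrable_of_continuous h s a _ (by fun_prop))
    (M.integrable_of_continuous h s a _ (by fun_prop)),
    integral_sub (M.integrable_of_continuous h s a _ (by fun_prop)) (integrable_const _),
    integral_const_mul]
  simp only [integral_const, probReal_univ, smul_eq_mul, one_mul]
  rw [show ∫ x, x ∂(M.R h s a : Measure ℝ) = M.meanReward h s a from rfl]
  ring

lemma stepVariance_le (M : EpisodicMDP S A H) (h : Fin H) (V : S → ℝ) (s : S) (a : A)
    (h0 : ∀ s, 0 ≤ V s) (hB : ∀ s, V s ≤ H) : M.stepVariance h V s a ≤ 2 * H ^ 2 := by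
  have hH : (1 : ℝ) ≤ H := by exact_mod_cast (Nat.zero_le _).trans_lt h.2
  have h1 : M.rewardVar h s a ≤ 1 := by
    have : M.rewardVar h s a ≤ ∫ _, (1 : ℝ) ∂(M.R h s a : Measure ℝ) := by
      refine integral_mono_ae (M.integrable_of_continuous h s a _ (by fun_prop))
        (integrable_const _) ?_
      filter_upwards [M.R_mem h s a] with x hx
      have hm := M.meanReward_mem h s a
      rw [sq_le_one_iff_abs_le_one, abs_le]
      constructor <;> linarith [hx.1, hx.2, hm.1, hm.2]
    simpa using this
  have h2 : M.valueVar h V s a ≤ H ^ 2 := by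
    refine M.sum_P_mul_le h s a fun s' _ => ?_
    have := abs_le.1 (M.centered_abs_le h V s a H h0 hB s')
    exact sq_le_sq' this.1 this.2
  rw [stepVariance_eq]
  nlinarith

/-- `Var(V) ≤ 2 Var(W) + 2 Var(V - W)`, the last variance is at most `κ²`, and `√2 ≤ 3/2`. Closeness
is needed only at possible next states. -/
lemma sqrt_stepVariance_le (M : EpisodicMDP S A H) (h : Fin H) (V W : S → ℝ) (s : S) (a : A)
    {κ : ℝ} (hκ : 0 ≤ κ) (hVW : ∀ s', 0 < M.P h s a s' → |V s' - W s'| ≤ κ) :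
    √(M.stepVariance h V s a) ≤ 3 / 2 * (√(M.stepVariance h W s a) + κ) := by
  have hw := M.stepVariance_nonneg h W s a
  have hsq := Real.sq_sqrt hw
  have hs0 := Real.sqrt_nonneg (M.stepVariance h W s a)
  have h1 : M.valueVar h (fun s' => V s' - W s') s a ≤ κ ^ 2 := by
    rw [valueVar_eq]
    refine (sub_le_self _ (sq_nonneg _)).trans (M.sum_P_mul_le h s a fun s' hs' => ?_)
    have := abs_le.1 (hVW s' hs')
    exact sq_le_sq' this.1 this.2
  have h2 : M.valueVar h V s a
      ≤ 2 * M.valueVar h W s a + 2 * M.valueVar h (fun s' => V s' - W s') s a := by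
    simp only [valueVar, Finset.mul_sum, ← Finset.sum_add_distrib]
    refine Finset.sum_le_sum fun s' _ => ?_
    have hc : M.centered h V s a s'
        = M.centered h W s a s' + M.centered h (fun s' => V s' - W s') s a s' := by
      simp only [centered, mul_sub, Finset.sum_sub_distrib]; ring
    rw [hc]
    have := mul_nonneg (M.P_nonneg h s a s') (sq_nonneg
      (M.centered h W s a s' - M.centered h (fun s' => V s' - W s') s a s'))
    nlinarith
  refine Real.sqrt_le_iff.2 ⟨by positivity, ?_⟩
  have hr := M.rewardVar_nonneg h s a
  have h3 : M.stepVariance h V s a ≤ 2 * M.stepVariance h W s a + 2 * κ ^ 2 := by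
    rw [stepVariance_eq, stepVariance_eq]; linarith
  have := mul_nonneg hs0 hκ
  nlinarith [sq_nonneg κ]

end EpisodicMDP

namespace EpisodicMDP

open APVI

variable {S A : Type*} [Fintype S] [Fintype A] {H n : ℕ}
variable [MeasurableSpace S] [MeasurableSpace A]
variable [MeasurableSingletonClass S] [MeasurableSingletonClass A]

/-! ### Consequences of a bound on the total reward -/

section Bounded

variable {M : EpisodicMDP S A H} {B : ℝ}

lemma TotalRewardLE.ae_tail_le (hB : M.TotalRewardLE B) (π : Policy S A H) :
    ∀ᵐ e ∂(M.episodeLaw π), 0 ≤ B ∧ (∀ h, e.reward h ≤ B) ∧ ∀ h₀, e.tailReward h₀ ≤ B := by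
  filter_upwards [hB π, M.ae_reward_mem π] with e he hr
  refine ⟨(Finset.sum_nonneg fun h _ => (hr h).1).trans he, fun h =>
    (Finset.single_le_sum (f := fun h => e.reward h) (fun h _ => (hr h).1)
      (Finset.mem_univ h)).trans he, fun h₀ => le_trans ?_ he⟩
  refine Finset.sum_le_sum fun h _ => ?_
  split_ifs
  · exact le_rfl
  · exact (hr h).1

lemma TotalRewardLE.nonneg (hB : M.TotalRewardLE B) (π : Policy S A H) : 0 ≤ B :=
  (hB.ae_tail_le π).exists.choose_spec.1

/-- Rewards are nonnegative, so the tail of the total reward is almost surely at most `B`;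
conditioning on a state of positive probability transfers the bound to its value. -/
lemma TotalRewardLE.polValue_le (hB : M.TotalRewardLE B) (π : Policy S A H) (i : Fin (H + 1))
    (s : S) (hs : 0 < M.stateDist π i s) : M.polValue π i s ≤ B := by
  classical
  induction i using Fin.lastCases with
  | last => simpa [polValue] using hB.nonneg π
  | cast h =>
    have h1 := M.integral_state_mul_tailReward π h (fun t => if t = s then 1 else 0)
    simp only [ite_mul, one_mul, zero_mul, mul_ite, mul_zero, Finset.sum_ite_eq',
      Finset.mem_univ, if_true] at h1
    have h2 := M.integral_step π h (fun t _ _ _ => if t = s then B else 0)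
      fun _ _ _ => integrable_const _
    have h3 : ∫ e : Episode S A H, (if e.state h.castSucc = s then B else 0) ∂(M.episodeLaw π)
        = M.stateDist π h.castSucc s * B := by
      rw [h2]
      simp [← Finset.sum_mul, M.P_sum, π.sum_one]
    have h4 : M.stateDist π h.castSucc s * M.polValue π h.castSucc s
        ≤ M.stateDist π h.castSucc s * B := by
      rw [← h1, ← h3]
      refine integral_mono_ae ?_ (M.integrable_step π h (fun t _ _ _ => if t = s then B else 0)
        fun _ _ _ => integrable_const _) ?_
      · have := M.integrable_mul_tailReward π (fun t => if t = s then 1 else 0) h h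
        simpa only [ite_mul, one_mul, zero_mul] using this
      · filter_upwards [hB.ae_tail_le π] with e he
        split_ifs
        · exact he.2.2 h
        · exact le_rfl
    exact le_of_mul_le_mul_left h4 hs

/-- The mean excess `max (r - B) 0`, weighted by the positive probability of the visit, is zero. -/
lemma TotalRewardLE.ae_reward_le (hB : M.TotalRewardLE B) (π : Policy S A H) (h : Fin H) (s : S)
    (a : A) (hs : 0 < M.flow π h s a) : ∀ᵐ x ∂(M.R h s a : Measure ℝ), x ≤ B := by
  classical
  have hcont : Continuous fun x : ℝ => max (x - B) 0 := by fun_prop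
  have h1 := M.integral_visit π h s a _ hcont
  have h2 : ∫ e : Episode S A H, (if e.state h.castSucc = s ∧ e.action h = a then
      max (e.reward h - B) 0 else 0) ∂(M.episodeLaw π) = 0 := by
    refine integral_eq_zero_of_ae ?_
    filter_upwards [hB.ae_tail_le π] with e he
    split_ifs
    · exact max_eq_right (sub_nonpos.2 (he.2.1 h))
    · rfl
  rw [h2] at h1
  have h3 := (mul_eq_zero.1 h1.symm).resolve_left hs.ne'
  have h3' := (integral_eq_zero_iff_of_nonneg (f := fun x : ℝ => max (x - B) 0)
    (fun x => le_max_right _ _) (M.integrable_of_continuous h s a _ hcont)).1 h3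
  filter_upwards [h3'] with x hx
  have h4 : x - B ≤ max (x - B) 0 := le_max_left _ _
  have h5 : max (x - B) 0 = 0 := hx
  linarith

/-- The conditional variances along the trajectory of a policy add up to at most `3 B²`. -/
lemma TotalRewardLE.evalCost_stepVariance_le (hB : M.TotalRewardLE B) (π : Policy S A H)
    (i : Fin (H + 1)) (s : S) (hs : 0 < M.stateDist π i s) :
    M.evalCost π (fun h s a => M.stepVariance h (M.polValue π h.succ) s a) i s
      ≤ 3 * B ^ 2 := by
  have hB0 := hB.nonneg π
  have hflow : ∀ h s a, 0 < M.stateDist π h.castSucc s → 0 < π.prob h s a →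
      0 < M.flow π h s a := fun h s a h1 h2 => mul_pos h1 h2
  have hR : ∀ h s a s', 0 < M.stateDist π h.castSucc s → 0 < π.prob h s a →
      0 < M.P h s a s' → 0 < M.stateDist π h.succ s' := fun h s a s' h1 h2 h3 =>
    (mul_pos (mul_pos h1 h2) h3).trans_le (M.flow_le_stateDist_succ π h s a s')
  -- The potential `3 B V - V²` decreases along the trajectory by at least the conditional variance,
  -- and is at most `3 B²` where `0 ≤ V ≤ B`.
  have key : M.evalCost π (fun h s a => M.stepVariance h (M.polValue π h.succ) s a) i s
      ≤ 3 * B * M.polValue π i s - M.polValue π i s ^ 2 := by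
    refine evalCost_le_sub (Rch := fun i s => 0 < M.stateDist π i s)
      (W := fun i s => 3 * B * M.polValue π i s - M.polValue π i s ^ 2) hR
      (fun s => by simp [polValue]) (fun h s hs => ?_) i s hs
    have hstep : ∀ a, 0 < π.prob h s a → M.stepVariance h (M.polValue π h.succ) s a
        + ∑ s', M.P h s a s' * (3 * B * M.polValue π h.succ s' - M.polValue π h.succ s' ^ 2)
        ≤ 3 * B * M.bellman h (M.polValue π h.succ) s a
          - M.bellman h (M.polValue π h.succ) s a ^ 2 := by
      intro a ha
      have h1 : ∫ x, x ^ 2 ∂(M.R h s a : Measure ℝ) ≤ B * M.meanReward h s a := by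
        rw [meanReward, ← integral_const_mul]
        refine integral_mono_ae (M.integrable_of_continuous h s a _ (by fun_prop))
          (M.integrable_of_continuous h s a _ (by fun_prop)) ?_
        filter_upwards [hB.ae_reward_le π h s a (hflow h s a hs ha), M.R_mem h s a] with x hx hx'
        nlinarith [hx'.1]
      have h2 : ∑ s', M.P h s a s' * M.polValue π h.succ s' ≤ B :=
        M.sum_P_mul_le h s a fun s' hs' => hB.polValue_le π _ s' (hR h s a s' hs ha hs')
      have h3 := (M.meanReward_mem h s a).1
      have h4 : ∑ s', M.P h s a s' *
          (3 * B * M.polValue π h.succ s' - M.polValue π h.succ s' ^ 2)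
          = 3 * B * ∑ s', M.P h s a s' * M.polValue π h.succ s'
            - ∑ s', M.P h s a s' * M.polValue π h.succ s' ^ 2 := by
        rw [Finset.mul_sum, ← Finset.sum_sub_distrib]
        exact Finset.sum_congr rfl fun _ _ => by ring
      rw [stepVariance_eq, rewardVar_eq, valueVar_eq, h4, bellman]
      -- After cancellation the claim is `E r² + 2 r̄ (P V) ≤ 3 B r̄`, with `r̄` the mean reward,
      -- which follows from `E r² ≤ B r̄` and `P V ≤ B`.
      nlinarith [mul_le_mul_of_nonneg_left h2 h3]
    have hjensen : (∑ a, π.prob h s a * M.bellman h (M.polValue π h.succ) s a) ^ 2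
        ≤ ∑ a, π.prob h s a * M.bellman h (M.polValue π h.succ) s a ^ 2 := by
      have := sum_mul_sqrt_le (π.nonneg h s) (π.sum_one h s)
        (x := fun a => M.bellman h (M.polValue π h.succ) s a ^ 2) fun a => sq_nonneg _
      simp only [Real.sqrt_sq (M.bellman_nonneg h (M.polValue_nonneg π h.succ) s _)] at this
      refine (Real.le_sqrt ?_ ?_).1 this
      · exact Finset.sum_nonneg fun a _ => mul_nonneg (π.nonneg ..)
          (M.bellman_nonneg h (M.polValue_nonneg π h.succ) s a)
      · exact Finset.sum_nonneg fun a _ => mul_nonneg (π.nonneg ..) (sq_nonneg _)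
    rw [polValue_castSucc]
    calc _ ≤ ∑ a, π.prob h s a * (3 * B * M.bellman h (M.polValue π h.succ) s a
          - M.bellman h (M.polValue π h.succ) s a ^ 2) := by
          refine Finset.sum_le_sum fun a _ => ?_
          rcases (π.nonneg h s a).eq_or_lt with h0 | h0
          · simp [← h0]
          · exact mul_le_mul_of_nonneg_left (hstep a h0) h0.le
      _ = 3 * B * ∑ a, π.prob h s a * M.bellman h (M.polValue π h.succ) s a
          - ∑ a, π.prob h s a * M.bellman h (M.polValue π h.succ) s a ^ 2 := by
          rw [Finset.mul_sum, ← Finset.sum_sub_distrib]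
          exact Finset.sum_congr rfl fun _ _ => by ring
      _ ≤ _ := by linarith
  have h1 := hB.polValue_le π i s hs
  nlinarith [sq_nonneg (M.polValue π i s)]

end Bounded

lemma performance_le (M : EpisodicMDP S A H) (hH : 1 ≤ H) (π : Policy S A H) :
    M.performance π ≤ ∑ s, M.d₁ s * M.optValue 0 s := by
  rw [M.performance_eq π hH]
  exact Finset.sum_le_sum fun s _ =>
    mul_le_mul_of_nonneg_left (M.polValue_le_optValue π 0 s) (M.d₁_nonneg s)

lemma performance_le_optPerformance (M : EpisodicMDP S A H) (hH : 1 ≤ H) (π : Policy S A H) :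
    M.performance π ≤ M.optPerformance :=
  le_ciSup (f := fun π => M.performance π)
    ⟨_, Set.forall_mem_range.2 fun π => M.performance_le hH π⟩ π

lemma optPerformance_sub_le (M : EpisodicMDP S A H) (hH : 1 ≤ H) (π : Policy S A H) (K : ℝ)
    (hK : ∀ s, 0 < M.d₁ s → M.optValue 0 s - M.polValue π 0 s ≤ K) :
    M.optPerformance - M.performance π ≤ K := by
  have : Nonempty (Policy S A H) := ⟨π⟩
  have h1 : M.optPerformance ≤ ∑ s, M.d₁ s * M.optValue 0 s :=
    ciSup_le fun π => M.performance_le hH π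
  rw [M.performance_eq π hH]
  calc _ ≤ ∑ s, M.d₁ s * M.optValue 0 s - ∑ s, M.d₁ s * M.polValue π 0 s :=
        sub_le_sub_right h1 _
    _ = ∑ s, M.d₁ s * (M.optValue 0 s - M.polValue π 0 s) := by
        rw [← Finset.sum_sub_distrib]
        exact Finset.sum_congr rfl fun _ _ => by ring
    _ ≤ ∑ s, M.d₁ s * K := by
        refine Finset.sum_le_sum fun s _ => ?_
        rcases (M.d₁_nonneg s).eq_or_lt with h0 | h0
        · simp [← h0]
        · exact mul_le_mul_of_nonneg_left (hK s h0) h0.le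
    _ = K := by rw [← Finset.sum_mul, M.d₁_sum, one_mul]

/-! ### The regret on the good event -/

section Regret

variable [DecidableEq S] [DecidableEq A] {M : EpisodicMDP S A H} {Rch : Fin (H + 1) → S → Prop}
  {δ C η : ℝ} {D : Fin n → Episode S A H}

/-- The per-step error of APVI on the good event. -/
def stepError (M : EpisodicMDP S A H) (δ C η : ℝ) (D : Fin n → Episode S A H) (h : Fin H) (s : S)
    (a : A) : ℝ :=
  18 * (√(η * M.stepVariance h (vMax δ C D h.succ) s a) + H * η)

/-- The a priori estimate that starts the bootstrap: it uses only that the variance is at most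
`2H²`. Summed over the `H` steps it gives the `36 H²√η` assumed in `stepError_le`. -/
lemma stepError_le_crude [Nonempty A] (hη : 0 < η) (hη' : η ≤ 1 / 16) (h : Fin H) (s : S)
    (a : A) : M.stepError δ C η D h s a ≤ 36 * (H * √η) := by
  have hH : (1 : ℝ) ≤ H := by exact_mod_cast (Nat.zero_le _).trans_lt h.2
  have hw := M.stepVariance_le h (vMax δ C D h.succ) s a (vMax_nonneg δ C D _)
    (fun s => (vMax_le δ C D _ s).trans (by simp; positivity))
  have hs0 : 0 ≤ √η := Real.sqrt_nonneg _
  have hs : √η ≤ 1 / 4 := by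
    rw [Real.sqrt_le_left (by norm_num)]; linarith
  have hss : √η ^ 2 = η := Real.sq_sqrt hη.le
  have h1 : √(M.stepVariance h (vMax δ C D h.succ) s a) ≤ 3 / 2 * H := by
    refine Real.sqrt_le_iff.2 ⟨by positivity, ?_⟩
    nlinarith
  have h2 : H * η ≤ 1 / 4 * (H * √η) := by
    have := mul_le_mul_of_nonneg_right hs (mul_nonneg hs0 (by linarith : (0 : ℝ) ≤ H))
    have h0 : (H : ℝ) * η = √η * (√η * H) := by linear_combination (-(H : ℝ)) * hss
    linarith
  rw [stepError, Real.sqrt_mul hη.le]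
  have h3 := mul_le_mul_of_nonneg_left h1 hs0
  have h4 : 0 ≤ H * √η := by positivity
  linarith

/-- The second round of the bootstrap. Replacing `V̂` by `W` costs an error of order `H²√η` in the
standard deviation, multiplied by `√η`; hence `990 = 18 · 54 + 18`. -/
lemma stepError_le (hη : 0 < η) (W : Fin (H + 1) → S → ℝ)
    (hW : ∀ i s, Rch i s → |vMax δ C D i s - W i s| ≤ 36 * (H ^ 2 * √η))
    (hR : ∀ h s a s', Rch h.castSucc s → 0 < M.P h s a s' → Rch h.succ s')
    (h : Fin H) (s : S) (a : A) (hs : Rch h.castSucc s) :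
    M.stepError δ C η D h s a
      ≤ 27 * √η * √(M.stepVariance h (W h.succ) s a) + 990 * (H ^ 2 * η) := by
  have hH : (1 : ℝ) ≤ H := by exact_mod_cast (Nat.zero_le _).trans_lt h.2
  have hs0 : 0 ≤ √η := Real.sqrt_nonneg _
  have hss : √η ^ 2 = η := Real.sq_sqrt hη.le
  have h1 := M.sqrt_stepVariance_le h (vMax δ C D h.succ) (W h.succ) s a
    (κ := 36 * (H ^ 2 * √η)) (by positivity) fun s' hs' => hW _ s' (hR h s a s' hs hs')
  have h2 : H * η ≤ H ^ 2 * η :=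
    mul_le_mul_of_nonneg_right (le_self_pow₀ hH two_ne_zero) hη.le
  rw [stepError, Real.sqrt_mul hη.le]
  have h3 := mul_le_mul_of_nonneg_left h1 hs0
  have h4 : √η * (3 / 2 * (√(M.stepVariance h (W h.succ) s a) + 36 * (H ^ 2 * √η)))
      = 3 / 2 * √η * √(M.stepVariance h (W h.succ) s a) + 54 * (H ^ 2 * η) := by
    linear_combination (54 * (H : ℝ) ^ 2) * hss
  rw [h4] at h3
  linarith

lemma evalCost_stepError_le (hη : 0 < η) (W : Fin (H + 1) → S → ℝ)
    (hW : ∀ i s, Rch i s → |vMax δ C D i s - W i s| ≤ 36 * (H ^ 2 * √η))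
    (hR : ∀ h s a s', Rch h.castSucc s → 0 < M.P h s a s' → Rch h.succ s')
    (π : Policy S A H) (s : S) (hs : Rch 0 s) :
    M.evalCost π (M.stepError δ C η D) 0 s
      ≤ 27 * √η * M.evalCost π (fun h s a => √(M.stepVariance h (W h.succ) s a)) 0 s
        + 990 * (H ^ 3 * η) := by
  refine (evalCost_mono (Rch := Rch) (fun h s a s' h1 _ h2 => hR h s a s' h1 h2)
    (fun h s a hs => stepError_le hη W hW hR h s a hs) 0 s hs).trans ?_
  rw [evalCost_const_mul_add]
  have := evalCost_const_le (M := M) (π := π) (k := 990 * (H ^ 2 * η)) (by positivity) 0 s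
  have h2 : (H : ℝ) * (990 * (H ^ 2 * η)) = 990 * (H ^ 3 * η) := by ring
  linarith

lemma stepVariance_le_envNorm (M : EpisodicMDP S A H) (h : Fin H) (s : S) (a : A) :
    M.stepVariance h (M.optValue h.succ) s a ≤ M.envNorm h :=
  le_ciSup (f := fun x : S × A => M.stepVariance h (M.optValue h.succ) x.1 x.2)
    (Set.finite_range _).bddAbove (s, a)

/-- The errors are evaluated along two policies, the output `π` and an optimal `π'`, which doubles
`27` and `990`. For the first bound the reference values are optimal in both cases; for the second
they must be those of the policy followed, since the variance sum is controlled only there. -/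
theorem regret_le [Nonempty A] (hH : 1 ≤ H) (hη : 0 < η) (hη' : η ≤ 1 / 16)
    (hR0 : ∀ s, 0 < M.d₁ s → Rch 0 s)
    (hR : ∀ h s a s', Rch h.castSucc s → 0 < M.P h s a s' → Rch h.succ s')
    (hc : ∀ h s a, Rch h.castSucc s →
      |qBar δ C D h (vMax δ C D h.succ) s a - M.bellman h (vMax δ C D h.succ) s a|
        ≤ M.stepError δ C η D h s a)
    {π : Policy S A H} (hπ : IsOutput δ C D π) :
    M.optPerformance - M.performance π
        ≤ 54 * ∑ h, √(η * M.envNorm h) + 1980 * (H ^ 3 * η) ∧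
    ∀ B, M.TotalRewardLE B → M.optPerformance - M.performance π
        ≤ 54 * √(η * (3 * (H * B ^ 2))) + 1980 * (H ^ 3 * η) := by
  obtain ⟨π', hπ'⟩ := M.exists_polValue_eq_optValue
  have hcrude : ∀ (ρ : Policy S A H) i s, Rch i s →
      M.evalCost ρ (M.stepError δ C η D) i s ≤ 36 * (H ^ 2 * √η) := by
    intro ρ i s hs
    refine (evalCost_mono (Rch := Rch) (fun h s a s' h1 _ h2 => hR h s a s' h1 h2)
      (fun h s a _ => stepError_le_crude (δ := δ) (C := C) (D := D) hη hη' h s a) i s hs).trans ?_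
    refine (evalCost_const_le (by positivity) i s).trans (le_of_eq ?_)
    ring
  have hup := fun ρ i s hs => polValue_sub_vMax_le hR hc ρ i s hs
  have hlow := fun i s hs => vMax_sub_polValue_le hR hc hπ i s hs
  have hWπ : ∀ i s, Rch i s → |vMax δ C D i s - M.polValue π i s| ≤ 36 * (H ^ 2 * √η) := by
    intro i s hs
    rw [abs_le]
    constructor <;> linarith [hup π i s hs, hlow i s hs, hcrude π i s hs]
  have hWo : ∀ i s, Rch i s → |vMax δ C D i s - M.optValue i s| ≤ 36 * (H ^ 2 * √η) := by
    intro i s hs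
    have h1 := hup π' i s hs
    rw [hπ'] at h1
    rw [abs_le]
    constructor <;> linarith [h1, hlow i s hs, hcrude π i s hs, hcrude π' i s hs,
      M.polValue_le_optValue π i s]
  have hsplit : ∀ s, 0 < M.d₁ s → M.optValue 0 s - M.polValue π 0 s
      ≤ M.evalCost π' (M.stepError δ C η D) 0 s + M.evalCost π (M.stepError δ C η D) 0 s := by
    intro s hs
    have h1 := hup π' 0 s (hR0 s hs)
    rw [hπ'] at h1
    linarith [hlow 0 s (hR0 s hs)]
  constructor
  · refine M.optPerformance_sub_le hH π _ fun s hs => (hsplit s hs).trans ?_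
    have key : ∀ ρ : Policy S A H, M.evalCost ρ (M.stepError δ C η D) 0 s
        ≤ 27 * ∑ h, √(η * M.envNorm h) + 990 * (H ^ 3 * η) := by
      intro ρ
      refine (evalCost_stepError_le hη M.optValue hWo hR ρ s (hR0 s hs)).trans ?_
      have h1 : M.evalCost ρ (fun h s a => √(M.stepVariance h (M.optValue h.succ) s a)) 0 s
          ≤ ∑ h, √(M.envNorm h) := by
        refine (evalCost_mono (Rch := fun _ _ => True) (fun _ _ _ _ _ _ _ => trivial)
          (fun h s a _ => Real.sqrt_le_sqrt (M.stepVariance_le_envNorm h s a)) 0 s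
          trivial).trans ?_
        rw [evalCost_time]
        simp
      have h2 : √η * ∑ h, √(M.envNorm h) = ∑ h, √(η * M.envNorm h) := by
        rw [Finset.mul_sum]
        exact Finset.sum_congr rfl fun h _ => (Real.sqrt_mul hη.le _).symm
      have h3 := mul_le_mul_of_nonneg_left h1 (Real.sqrt_nonneg η)
      rw [h2] at h3
      linarith
    linarith [key π, key π']
  · intro B hB
    refine M.optPerformance_sub_le hH π _ fun s hs => (hsplit s hs).trans ?_
    have key : ∀ ρ : Policy S A H,
        (∀ i s, Rch i s → |vMax δ C D i s - M.polValue ρ i s| ≤ 36 * (H ^ 2 * √η)) →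
        M.evalCost ρ (M.stepError δ C η D) 0 s
          ≤ 27 * √(η * (3 * (H * B ^ 2))) + 990 * (H ^ 3 * η) := by
      intro ρ hW
      refine (evalCost_stepError_le hη (M.polValue ρ) hW hR ρ s (hR0 s hs)).trans ?_
      have h1 := evalCost_sqrt_le (M := M) (π := ρ)
        (v := fun h s a => M.stepVariance h (M.polValue ρ h.succ) s a)
        (fun h s a => M.stepVariance_nonneg ..) 0 s
      have h2 := hB.evalCost_stepVariance_le ρ 0 s hs
      have h3 : √(((H : ℝ) - ((0 : Fin (H + 1)) : ℕ)) * M.evalCost ρ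
          (fun h s a => M.stepVariance h (M.polValue ρ h.succ) s a) 0 s)
          ≤ √(3 * (H * B ^ 2)) := by
        refine Real.sqrt_le_sqrt ?_
        have := mul_le_mul_of_nonneg_left h2 (Nat.cast_nonneg (α := ℝ) H)
        simp only [Fin.val_zero, Nat.cast_zero, sub_zero]
        linarith
      have h4 := mul_le_mul_of_nonneg_left (h1.trans h3) (Real.sqrt_nonneg η)
      rw [← Real.sqrt_mul hη.le] at h4
      linarith
    linarith [key π hWπ, key π' (fun i s hs => by rw [hπ']; exact hWo i s hs)]

end Regret

end EpisodicMDP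

namespace EpisodicMDP

open APVI

variable {S A : Type*} [Fintype S] [Fintype A] {H n : ℕ}

/-! ### Deterministic problems -/

lemma IsDeterministic.envNorm_eq_zero {M : EpisodicMDP S A H} (hM : M.IsDeterministic)
    (h : Fin H) : M.envNorm h = 0 := by
  classical
  have key : ∀ s a, M.stepVariance h (M.optValue h.succ) s a = 0 := by
    intro s a
    obtain ⟨⟨s₀, hs₀⟩, x, hx⟩ := hM h s a
    have h0 : ∀ s' ≠ s₀, M.P h s a s' = 0 := by
      have h1 := M.P_sum h s a
      rw [← Finset.add_sum_erase _ _ (Finset.mem_univ s₀), hs₀, add_eq_left,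
        Finset.sum_eq_zero_iff_of_nonneg fun s' _ => M.P_nonneg h s a s'] at h1
      exact fun s' hs' => h1 s' (Finset.mem_erase.2 ⟨hs', Finset.mem_univ _⟩)
    have hsum : ∀ f : S → ℝ, ∑ s', M.P h s a s' * f s' = f s₀ := by
      intro f
      rw [Finset.sum_eq_single s₀ (fun s' _ hs' => by rw [h0 s' hs', zero_mul]) (by simp), hs₀,
        one_mul]
    simp only [stepVariance, bellman, meanReward, hsum, hx, integral_dirac, sub_self]
    norm_num
  simp [envNorm, key]

/-! ### Coverage -/

section Coverage

variable [DecidableEq S] [DecidableEq A] [MeasurableSpace S] [MeasurableSingletonClass S]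
  [MeasurableSpace A] [MeasurableSingletonClass A] {M : EpisodicMDP S A H} {μ : Policy S A H}

lemma occupancy_eq_flow (M : EpisodicMDP S A H) (μ : Policy S A H) (h : Fin H) (s : S) (a : A) :
    M.occupancy μ h s a = M.flow μ h s a := by
  rw [occupancy, stateProb_eq, flow]

lemma minOccupancy_le {h : Fin H} {s : S} {a : A} (hf : 0 < M.flow μ h s a) :
    M.minOccupancy μ ≤ M.flow μ h s a :=
  csInf_le ⟨0, fun _ hx => hx.1.le⟩ ⟨hf, h, s, a, (M.occupancy_eq_flow μ h s a).symm⟩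

lemma exists_flow_pos (M : EpisodicMDP S A H) (μ : Policy S A H) (h : Fin H) :
    ∃ s a, 0 < M.flow μ h s a := by
  obtain ⟨s, -, hs⟩ := Finset.exists_lt_of_sum_lt (s := Finset.univ) (f := fun _ : S => (0 : ℝ))
    (g := M.stateDist μ h.castSucc) (by rw [M.stateDist_sum]; simp)
  obtain ⟨a, -, ha⟩ := Finset.exists_lt_of_sum_lt (s := Finset.univ) (f := fun _ : A => (0 : ℝ))
    (g := μ.prob h s) (by rw [μ.sum_one]; simp)
  exact ⟨s, a, mul_pos hs ha⟩

lemma minOccupancy_pos (hH : 1 ≤ H) (M : EpisodicMDP S A H) (μ : Policy S A H) :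
    0 < M.minOccupancy μ := by
  have hfin : {x | 0 < x ∧ ∃ h s a, x = M.occupancy μ h s a}.Finite := by
    refine (Set.finite_range fun x : Fin H × S × A => M.occupancy μ x.1 x.2.1 x.2.2).subset ?_
    rintro x ⟨-, h, s, a, rfl⟩
    exact ⟨(h, s, a), rfl⟩
  obtain ⟨s, a, hsa⟩ := M.exists_flow_pos μ ⟨0, hH⟩
  have hne : {x | 0 < x ∧ ∃ h s a, x = M.occupancy μ h s a}.Nonempty :=
    ⟨_, hsa, _, s, a, (M.occupancy_eq_flow μ _ s a).symm⟩
  exact (hne.csInf_mem hfin).1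

/-- The policy that reaches `s` may be `μ` itself. Hence the states reached by `μ` are closed under
all actions and contain the starting states, and form a valid region `Rch`. -/
lemma UniformCoverage.flow_pos (hμ : M.UniformCoverage μ) {h : Fin H} {s : S}
    (hs : 0 < M.stateDist μ h.castSucc s) (a : A) : 0 < M.flow μ h s a := by
  rw [← occupancy_eq_flow]
  exact hμ h s ⟨μ, by rwa [stateProb_eq]⟩ a

lemma UniformCoverage.minOccupancy_le_stateDist [Nonempty A] (hμ : M.UniformCoverage μ)
    {h : Fin H} {s : S} (hs : 0 < M.stateDist μ h.castSucc s) :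
    M.minOccupancy μ ≤ M.stateDist μ h.castSucc s := by
  obtain ⟨a⟩ := ‹Nonempty A›
  refine (minOccupancy_le (hμ.flow_pos hs a)).trans (mul_le_of_le_one_right hs.le ?_)
  rw [← μ.sum_one h s]
  exact Finset.single_le_sum (fun a _ => μ.nonneg h s a) (Finset.mem_univ a)

/-- The regret of an output of APVI on the good event. -/
theorem regret_le_of_goodAt [Nonempty A] (hH : 1 ≤ H) (hμ : M.UniformCoverage μ) {δ C η : ℝ}
    {D : Fin n → Episode S A H} (hη : 0 < η) (hη' : η ≤ 1 / 16) (hι : 0 < logFactor S A H δ)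
    (hn : 0 < (n : ℝ)) (hηι : η * (n * M.minOccupancy μ) = 5 * logFactor S A H δ)
    (hG : ∀ h s a, M.GoodAt μ δ C η (5 * logFactor S A H δ) D h s a)
    {π : Policy S A H} (hπ : IsOutput δ C D π) :
    M.optPerformance - M.performance π
        ≤ 54 * ∑ h, √(η * M.envNorm h) + 1980 * (H ^ 3 * η) ∧
    ∀ B, M.TotalRewardLE B → M.optPerformance - M.performance π
        ≤ 54 * √(η * (3 * (H * B ^ 2))) + 1980 * (H ^ 3 * η) := by
  have hle : ∀ x, M.minOccupancy μ ≤ x → 5 * logFactor S A H δ ≤ η * (n * x) := fun x hx => by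
    rw [← hηι]
    gcongr
  refine regret_le (Rch := fun i s => 0 < M.stateDist μ i s) hH hη hη' (fun s hs => hs)
    (fun h s a s' hs hP => ?_) (fun h s a hs => ?_) hπ
  · exact (mul_pos (hμ.flow_pos hs a) hP).trans_le (M.flow_le_stateDist_succ μ h s a s')
  · have hf := hμ.flow_pos hs a
    refine (hG h s a).abs_qBar_sub_le hη hη' hι.le (mul_pos hn hf) (hle _ (minOccupancy_le hf))
      fun s' hs' => ?_
    -- After the final action `minOccupancy` gives no lower bound on state probabilities, but the
    -- value function there is zero.
    by_cases hl : h.succ = Fin.last H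
    · right
      simp [centered, hl]
    · left
      obtain ⟨j, hj⟩ := Fin.exists_castSucc_eq.2 hl
      refine abs_stateCount_sub_le hη (hG h s' a).2.2.2.2.1 (hG h s' a).2.2.2.2.2.1 (hle _ ?_)
      rw [← hj] at hs' ⊢
      exact hμ.minOccupancy_le_stateDist hs'

end Coverage

/-! ### The probability of the good event -/

lemma logFactor_nonneg {H : ℕ} (hH : 1 ≤ H) [Nonempty S] [Nonempty A] {δ : ℝ} (hδ : 0 < δ)
    (hδ' : δ < 1) : 0 ≤ logFactor S A H δ := by
  have h1 : (1 : ℝ) ≤ H * Fintype.card S * Fintype.card A := by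
    exact_mod_cast Nat.one_le_iff_ne_zero.2
      (mul_ne_zero (mul_ne_zero (by omega) Fintype.card_ne_zero) Fintype.card_ne_zero)
  refine Real.log_nonneg ?_
  rw [le_div_iff₀ hδ]
  linarith

lemma two_le_of_nontrivial {H : ℕ} (hH : 1 ≤ H) [Nonempty S] [Nontrivial A] {δ : ℝ} (hδ : 0 < δ)
    (hδ' : δ < 1) : 2 ≤ (H : ℝ) * Fintype.card S * Fintype.card A / δ := by
  have h1 : (1 * 1 * 2 : ℕ) ≤ H * Fintype.card S * Fintype.card A :=
    Nat.mul_le_mul (Nat.mul_le_mul hH Fintype.card_pos) Fintype.one_lt_card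
  have h2 : (2 : ℝ) ≤ H * Fintype.card S * Fintype.card A := by exact_mod_cast h1
  rw [le_div_iff₀ hδ]
  linarith

/-- With `x = HSA/δ` the left side is `9 x δ / x⁵`. It is at most `δ` because `x ≥ 2` and `9 ≤ 2⁴`;
this is why `5ι` is used in the exponent and two actions are required. -/
lemma union_bound_le {H : ℕ} (hH : 1 ≤ H) [Nonempty S] [Nontrivial A] {δ : ℝ} (hδ : 0 < δ)
    (hδ' : δ < 1) : 9 * (H * Fintype.card S * Fintype.card A)
      * Real.exp (-(5 * logFactor S A H δ)) ≤ δ := by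
  have h2 := two_le_of_nontrivial (S := S) (A := A) hH hδ hδ'
  rw [logFactor]
  set x := (H : ℝ) * Fintype.card S * Fintype.card A / δ with hx
  have hx0 : 0 < x := by linarith
  have h3 : (H : ℝ) * Fintype.card S * Fintype.card A = x * δ := by
    rw [hx, div_mul_cancel₀ _ hδ.ne']
  have h4 : Real.exp (-(5 * Real.log x)) = (x ^ 5)⁻¹ := by
    rw [Real.exp_neg, mul_comm, Real.exp_mul, Real.exp_log hx0]
    norm_cast
  rw [h3, h4, ← div_eq_mul_inv, div_le_iff₀ (by positivity)]
  have h5 : (2 : ℝ) ^ 4 ≤ x ^ 4 := pow_le_pow_left₀ (by norm_num) h2 4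
  have h6 : 9 * (x * δ) ≤ x ^ 4 * (x * δ) :=
    mul_le_mul_of_nonneg_right (by linarith) (by positivity)
  calc _ ≤ _ := h6
    _ = _ := by ring

section Main

variable [DecidableEq S] [DecidableEq A] [MeasurableSpace S] [MeasurableSingletonClass S]
  [MeasurableSpace A] [MeasurableSingletonClass A]

lemma optPerformance_eq_of_subsingleton [Subsingleton A] (M : EpisodicMDP S A H) (hH : 1 ≤ H)
    (π : Policy S A H) : M.optPerformance = M.performance π := by
  have : Nonempty (Policy S A H) := ⟨π⟩
  have h1 : ∀ (ρ : Policy S A H) h s a, ρ.prob h s a = 1 := fun ρ h s a => by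
    rw [← ρ.sum_one h s, Fintype.sum_subsingleton _ a]
  have h2 : ∀ ρ : Policy S A H, ρ = π := by
    rintro ⟨p, hp, hp'⟩
    have h3 := h1 ⟨p, hp, hp'⟩
    cases π with
    | mk q hq hq' =>
      congr
      funext h s a
      exact (h3 h s a).trans (h1 ⟨q, hq, hq'⟩ h s a).symm
  exact le_antisymm (ciSup_le fun ρ => by rw [h2 ρ]) (M.performance_le_optPerformance hH π)

/-- With probability at least `1 - δ`, every output of APVI satisfies both regret bounds. -/
theorem measure_regret_le (hH : 1 ≤ H) (M : EpisodicMDP S A H) (μ : Policy S A H)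
    (hμ : M.UniformCoverage μ) {δ : ℝ} (hδ : 0 < δ) (hδ' : δ < 1) (C : ℝ)
    (hn : 80 * (1 / M.minOccupancy μ) * logFactor S A H δ < n) :
    M.dataLaw μ n {D | ¬ ∀ π : Policy S A H, IsOutput δ C D π →
      0 ≤ M.optPerformance - M.performance π ∧
      M.optPerformance - M.performance π ≤
        216 * ∑ h, √(M.envNorm h * logFactor S A H δ / (n * M.minOccupancy μ))
          + 9900 * (H ^ 3 * logFactor S A H δ / (n * M.minOccupancy μ)) ∧
      ∀ B : ℝ, M.TotalRewardLE B → M.optPerformance - M.performance π ≤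
        216 * √(H * B ^ 2 * logFactor S A H δ / (n * M.minOccupancy μ))
          + 9900 * (H ^ 3 * logFactor S A H δ / (n * M.minOccupancy μ))}
      ≤ ENNReal.ofReal δ := by
  obtain ⟨s₀, a₀, -⟩ := M.exists_flow_pos μ ⟨0, hH⟩
  have : Nonempty S := ⟨s₀⟩
  have : Nonempty A := ⟨a₀⟩
  have hι := logFactor_nonneg (S := S) (A := A) hH hδ hδ'
  have hd := M.minOccupancy_pos hH μ
  -- With a single action the union bound may fail, but there is only one policy and the regret is
  -- zero.
  rcases subsingleton_or_nontrivial A with hA | hA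
  · refine (measure_mono_null (t := ∅) ?_ measure_empty).le.trans zero_le
    rw [Set.subset_empty_iff, Set.eq_empty_iff_forall_notMem]
    intro D hD
    refine hD fun π _ => ?_
    rw [M.optPerformance_eq_of_subsingleton hH π, sub_self]
    exact ⟨le_rfl, by positivity, fun B _ => by positivity⟩
  have hn0 : (0 : ℝ) < n := lt_of_le_of_lt (by positivity) hn
  have hι' : 0 < logFactor S A H δ :=
    Real.log_pos (by linarith [two_le_of_nontrivial (S := S) (A := A) hH hδ hδ'])
  have hnd : 0 < n * M.minOccupancy μ := mul_pos hn0 hd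
  -- With this `η` the tail level `5ι` is at most `η` times the mean count at every covered pair,
  -- and `80 = 5 · 16` makes `η ≤ 1/16`.
  set η := 5 * logFactor S A H δ / (n * M.minOccupancy μ) with hηdef
  have hη : 0 < η := by positivity
  have hη' : η ≤ 1 / 16 := by
    rw [hηdef, div_le_iff₀ hnd]
    have h1 : 80 * (1 / M.minOccupancy μ) * logFactor S A H δ
        = 80 * logFactor S A H δ / M.minOccupancy μ := by ring
    rw [h1, div_lt_iff₀ hd] at hn
    linarith
  have hηι : η * (n * M.minOccupancy μ) = 5 * logFactor S A H δ := div_mul_cancel₀ _ hnd.ne'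
  -- Both factors `5` (from `η`) and `15` (from `η` and `3 B²`) are below `16`, so the constant
  -- becomes `54 · 4 = 216`.
  have hsqrt : ∀ x y : ℝ, x ≤ 16 * y → √x ≤ 4 * √y := fun x y hxy => by
    have h4 : √(16 : ℝ) = 4 := by
      rw [show (16 : ℝ) = 4 ^ 2 by norm_num, Real.sqrt_sq (by norm_num)]
    rw [← h4, ← Real.sqrt_mul (by norm_num)]
    exact Real.sqrt_le_sqrt hxy
  have hcube : 1980 * (H ^ 3 * η)
      = 9900 * (H ^ 3 * logFactor S A H δ / (n * M.minOccupancy μ)) := by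
    rw [hηdef]; ring
  refine (measure_mono fun D hD => ?_).trans
    ((M.measure_exists_not_goodAt_le μ n δ C η (5 * logFactor S A H δ) (by linarith)).trans
      (ENNReal.ofReal_le_ofReal (union_bound_le hH hδ hδ')))
  by_contra hcon
  have hG : ∀ h s a, M.GoodAt μ δ C η (5 * logFactor S A H δ) D h s a := by
    simpa using hcon
  refine hD fun π hπ => ?_
  obtain ⟨h1, h2⟩ := regret_le_of_goodAt hH hμ hη hη' hι' hn0 hηι hG hπ
  refine ⟨sub_nonneg.2 (M.performance_le_optPerformance hH π), ?_, fun B hB => ?_⟩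
  · rw [hcube] at h1
    refine h1.trans (add_le_add_left ?_ _)
    have : ∑ h, √(η * M.envNorm h)
        ≤ 4 * ∑ h, √(M.envNorm h * logFactor S A H δ / (n * M.minOccupancy μ)) := by
      rw [Finset.mul_sum]
      refine Finset.sum_le_sum fun h _ => hsqrt _ _ ?_
      have hQ : 0 ≤ M.envNorm h := Real.iSup_nonneg fun x => M.stepVariance_nonneg ..
      have h3 : η * M.envNorm h
          = 5 * (M.envNorm h * logFactor S A H δ / (n * M.minOccupancy μ)) := by
        rw [hηdef]; ring
      rw [h3]
      gcongr
      norm_num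
    linarith
  · have h3 := h2 B hB
    rw [hcube] at h3
    refine h3.trans (add_le_add_left ?_ _)
    have : √(η * (3 * (H * B ^ 2)))
        ≤ 4 * √(H * B ^ 2 * logFactor S A H δ / (n * M.minOccupancy μ)) := by
      refine hsqrt _ _ ?_
      have h4 : η * (3 * (H * B ^ 2))
          = 15 * (H * B ^ 2 * logFactor S A H δ / (n * M.minOccupancy μ)) := by
        rw [hηdef]; ring
      rw [h4]
      gcongr
      norm_num
    linarith

end Main

end EpisodicMDP

end

/-! ### The two claims, read off from a single event. -/

theorem mainTheorem9 :
    ∃ c₀ C₁ C₂ : ℝ, 0 < c₀ ∧ 0 < C₁ ∧ 0 < C₂ ∧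
      ∀ (S A : Type*) [Fintype S] [Fintype A] [DecidableEq S] [DecidableEq A]
        [MeasurableSpace S] [MeasurableSingletonClass S]
        [MeasurableSpace A] [MeasurableSingletonClass A]
        (H : ℕ) (_ : 1 ≤ H) (M : EpisodicMDP S A H) (μ : Policy S A H)
        (_ : M.UniformCoverage μ) (δ : ℝ) (_ : 0 < δ) (_ : δ < 1) (C : ℝ) (_ : 0 < C)
        (n : ℕ) (_ : c₀ * (1 / M.minOccupancy μ) * APVI.logFactor S A H δ < n),
        (∀ B : ℝ, M.TotalRewardLE B →
          M.dataLaw μ n {D | ¬ ∀ π : Policy S A H, APVI.IsOutput δ C D π →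
            0 ≤ M.optPerformance - M.performance π ∧
            M.optPerformance - M.performance π ≤
              C₁ * min
                (∑ h : Fin H, √(M.envNorm h * APVI.logFactor S A H δ
                  / (n * M.minOccupancy μ)))
                (√(H * B ^ 2 * APVI.logFactor S A H δ / (n * M.minOccupancy μ)))
              + C₂ * (H ^ 3 * APVI.logFactor S A H δ / (n * M.minOccupancy μ))}
            ≤ ENNReal.ofReal δ) ∧
        (M.IsDeterministic →
          (∀ h, M.envNorm h = 0) ∧
          M.dataLaw μ n {D | ¬ ∀ π : Policy S A H, APVI.IsOutput δ C D π →
            0 ≤ M.optPerformance - M.performance π ∧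
            M.optPerformance - M.performance π ≤
              C₂ * (H ^ 3 * APVI.logFactor S A H δ / (n * M.minOccupancy μ))}
            ≤ ENNReal.ofReal δ) := by
  refine ⟨80, 216, 9900, by norm_num, by norm_num, by norm_num, ?_⟩
  intro S A _ _ _ _ _ _ _ _ H hH M μ hμ δ hδ hδ' C _ n hn
  have key := M.measure_regret_le hH μ hμ hδ hδ' C hn
  refine ⟨fun B hB => le_trans (measure_mono ?_) key,
    fun hM => ⟨hM.envNorm_eq_zero, le_trans (measure_mono ?_) key⟩⟩
  · refine fun D hD hall => hD fun π hπ => ?_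
    obtain ⟨h1, h2, h3⟩ := hall π hπ
    refine ⟨h1, ?_⟩
    -- Both regret bounds hold on the same event, so the minimum costs no additional probability.
    rcases min_choice
      (∑ h : Fin H, √(M.envNorm h * APVI.logFactor S A H δ / (n * M.minOccupancy μ)))
      (√(H * B ^ 2 * APVI.logFactor S A H δ / (n * M.minOccupancy μ))) with h | h <;> rw [h]
    · exact h2
    · exact h3 B hB
  · refine fun D hD hall => hD fun π hπ => ?_
    obtain ⟨h1, h2, -⟩ := hall π hπ
    refine ⟨h1, ?_⟩
    simpa [hM.envNorm_eq_zero] using h2
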